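/- **Setting.** Let $f(x,y)=\tfrac12x^{T}Ax+x^{T}By-\tfrac12y^{T}Cy+u^{T}x+v^{T}y$ on $\mathbb R^n\times\mathbb R^m$, with $A,C$ symmetric, $m_xI\preccurlyeq A\preccurlyeq L_xI$, $m_yI\preccurlyeq C\preccurlyeq L_yI$, $\|B\|_2\le L_{xy}$, $L_x=L_y$ and $0<m_x\le m_y\le\min\{L_{xy},L_x\}$. Put $L=\max\{L_x,L_{xy},L_y\}$, $z=[x;y]$ (Euclidean norm), $J=\begin{pmatrix}A&B\\-B^T&C\end{pmatrix}$, $b=[-u;v]$, and let $z^*$ be the saddle point of $f$ (the solution of $Jz=b$). **Theorem.** There are absolute constants $C_1,C_2>0$ such that for all integers $k\ge1$, all such problems, all $z_0\ne z^*$ and all $\epsilon>0$, the algorithm RHSS($k$) defined below, started at $z_0$ with relative precision $\epsilon/\|z_0-z^*\|$, halts; its output $z_T$ satisfies $\|z_T-z^*\|\le\epsilon$; and it uses at most $$\sqrt{\frac{L_{xy}^2}{m_xm_y}+\Bigl(\frac{L_x}{m_x}+\frac{L_y}{m_y}\Bigr)\Bigl(1+\Bigl(\frac{L_{xy}}{\max\{m_x,m_y\}}\Bigr)^{1/k}\Bigr)}\cdot\Bigl(C_1\max\Bigl\{k,\ln\frac{C_2L^2}{m_xm_y}\Bigr\}\Bigr)^{k+3}\cdot\max\Bigl\{1,\ln\frac{\|z_0-z^*\|}{\epsilon}\Bigr\}$$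 matrix-vector products (each product of $A$, $B$, $B^T$ or $C$ with a vector counts as one; a product with a matrix $sI+tA$ or $sI+tC$ is one product with $A$ or $C$). **RHSS($k$)** on a problem $(A,B,C,u,v)$ with parameters $(m_x,m_y,L_{xy},L_x)$, start $z_0$, relative precision $\delta$. All loops "repeat … until" execute their body at least once. Put $\tilde\delta=m_x\delta/(L_{xy}+L_x)$. *Case $k\ge2$.* Put $\alpha=m_x/m_y$, $\beta=L_{xy}^{-2/k}m_y^{-(k-2)/k}$, $\eta=L_{xy}^{1/k}m_y^{1-1/k}$, $M_1=192L^5/(m_x^2m_y^3)$, $M_2=16L_{xy}/m_y$, $P=\mathrm{diag}(\alpha I+\beta A,\,I+\beta C)$, $G=\mathrm{diag}(A,C)$, $S=J-G$. Repeat for $t=0,1,\dots$: (i) $r=(\eta P-S)z_t+b$; (ii) $z_{t+1/2}$ is the result of the conjugate gradient method for $(\eta P+G)z=r$, started at $z_t$ and stopped when the residual norm is at most $1/M_1$ times the initial one; (iii) $w=(\eta P-G)z_{t+1/2}+b$; (iv) $z_{t+1}$ is the output of RHSS($k-1$) for the system $(\eta P+S)z=w$, which is again a quadratic saddle point problem,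 started at $z_t$ with relative precision $1/M_2$ and parameters $m_x'=\eta\alpha$, $m_y'=\eta$, $L_{xy}'=L_{xy}$, $L_x'=L_y'=2\eta\max\{1,\beta L_x\}$; until $\|Jz_{t+1}-b\|\le\tilde\delta\|Jz_0-b\|$. Output $z_{t+1}$. *Case $k=1$ (Proximal Best Response).* Put $\beta_1=\max\{m_x,L_{xy}\}$, $\beta_2=\max\{m_y,L_{xy}\}$, $\theta(\kappa)=\frac{2\sqrt\kappa-1}{2\sqrt\kappa+1}$, $\tau(\kappa)=\frac1{2\sqrt\kappa+4\kappa}$, $\kappa_1=\beta_1/m_x$, $\kappa_2=\beta_2/m_y$, $N_1=80L^3/(m_xm_y)^{3/2}$, $N_2=96L^{5/2}/(m_xm_y^{3/2})$. - Outer loop: $\hat x_0=x_0$; repeat for $t\ge1$: $z_t$ is the output of the inner loop for $g(x,y)=f(x,y)+\beta_1\|x-\hat x_{t-1}\|^2$ from $z_{t-1}$; $\hat x_t=x_t+\theta(\kappa_1)(x_t-x_{t-1})+\tau(\kappa_1)(x_t-\hat x_{t-1})$; until $\|Jz_t-b\|\le\tilde\delta\|Jz_0-b\|$. Output $z_t$.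 - Inner loop for $g$ from a point $z_0$: $\hat y_0=y_0$; repeat for $t\ge1$: $z_t$ is the output of ABR for $g(x,y)-\beta_2\|y-\hat y_{t-1}\|^2$ from $z_{t-1}$; $\hat y_t=y_t+\theta(\kappa_2)(y_t-y_{t-1})+\tau(\kappa_2)(y_t-\hat y_{t-1})$; until $\|\nabla g(z_t)\|\le\frac{\min\{m_x,m_y\}}{9LN_1}\|\nabla g(z_0)\|$. Output $z_t$. - ABR for $h$ from a point $z_0$: with $\kappa_x=3L/(2\beta_1)$, $\kappa_y=3L/(2\beta_2)$ and $T=\lceil\log_2(4N_2\sqrt{\kappa_x+\kappa_y})\rceil$, for $t=0,\dots,T$ let $x_{t+1}$ be the result of $\lceil2\sqrt{\kappa_x}\ln(24\kappa_x)\rceil$ steps of AGD on $h(\cdot,y_t)$ from $x_t$ with $(l,\mu)=(3L,2\beta_1)$, and then $y_{t+1}$ the result of $\lceil2\sqrt{\kappa_y}\ln(24\kappa_y)\rceil$ steps of AGD on $-h(x_{t+1},\cdot)$ from $y_t$ with $(l,\mu)=(3L,2\beta_2)$. Output $z_{T+1}$. - AGD with $(l,\mu)$ on a function $\phi$ of one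 block from $p_0$: $\tilde p_0=p_0$, $p_t=\tilde p_{t-1}-\frac1l\nabla\phi(\tilde p_{t-1})$, $\tilde p_t=p_t+\frac{\sqrt{l/\mu}-1}{\sqrt{l/\mu}+1}(p_t-p_{t-1})$. -/

import Mathlib

namespace SaddleQuad

/-- A deterministic computation that may fail to halt and that counts matrix-vector products:
`run = none` means that it does not halt, `run = some (a, N)` that it halts with the value `a`
after exactly `N` matrix-vector products. -/
structure Counted (α : Type) where
  run : Option (α × ℕ)

noncomputable section

namespace Counted

/-- Sequential composition adds the numbers of products. -/
instance : Monad Counted where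
  pure a := ⟨some (a, 0)⟩
  bind x f := ⟨x.run.bind fun p => (f p.1).run.map fun q => (q.1, p.2 + q.2)⟩

/-- The computation that never halts. -/
def diverge {α : Type} : Counted α := ⟨none⟩

/-- `for` loop: run `body` exactly `t` times. -/
def iter {σ : Type} (body : σ → Counted σ) : ℕ → σ → Counted σ
  | 0, s => pure s
  | t + 1, s => do
      let s' ← body s
      iter body t s'

open Classical in
/-- `repeat body until halt`: the body is run at least once, and then until the state that it
returns satisfies `halt` for the first time; if this never happens the loop does not halt. -/
def repeatUntil {σ : Type} (body : σ → Counted σ) (halt : σ → Prop) (s : σ) : Counted σ :=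
  if h : ∃ t, ∃ r : σ × ℕ, (iter body (t + 1) s).run = some r ∧ halt r.1 then
    iter body (Nat.find h + 1) s
  else diverge

end Counted

/-- `ℝⁿ` with the Euclidean norm. -/
abbrev Vec (n : ℕ) := EuclideanSpace ℝ (Fin n)

/-- Pairs `[x; y]` with the Euclidean norm `‖[x; y]‖² = ‖x‖² + ‖y‖²`. -/
abbrev PVec (n m : ℕ) := WithLp 2 (Vec n × Vec m)

/-- The pair `[x; y]`. -/
def pair {n m : ℕ} (x : Vec n) (y : Vec m) : PVec n m := WithLp.toLp 2 (x, y)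

/-- The product of a matrix and a vector. -/
def matVec {a b : ℕ} (M : Matrix (Fin a) (Fin b) ℝ) (v : Vec b) : Vec a :=
  Matrix.toEuclideanLin M v

/-- The only primitive through which the algorithms below use a matrix: one matrix-vector product,
at cost one. -/
def mul {a b : ℕ} (M : Matrix (Fin a) (Fin b) ℝ) (v : Vec b) : Counted (Vec a) :=
  ⟨some (matVec M v, 1)⟩

/-- The data of the quadratic function
`f (x, y) = ½ xᵀ A x + xᵀ B y - ½ yᵀ C y + uᵀ x + vᵀ y`. -/
structure QuadSaddle (n m : ℕ) where
  A : Matrix (Fin n) (Fin n) ℝ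
  B : Matrix (Fin n) (Fin m) ℝ
  C : Matrix (Fin m) (Fin m) ℝ
  u : Vec n
  v : Vec m

namespace QuadSaddle

variable {n m : ℕ}

/-- The function `f`. -/
def value (Q : QuadSaddle n m) (x : Vec n) (y : Vec m) : ℝ :=
  1 / 2 * inner ℝ x (matVec Q.A x) + inner ℝ x (matVec Q.B y)
    - 1 / 2 * inner ℝ y (matVec Q.C y) + inner ℝ Q.u x + inner ℝ Q.v y

/-- `z = [x*; y*]` is a saddle point: `f (x, y*) ≥ f (x*, y*) ≥ f (x*, y)` for all `x`, `y`. -/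
def IsSaddle (Q : QuadSaddle n m) (z : PVec n m) : Prop :=
  ∀ (x : Vec n) (y : Vec m),
    Q.value z.fst z.snd ≤ Q.value x z.snd ∧ Q.value z.fst y ≤ Q.value z.fst z.snd

/-- The function class: `A`, `C` are symmetric with `m_x I ≼ A ≼ L_x I` and `m_y I ≼ C ≼ L_y I`,
and the spectral norm of `B` is at most `L_xy`. -/
structure InClass (Q : QuadSaddle n m) (mx my Lx Lxy Ly : ℝ) : Prop where
  A_lower : (Q.A - mx • (1 : Matrix (Fin n) (Fin n) ℝ)).PosSemidef
  A_upper : (Lx • (1 : Matrix (Fin n) (Fin n) ℝ) - Q.A).PosSemidef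
  C_lower : (Q.C - my • (1 : Matrix (Fin m) (Fin m) ℝ)).PosSemidef
  C_upper : (Ly • (1 : Matrix (Fin m) (Fin m) ℝ) - Q.C).PosSemidef
  B_norm : ∀ y : Vec m, ‖matVec Q.B y‖ ≤ Lxy * ‖y‖

/-- `b = [-u; v]`; the saddle point solves `J z = b` with `J = [A, B; -Bᵀ, C]`. -/
def rhs (Q : QuadSaddle n m) : PVec n m := pair (-Q.u) Q.v

/-- The function `f (x, y) + β ‖x - x̂‖²`, up to an additive constant. -/
def addProxX (Q : QuadSaddle n m) (β : ℝ) (xhat : Vec n) : QuadSaddle n m where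
  A := Q.A + (2 * β) • (1 : Matrix (Fin n) (Fin n) ℝ)
  B := Q.B
  C := Q.C
  u := Q.u - (2 * β) • xhat
  v := Q.v

/-- The function `f (x, y) - β ‖y - ŷ‖²`, up to an additive constant. -/
def subProxY (Q : QuadSaddle n m) (β : ℝ) (yhat : Vec m) : QuadSaddle n m where
  A := Q.A
  B := Q.B
  C := Q.C + (2 * β) • (1 : Matrix (Fin m) (Fin m) ℝ)
  u := Q.u
  v := Q.v + (2 * β) • yhat

/-- `∇ₓ f (x, y) = A x + B y + u`. -/
def gradX (Q : QuadSaddle n m) (x : Vec n) (y : Vec m) : Counted (Vec n) := do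
  let p ← mul Q.A x
  let q ← mul Q.B y
  pure (p + q + Q.u)

/-- `∇_y f (x, y) = Bᵀ x - C y + v`. -/
def gradY (Q : QuadSaddle n m) (x : Vec n) (y : Vec m) : Counted (Vec m) := do
  let p ← mul Q.B.transpose x
  let q ← mul Q.C y
  pure (p - q + Q.v)

/-- The full gradient `[∇ₓ f; ∇_y f]`. -/
def grad (Q : QuadSaddle n m) (z : PVec n m) : Counted (PVec n m) := do
  let p ← Q.gradX z.fst z.snd
  let q ← Q.gradY z.fst z.snd
  pure (pair p q)

end QuadSaddle

/-- `[A, B; -Bᵀ, C] [x; y]`. -/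
def saddleMul {n m : ℕ} (A : Matrix (Fin n) (Fin n) ℝ) (B : Matrix (Fin n) (Fin m) ℝ)
    (C : Matrix (Fin m) (Fin m) ℝ) (z : PVec n m) : Counted (PVec n m) := do
  let p₁ ← mul A z.fst
  let p₂ ← mul B z.snd
  let q₁ ← mul B.transpose z.fst
  let q₂ ← mul C z.snd
  pure (pair (p₁ + p₂) (-q₁ + q₂))

/-- `[A, 0; 0, C] [x; y]`. -/
def diagMul {n m : ℕ} (A : Matrix (Fin n) (Fin n) ℝ) (C : Matrix (Fin m) (Fin m) ℝ)
    (z : PVec n m) : Counted (PVec n m) := do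
  let p ← mul A z.fst
  let q ← mul C z.snd
  pure (pair p q)

/-- The residual `J z - b`. -/
def QuadSaddle.residual {n m : ℕ} (Q : QuadSaddle n m) (z : PVec n m) : Counted (PVec n m) := do
  let p ← saddleMul Q.A Q.B Q.C z
  pure (p - Q.rhs)

/-- The parameters known to the algorithms; `Lx` is the common value of `L_x` and `L_y`. -/
structure Params where
  mx : ℝ
  my : ℝ
  Lxy : ℝ
  Lx : ℝ

/-- `L = max {L_x, L_xy, L_y}`. -/
def Params.L (P : Params) : ℝ := max P.Lx P.Lxy

/-! ### Conjugate gradient -/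

/-- Conjugate gradient for `M x = b` from `x₀` with relative precision `ε` in the residual;
`op v` computes `M v`. The loop state is `(x, r, p)`. -/
def conjGrad {n m : ℕ} (op : PVec n m → Counted (PVec n m)) (b x₀ : PVec n m) (ε : ℝ) :
    Counted (PVec n m) := do
  let q₀ ← op x₀
  let r₀ := b - q₀
  let s ← Counted.repeatUntil
    (fun s : PVec n m × PVec n m × PVec n m => do
      let x := s.1
      let r := s.2.1
      let p := s.2.2
      let w ← op p
      let a : ℝ := inner ℝ r r / inner ℝ p w
      let r' := r - a • w
      let c : ℝ := inner ℝ r' r' / inner ℝ r r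
      pure (x + a • p, r', r' + c • p))
    (fun s => ‖s.2.1‖ ≤ ε * ‖r₀‖)
    (x₀, r₀, r₀)
  pure s.1

/-! ### Proximal Best Response -/

/-- Accelerated gradient descent: `T` steps from `x₀` on an `l`-smooth and `μ`-strongly convex
function with gradient `g`. The loop state is `(x_t, x̃_t)`. -/
def agd {d : ℕ} (g : Vec d → Counted (Vec d)) (x₀ : Vec d) (l μ : ℝ) (T : ℕ) :
    Counted (Vec d) := do
  let κ := l / μ
  let θ := (√κ - 1) / (√κ + 1)
  let s ← Counted.iter
    (fun s : Vec d × Vec d => do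
      let G ← g s.2
      let x' := s.2 - (1 / l) • G
      pure (x', x' + θ • (x' - s.1)))
    T (x₀, x₀)
  pure s.1

/-- The number `⌈2 √κ ln (24 κ)⌉` of inner steps. -/
def agdSteps (κ : ℝ) : ℕ := ⌈2 * √κ * Real.log (24 * κ)⌉₊

/-- Alternating Best Response for `min_x max_y g` with the parameters `m_x, m_y, L_x, L_y` and
precision `ε`. The loop runs over `t = 0, …, T` with `T = ⌈log₂ (4 √(κ_x + κ_y) / ε)⌉`. -/
def abr {n m : ℕ} (g : QuadSaddle n m) (z₀ : PVec n m) (ε mx my Lx Ly : ℝ) :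
    Counted (PVec n m) :=
  let κx := Lx / mx
  let κy := Ly / my
  let T := ⌈Real.logb 2 (4 * √(κx + κy) / ε)⌉₊
  Counted.iter
    (fun z => do
      let x' ← agd (fun x => g.gradX x z.snd) z.fst Lx mx (agdSteps κx)
      let y' ← agd (fun y => do
        let G ← g.gradY x' y
        pure (-G)) z.snd Ly my (agdSteps κy)
      pure (pair x' y'))
    (T + 1) z₀

/-- The extrapolation coefficient `θ = (2 √κ - 1) / (2 √κ + 1)` of the proximal point method. -/
def proxTheta (κ : ℝ) : ℝ := (2 * √κ - 1) / (2 * √κ + 1)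

/-- The extrapolation coefficient `τ = 1 / (2 √κ + 4 κ)` of the proximal point method. -/
def proxTau (κ : ℝ) : ℝ := 1 / (2 * √κ + 4 * κ)

/-- The inner accelerated proximal point method, on the variable `y`, applied to `g` with precision
parameter `M₁`; `P` holds the parameters of the original function.
The loop state is `(z_t, ŷ_t, ∇g (z_t))`. -/
def appaAbr {n m : ℕ} (P : Params) (g : QuadSaddle n m) (z₀ : PVec n m) (M₁ : ℝ) :
    Counted (PVec n m) := do
  let β₁ := max P.mx P.Lxy
  let β₂ := max P.my P.Lxy
  let M₂ := 96 * P.L ^ (5 / 2 : ℝ) / (P.mx * P.my ^ (3 / 2 : ℝ))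
  let κ := β₂ / P.my
  let G₀ ← g.grad z₀
  let s ← Counted.repeatUntil
    (fun s : PVec n m × Vec m × PVec n m => do
      let z := s.1
      let yhat := s.2.1
      let z' ← abr (g.subProxY β₂ yhat) z (1 / M₂) (2 * β₁) (2 * β₂) (3 * P.L) (3 * P.L)
      let yhat' := z'.snd + proxTheta κ • (z'.snd - z.snd) + proxTau κ • (z'.snd - yhat)
      let G ← g.grad z'
      pure (z', yhat', G))
    (fun s => ‖s.2.2‖ ≤ min P.mx P.my / (9 * P.L * M₁) * ‖G₀‖)
    (z₀, z₀.snd, G₀)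
  pure s.1

/-- The relative residual `ε̃ = m_x ε / (L_xy + L_x)` at which a run with precision `ε` stops. -/
def epsTilde (P : Params) (ε : ℝ) : ℝ := P.mx * ε / (P.Lxy + P.Lx)

/-- Proximal Best Response, stopped as soon as `‖J z_t - b‖ ≤ ε̃ ‖J z₀ - b‖`.
The loop state is `(z_t, x̂_t, J z_t - b)`. -/
def pbr {n m : ℕ} (P : Params) (Q : QuadSaddle n m) (z₀ : PVec n m) (ε : ℝ) :
    Counted (PVec n m) := do
  let β₁ := max P.mx P.Lxy
  let M₁ := 80 * P.L ^ 3 / (P.mx ^ (3 / 2 : ℝ) * P.my ^ (3 / 2 : ℝ))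
  let κ := β₁ / P.mx
  let R₀ ← Q.residual z₀
  let s ← Counted.repeatUntil
    (fun s : PVec n m × Vec n × PVec n m => do
      let z := s.1
      let xhat := s.2.1
      let z' ← appaAbr P (Q.addProxX β₁ xhat) z M₁
      let xhat' := z'.fst + proxTheta κ • (z'.fst - z.fst) + proxTau κ • (z'.fst - xhat)
      let R ← Q.residual z'
      pure (z', xhat', R))
    (fun s => ‖s.2.2‖ ≤ epsTilde P ε * ‖R₀‖)
    (z₀, z₀.fst, R₀)
  pure s.1

/-! ### Recursive Hermitian/skew-Hermitian splitting -/

/-- `α = m_x / m_y`. -/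
def hssAlpha (P : Params) : ℝ := P.mx / P.my

/-- `β = L_xy^(-2/k) m_y^(-(k-2)/k)`. -/
def hssBeta (k : ℕ) (P : Params) : ℝ :=
  P.Lxy ^ (-(2 / (k : ℝ))) * P.my ^ (-(((k : ℝ) - 2) / (k : ℝ)))

/-- `η = L_xy^(1/k) m_y^(1-1/k)`. -/
def hssEta (k : ℕ) (P : Params) : ℝ :=
  P.Lxy ^ (1 / (k : ℝ)) * P.my ^ (1 - 1 / (k : ℝ))

/-- The parameters handed to the recursive call: `m_x' = η α`, `m_y' = η`, `L_xy' = L_xy` and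
`L_x' = L_y' = 2 η max {1, β L_x}`, which is `2 η β L_x` as soon as `β L_x ≥ 1`. -/
def hssParams (k : ℕ) (P : Params) : Params where
  mx := hssEta k P * hssAlpha P
  my := hssEta k P
  Lxy := P.Lxy
  Lx := 2 * hssEta k P * max 1 (hssBeta k P * P.Lx)

/-- `η (α I + β A)`, the first diagonal block of `η P`.
One product with this matrix costs one product with `A`. -/
def hssBlockX {n m : ℕ} (k : ℕ) (P : Params) (Q : QuadSaddle n m) : Matrix (Fin n) (Fin n) ℝ :=
  hssEta k P • (hssAlpha P • (1 : Matrix (Fin n) (Fin n) ℝ) + hssBeta k P • Q.A)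

/-- `η (I + β C)`, the second diagonal block of `η P`.
One product with this matrix costs one product with `C`. -/
def hssBlockY {n m : ℕ} (k : ℕ) (P : Params) (Q : QuadSaddle n m) : Matrix (Fin m) (Fin m) ℝ :=
  hssEta k P • ((1 : Matrix (Fin m) (Fin m) ℝ) + hssBeta k P • Q.C)

/-- `RHSS(k)` on the problem `Q` with parameters `P`, from the point `z₀` and with relative
precision `ε`. For `k = 1` this is Proximal Best Response; `k = 0` is not used.
For `k ≥ 2` the loop state is `(z_t, J z_t - b)`. -/
def rhss {n m : ℕ} :
    ℕ → Params → QuadSaddle n m → PVec n m → ℝ → Counted (PVec n m)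
  | 0, _, _, _, _ => Counted.diverge
  | 1, P, Q, z₀, ε => pbr P Q z₀ ε
  | k + 2, P, Q, z₀, ε => do
      let M₁ := 192 * P.L ^ 5 / (P.mx ^ 2 * P.my ^ 3)
      let M₂ := 16 * P.Lxy / P.my
      let DX := hssBlockX (k + 2) P Q
      let DY := hssBlockY (k + 2) P Q
      let R₀ ← Q.residual z₀
      let s ← Counted.repeatUntil
        (fun s : PVec n m × PVec n m => do
          let z := s.1
          let p ← saddleMul DX (-Q.B) DY z
          let r := p + Q.rhs
          let zhalf ← conjGrad (diagMul (DX + Q.A) (DY + Q.C)) r z (1 / M₁)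
          let q ← diagMul (DX - Q.A) (DY - Q.C) zhalf
          let w := q + Q.rhs
          let z' ← rhss (k + 1) (hssParams (k + 2) P)
            { A := DX, B := Q.B, C := DY, u := -w.fst, v := w.snd } z (1 / M₂)
          let R ← Q.residual z'
          pure (z', R))
        (fun s => ‖s.2‖ ≤ epsTilde P ε * ‖R₀‖)
        (z₀, R₀)
      pure s.1

end

end SaddleQuad

/-! Every loop contracts a potential. `Meets` is a Hoare triple with a cost bound; an invariant
indexed by the pass number bounds the potential by a geometric sequence, and the number of passes is
the logarithm of the required gain divided by the contraction rate. Outer precisions are stated for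
residuals, and strong monotonicity of `J` turns residuals into distances only at the very end.

Base case. Each of the two proximal loops of Proximal Best Response acts on one block. Eliminating
the other block through its best response leaves a strongly convex quadratic with a reduced Hessian
(`exists_reduced`), and `prox_step` shows that the accelerated proximal point method still contracts
by `1 - a / 4`, with `a = 1 / (2 √κ)`, when its subproblems are solved to a small relative error. In
the innermost problem the coupling is at most half of both moduli, so alternating best responses
halve a weighted error (`meets_abr_step`). The three nested condition numbers `L / L_xy`, `L_xy /
m_y`, `L_xy / m_x` multiply to `L L_xy / (m_x m_y)`, which is the rate for `k = 1` (`pbr_rate`).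

Recursive case. Let `ρ = (m_y / L_xy) ^ (1 / k)`. On each block `N = η P` is `(m / ρ) I + ρ G`,
where `m` is the modulus of that block. In the norm with weight `N⁻¹` the vectors `N z` and `S z`
are orthogonal, so `N - S` and `N + S` are equally large, while the common eigenvalues make `N - G`
smaller than `N + G` by the factor `1 - 2 ρ / 3` (`hss_ratio`). Inexact solves leave the factor `1 -
ρ / 3` (`IsWeight.step`), hence `O(1 / ρ)` passes up to logarithms. The conjugate gradient solve of
a pass is compared with accelerated gradient descent inside the Krylov space (`meets_conjGrad`). The
other solve is a saddle problem with moduli `m_x / ρ`, `m_y / ρ` and the same `L_xy`, whose own `ρ`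
for `k - 1` is the same number (`hssRho_hssParams`).

Cost. `1 / ρ` times the rate of the subproblem is at most three times the rate of the problem
(`rate_hssParams`), and the conjugate gradient solves fit under the same rate (`cg_rate`). So each
level of the induction `meets_rhss` loses only a constant times a logarithm `Λ`. Descending one
level at most doubles `L / m_x`, so one `Λ` of size `k ln 2 + ln (L / m_x)` serves all levels; this
is the source of the maximum of `k` and a logarithm. -/

namespace SaddleQuad

open scoped InnerProductSpace

/-! ### Rules for bounding cost and value of counted computations -/

namespace Counted

variable {α γ σ : Type}

/-- The computation halts, uses at most `N` products, and its value satisfies `post`. -/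
def Meets (c : Counted α) (N : ℝ) (post : α → Prop) : Prop :=
  ∃ a k, c.run = some (a, k) ∧ (k : ℝ) ≤ N ∧ post a

theorem Meets.mono {c : Counted α} {N M : ℝ} {p q : α → Prop} (h : c.Meets N p) (hN : N ≤ M)
    (hpq : ∀ a, p a → q a) : c.Meets M q := by
  obtain ⟨a, k, h1, h2, h3⟩ := h
  exact ⟨a, k, h1, h2.trans hN, hpq a h3⟩

theorem meets_pure {a : α} {p : α → Prop} (h : p a) : (pure a : Counted α).Meets 0 p :=
  ⟨a, 0, rfl, by simp, h⟩

theorem Meets.bind {c : Counted α} {f : α → Counted γ} {N M : ℝ} {p : α → Prop} {q : γ → Prop}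
    (h : c.Meets N p) (hf : ∀ a, p a → (f a).Meets M q) : (c >>= f).Meets (N + M) q := by
  obtain ⟨a, k, h1, h2, h3⟩ := h
  obtain ⟨b, l, h4, h5, h6⟩ := hf a h3
  refine ⟨b, k + l, ?_, by push_cast; linarith, h6⟩
  change (c.run.bind fun p => ((f p.1).run.map fun q => (q.1, p.2 + q.2))) = _
  simp [h1, h4]

theorem Meets.bind_pure {c : Counted α} {f : α → γ} {N : ℝ} {p : α → Prop} {q : γ → Prop}
    (h : c.Meets N p) (hf : ∀ a, p a → q (f a)) :
    (c >>= fun a => pure (f a)).Meets N q := by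
  simpa using h.bind (M := 0) fun a ha => meets_pure (hf a ha)

theorem meets_iter {body : σ → Counted σ} {I : ℕ → σ → Prop} {c : ℝ}
    (hb : ∀ t s, I t s → (body s).Meets c (I (t + 1))) (k : ℕ) :
    ∀ (t : ℕ) (s : σ), I t s → (iter body k s).Meets (k * c) (I (t + k)) := by
  induction k with
  | zero => intro t s h; simpa [iter] using meets_pure (p := I t) h
  | succ k ih =>
    intro t s h
    refine ((hb t s h).bind fun a ha => ih (t + 1) a ha).mono ?_ ?_
    · push_cast; linarith
    · intro a ha; rwa [show t + (k + 1) = t + 1 + k by ring]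

/-- The invariant is indexed by the pass number so that it can carry a geometric bound; once it
forces the stopping test after `T + 1` passes, the first time the test succeeds exists and is no
later. The loop may stop earlier, so the invariant survives only at an unspecified time. -/
theorem meets_repeatUntil {body : σ → Counted σ} {halt : σ → Prop} {I : ℕ → σ → Prop} {c : ℝ}
    {T : ℕ} {s : σ} (hc : 0 ≤ c) (h0 : I 0 s)
    (hb : ∀ t s, I t s → (body s).Meets c (I (t + 1))) (hT : ∀ s, I (T + 1) s → halt s) :
    (repeatUntil body halt s).Meets ((T + 1) * c) (fun s => halt s ∧ ∃ t, I t s) := by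
  classical
  have key : ∀ k, (iter body k s).Meets (k * c) (I k) := fun k => by
    simpa using meets_iter hb k 0 s h0
  have hex : ∃ t, ∃ r : σ × ℕ, (iter body (t + 1) s).run = some r ∧ halt r.1 := by
    obtain ⟨a, k, h1, _, h3⟩ := key (T + 1)
    exact ⟨T, (a, k), h1, hT a h3⟩
  have hle : Nat.find hex ≤ T := by
    obtain ⟨a, k, h1, _, h3⟩ := key (T + 1)
    exact Nat.find_min' hex ⟨(a, k), h1, hT a h3⟩
  obtain ⟨r, hr1, hr2⟩ := Nat.find_spec hex
  obtain ⟨a, k, h1, h2, h3⟩ := key (Nat.find hex + 1)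
  rw [h1] at hr1
  obtain rfl : (a, k) = r := by simpa using hr1
  refine ⟨a, k, ?_, h2.trans ?_, hr2, _, h3⟩
  · unfold repeatUntil
    rw [dif_pos hex]
    convert h1
  · have : ((Nat.find hex : ℕ) : ℝ) ≤ T := by exact_mod_cast hle
    push_cast
    exact mul_le_mul_of_nonneg_right (by linarith) hc

end Counted

open Counted

variable {n m : ℕ}

/-! ### Cost and value of the matrix-vector primitives -/

theorem meets_mul {a b : ℕ} (M : Matrix (Fin a) (Fin b) ℝ) (v : Vec b) :
    (mul M v).Meets 1 (fun w => w = matVec M v) :=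
  ⟨_, 1, rfl, by simp, rfl⟩

theorem meets_gradX (Q : QuadSaddle n m) (x : Vec n) (y : Vec m) :
    (Q.gradX x y).Meets 2 (fun w => w = matVec Q.A x + matVec Q.B y + Q.u) := by
  refine ((meets_mul Q.A x).bind fun p hp =>
    (meets_mul Q.B y).bind_pure fun q hq => ?_).mono (by norm_num) (fun _ h => h)
  rw [hp, hq]

theorem meets_gradY (Q : QuadSaddle n m) (x : Vec n) (y : Vec m) :
    (Q.gradY x y).Meets 2 (fun w => w = matVec Q.B.transpose x - matVec Q.C y + Q.v) := by
  refine ((meets_mul Q.B.transpose x).bind fun p hp =>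
    (meets_mul Q.C y).bind_pure fun q hq => ?_).mono (by norm_num) (fun _ h => h)
  rw [hp, hq]

theorem meets_grad (Q : QuadSaddle n m) (z : PVec n m) :
    (Q.grad z).Meets 4 (fun w => w = pair (matVec Q.A z.fst + matVec Q.B z.snd + Q.u)
      (matVec Q.B.transpose z.fst - matVec Q.C z.snd + Q.v)) := by
  refine ((meets_gradX Q z.fst z.snd).bind fun p hp =>
    (meets_gradY Q z.fst z.snd).bind_pure fun q hq => ?_).mono (by norm_num) (fun _ h => h)
  rw [hp, hq]

theorem meets_saddleMul (A : Matrix (Fin n) (Fin n) ℝ) (B : Matrix (Fin n) (Fin m) ℝ)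
    (C : Matrix (Fin m) (Fin m) ℝ) (z : PVec n m) :
    (saddleMul A B C z).Meets 4 (fun w => w = pair (matVec A z.fst + matVec B z.snd)
      (-matVec B.transpose z.fst + matVec C z.snd)) := by
  refine ((meets_mul A z.fst).bind fun p hp => (meets_mul B z.snd).bind fun q hq =>
    (meets_mul B.transpose z.fst).bind fun r hr =>
    (meets_mul C z.snd).bind_pure fun s hs => ?_).mono (by norm_num) (fun _ h => h)
  rw [hp, hq, hr, hs]

theorem meets_diagMul (A : Matrix (Fin n) (Fin n) ℝ) (C : Matrix (Fin m) (Fin m) ℝ)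
    (z : PVec n m) :
    (diagMul A C z).Meets 2 (fun w => w = pair (matVec A z.fst) (matVec C z.snd)) := by
  refine ((meets_mul A z.fst).bind fun p hp =>
    (meets_mul C z.snd).bind_pure fun q hq => ?_).mono (by norm_num) (fun _ h => h)
  rw [hp, hq]

/-! ### Symmetric operators with spectral bounds -/

section

variable {E : Type*} [NormedAddCommGroup E] [InnerProductSpace ℝ E]

/-- `M` is symmetric and `l I ≼ M ≼ u I`. -/
structure SymBdd (M : E →ₗ[ℝ] E) (l u : ℝ) : Prop where
  symm : ∀ x y, ⟪M x, y⟫_ℝ = ⟪x, M y⟫_ℝ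
  lower : ∀ x, l * ‖x‖ ^ 2 ≤ ⟪x, M x⟫_ℝ
  upper : ∀ x, ⟪x, M x⟫_ℝ ≤ u * ‖x‖ ^ 2

namespace SymBdd

variable {M : E →ₗ[ℝ] E} {l u : ℝ}

theorem mono (h : SymBdd M l u) {l' u' : ℝ} (hl : l' ≤ l) (hu : u ≤ u') : SymBdd M l' u' :=
  ⟨h.symm, fun x => (mul_le_mul_of_nonneg_right hl (sq_nonneg _)).trans (h.lower x),
    fun x => (h.upper x).trans (mul_le_mul_of_nonneg_right hu (sq_nonneg _))⟩

/-- Co-coercivity: combine positivity of `M` at `u • x - M x` with the upper bound at `M x`. No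
spectral theorem is needed. -/
theorem norm_sq_le (h : SymBdd M l u) (hl : 0 ≤ l) (hu : 0 < u) (x : E) :
    ‖M x‖ ^ 2 ≤ u * ⟪x, M x⟫_ℝ := by
  have h1 := (mul_nonneg hl (sq_nonneg _)).trans (h.lower (u • x - M x))
  have h2 := h.upper (M x)
  simp only [map_sub, map_smul, inner_sub_left, inner_sub_right, inner_smul_left,
    inner_smul_right, ← h.symm x (M x), real_inner_self_eq_norm_sq, RCLike.conj_to_real] at h1
  nlinarith

theorem norm_le (h : SymBdd M l u) (hl : 0 ≤ l) (hu : 0 < u) (x : E) : ‖M x‖ ≤ u * ‖x‖ := by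
  have h1 := h.norm_sq_le hl hu x
  have h2 := h.upper x
  refine le_of_sq_le_sq ?_ (by positivity)
  nlinarith

theorem lower_norm (h : SymBdd M l u) (x : E) : l * ‖x‖ ≤ ‖M x‖ := by
  rcases (norm_nonneg x).eq_or_lt with h0 | h0
  · simp [← h0]
  · have h1 := (h.lower x).trans (real_inner_le_norm x (M x))
    exact le_of_mul_le_mul_left (by nlinarith) h0

end SymBdd

/-- A strongly monotone linear operator on a finite-dimensional space is invertible. -/
theorem exists_inverse [FiniteDimensional ℝ E] {M : E →ₗ[ℝ] E} {l : ℝ} (hl : 0 < l)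
    (h : ∀ x, l * ‖x‖ ^ 2 ≤ ⟪x, M x⟫_ℝ) :
    ∃ N : E →ₗ[ℝ] E, (∀ x, M (N x) = x) ∧ ∀ x, N (M x) = x := by
  have hinj : Function.Injective M := by
    rw [injective_iff_map_eq_zero]
    intro x hx
    have := h x
    rw [hx, inner_zero_right] at this
    have h2 : ‖x‖ ^ 2 = 0 := le_antisymm (by nlinarith) (sq_nonneg _)
    simpa using h2
  refine ⟨(LinearEquiv.ofInjectiveEndo M hinj).symm, fun x => ?_, fun x => ?_⟩
  · exact (LinearEquiv.ofInjectiveEndo M hinj).apply_symm_apply x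
  · exact (LinearEquiv.ofInjectiveEndo M hinj).symm_apply_apply x

/-- A strongly monotone operator expands norms. -/
theorem mul_norm_le_of_monotone {M : E →ₗ[ℝ] E} {l : ℝ}
    (h : ∀ x, l * ‖x‖ ^ 2 ≤ ⟪x, M x⟫_ℝ) (x : E) : l * ‖x‖ ≤ ‖M x‖ := by
  rcases (norm_nonneg x).eq_or_lt with h0 | h0
  · simp [← h0]
  · have h1 := (h x).trans (real_inner_le_norm x (M x))
    exact le_of_mul_le_mul_left (by nlinarith) h0

/-! ### Accelerated gradient descent -/

/-- The Lyapunov function `½⟨e, M e⟩ + ½ μ ‖v‖²` of accelerated methods. -/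
noncomputable def energy (M : E →ₗ[ℝ] E) (μ : ℝ) (e v : E) : ℝ :=
  1 / 2 * ⟪e, M e⟫_ℝ + μ / 2 * ‖v‖ ^ 2

/-- The classical estimate for accelerated gradient descent with errors as unknowns: `e` is the
iterate, `et` the extrapolated point, `v` the auxiliary sequence. Strong convexity between `et` and
`e` and between `et` and the minimiser is weighted by `1 - a` and `a`. The coupling `het` makes the
terms linear in the gradient cancel, and `a ^ 2 = μ / l` makes the squared gradient terms cancel. -/
theorem energy_step {M : E →ₗ[ℝ] E} {μ l a : ℝ} (h : SymBdd M μ l) (hμ : 0 < μ) (hl : 0 < l)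
    (ha : a ^ 2 = μ / l) (ha0 : 0 < a) (ha1 : a ≤ 1) {e v et : E}
    (het : (1 + a) • et = e + a • v) :
    energy M μ (et - (1 / l) • M et) ((1 - a) • v + a • et - (a / μ) • M et)
      ≤ (1 - a) * energy M μ e v := by
  set g := M et with hg
  have hal : μ = a ^ 2 * l := by rw [ha]; field_simp
  have h1 : ⟪et - (1 / l) • g, M (et - (1 / l) • g)⟫_ℝ ≤ ⟪et, g⟫_ℝ - ‖g‖ ^ 2 / l := by
    have h2 := h.upper g
    have e1 : ⟪et, M g⟫_ℝ = ‖g‖ ^ 2 := by rw [← h.symm, ← hg, real_inner_self_eq_norm_sq]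
    simp only [map_sub, map_smul, inner_sub_left, inner_sub_right, inner_smul_left,
      inner_smul_right, ← hg, e1, real_inner_self_eq_norm_sq, RCLike.conj_to_real]
    have : 1 / l * (1 / l * ⟪g, M g⟫_ℝ) ≤ 1 / l * (1 / l * (l * ‖g‖ ^ 2)) := by gcongr
    have e2 : 1 / l * (1 / l * (l * ‖g‖ ^ 2)) = ‖g‖ ^ 2 / l := by field_simp
    have e3 : 1 / l * ‖g‖ ^ 2 = ‖g‖ ^ 2 / l := by ring
    linarith
  have h3 : ⟪et, g⟫_ℝ + 2 * ⟪g, e - et⟫_ℝ + μ * ‖e - et‖ ^ 2 ≤ ⟪e, M e⟫_ℝ := by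
    have := h.lower (e - et)
    simp only [map_sub, inner_sub_left, inner_sub_right, ← hg] at this ⊢
    have e1 : ⟪et, M e⟫_ℝ = ⟪g, e⟫_ℝ := by rw [← h.symm]
    have e2 := real_inner_comm g et
    have e3 := real_inner_comm e g
    rw [e1] at this
    linarith
  have h4 : μ * ‖et‖ ^ 2 ≤ ⟪et, g⟫_ℝ := h.lower et
  set w := (1 - a) • v + a • et with hw
  have h5 : ‖w‖ ^ 2 ≤ (1 - a) * ‖v‖ ^ 2 + a * ‖et‖ ^ 2 := by
    have e1 : ‖w‖ ^ 2 = (1 - a) * ‖v‖ ^ 2 + a * ‖et‖ ^ 2 - a * (1 - a) * ‖v - et‖ ^ 2 := by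
      simp only [hw, ← real_inner_self_eq_norm_sq, inner_add_left, inner_add_right,
        inner_sub_left, inner_sub_right, inner_smul_left, inner_smul_right,
        RCLike.conj_to_real, real_inner_comm v et]
      ring
    have : 0 ≤ a * (1 - a) * ‖v - et‖ ^ 2 := by
      have := sub_nonneg.2 ha1
      positivity
    linarith
  have h6 : ‖w - (a / μ) • g‖ ^ 2 = ‖w‖ ^ 2 - 2 * (a / μ) * ⟪g, w⟫_ℝ + (a / μ) ^ 2 * ‖g‖ ^ 2 := by
    rw [norm_sub_sq_real, inner_smul_right, norm_smul, mul_pow, Real.norm_eq_abs, sq_abs,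
      real_inner_comm]
    ring
  -- The coupling enters only here: it moves the inner products of the gradient with `e` and with
  -- `w` onto `et`.
  have h7 : (1 - a) * ⟪g, e - et⟫_ℝ + a * ⟪g, w⟫_ℝ = a * ⟪g, et⟫_ℝ := by
    have e1 : e = (1 + a) • et - a • v := by rw [het]; simp
    rw [e1, hw]
    simp only [inner_sub_right, inner_add_right, inner_smul_right]
    ring
  have h8 : μ / 2 * ((a / μ) ^ 2 * ‖g‖ ^ 2) = ‖g‖ ^ 2 / l / 2 := by
    rw [hal]; field_simp
  have h9 : μ / 2 * (2 * (a / μ) * ⟪g, w⟫_ℝ) = a * ⟪g, w⟫_ℝ := by field_simp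
  have h10 := real_inner_comm et g
  have h11 : 0 ≤ (1 - a) * (μ * ‖e - et‖ ^ 2) := by
    have := sub_nonneg.2 ha1
    positivity
  have h12 := mul_le_mul_of_nonneg_left h3 (sub_nonneg.2 ha1)
  have h13 := mul_le_mul_of_nonneg_left h4 ha0.le
  have h14 := mul_le_mul_of_nonneg_left h5 hμ.le
  have h15 : μ / 2 * ‖w - (a / μ) • g‖ ^ 2
      = μ / 2 * ‖w‖ ^ 2 - a * ⟪g, w⟫_ℝ + ‖g‖ ^ 2 / l / 2 := by
    rw [h6, mul_add, mul_sub, h8, h9]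
  rw [h10] at h7
  unfold energy
  rw [h15]
  linarith

theorem energy_self_le {M : E →ₗ[ℝ] E} {μ l : ℝ} (h : SymBdd M μ l) (e : E) :
    energy M μ e e ≤ ⟪e, M e⟫_ℝ := by
  have := h.lower e
  unfold energy; linarith

theorem le_energy {M : E →ₗ[ℝ] E} {μ : ℝ} (hμ : 0 ≤ μ) (e v : E) :
    ⟪e, M e⟫_ℝ ≤ 2 * energy M μ e v := by
  unfold energy; nlinarith [mul_nonneg hμ (sq_nonneg ‖v‖)]

/-- The momentum step of accelerated gradient descent, in terms of the Lyapunov function. -/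
theorem agd_momentum {a θ : ℝ} (ha : 0 < a) (hθ : θ = (1 - a) / (1 + a)) {e' et e v g : E} {μ l : ℝ}
    (hμ : 0 < μ) (hl : 0 < l) (hal : a ^ 2 = μ / l)
    (het : (1 + a) • et = e + a • v) (he' : e' = et - (1 / l) • g) :
    (1 + a) • (e' + θ • (e' - e)) = e' + a • ((1 - a) • v + a • et - (a / μ) • g) := by
  have h1 : a * (a / μ) = 1 / l := by
    have : μ = a ^ 2 * l := by rw [hal]; field_simp
    rw [this]; field_simp
  have h2 : (1 + a) * θ = 1 - a := by rw [hθ]; field_simp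
  have h3 : e = (1 + a) • et - a • v := by rw [het]; simp
  have h4 : (1 / l) • g = et - e' := by rw [he']; abel
  have h5 : (1 + a) • (e' + θ • (e' - e)) = (1 + a) • e' + ((1 + a) * θ) • (e' - e) := by module
  have h6 : a • ((1 - a) • v + a • et - (a / μ) • g)
      = a • ((1 - a) • v + a • et) - (a * (a / μ)) • g := by module
  rw [h5, h6, h1, h2, h4, h3]
  module

theorem pow_one_sub_le_exp {a : ℝ} (ha1 : a ≤ 1) (T : ℕ) :
    (1 - a) ^ T ≤ Real.exp (-(a * T)) := by
  have h1 : 1 - a ≤ Real.exp (-a) := by linarith [Real.add_one_le_exp (-a)]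
  calc (1 - a) ^ T ≤ Real.exp (-a) ^ T := by gcongr
    _ = Real.exp (-(a * T)) := by rw [← Real.exp_nat_mul]; ring_nf

end

/-- Number of steps after which a geometric sequence with ratio `1 - q` gains a factor `X`. -/
theorem exists_steps {q X : ℝ} (hq : 0 < q) (hq1 : q ≤ 1) (hX : 0 < X) :
    ∃ T : ℕ, X * (1 - q) ^ (T + 1) ≤ 1 ∧ (T : ℝ) + 1 ≤ max 0 (Real.log X) / q + 2 := by
  refine ⟨⌈max 0 (Real.log X) / q⌉₊, ?_, ?_⟩
  · set T := ⌈max 0 (Real.log X) / q⌉₊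
    have h1 : max 0 (Real.log X) / q ≤ T := Nat.le_ceil _
    have h2 : Real.log X ≤ q * ((T + 1 : ℕ) : ℝ) := by
      rw [div_le_iff₀ hq] at h1
      have := le_max_right 0 (Real.log X)
      push_cast
      nlinarith
    calc X * (1 - q) ^ (T + 1) ≤ Real.exp (Real.log X) * Real.exp (-(q * ((T + 1 : ℕ) : ℝ))) := by
          rw [Real.exp_log hX]
          exact mul_le_mul_of_nonneg_left (pow_one_sub_le_exp hq1 _) hX.le
      _ = Real.exp (Real.log X - q * ((T + 1 : ℕ) : ℝ)) := by rw [← Real.exp_add]; ring_nf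
      _ ≤ 1 := Real.exp_le_one_iff.2 (by linarith)
  · have := Nat.ceil_lt_add_one (a := max 0 (Real.log X) / q) (by positivity)
    linarith

theorem sqrt_div_facts {μ l : ℝ} (hμ : 0 < μ) (hl : μ ≤ l) :
    0 < 1 / √(l / μ) ∧ 1 / √(l / μ) ≤ 1 ∧ (1 / √(l / μ)) ^ 2 = μ / l ∧
    (√(l / μ) - 1) / (√(l / μ) + 1) = (1 - 1 / √(l / μ)) / (1 + 1 / √(l / μ)) := by
  have h1 : 1 ≤ l / μ := by rwa [le_div_iff₀ hμ, one_mul]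
  have h2 : 1 ≤ √(l / μ) := by rwa [Real.one_le_sqrt]
  refine ⟨by positivity, ?_, ?_, ?_⟩
  · rw [div_le_one (by linarith)]; exact h2
  · rw [div_pow, Real.sq_sqrt (by linarith)]; field_simp
  · field_simp

/-- The auxiliary sequence `v` is not in the program state. The invariant supplies it existentially,
pinned by the coupling, and starts it at the initial error. -/
theorem meets_agd {d : ℕ} {M : Vec d →ₗ[ℝ] Vec d} {μ l c : ℝ} (h : SymBdd M μ l) (hμ : 0 < μ)
    (hl : μ ≤ l) {g : Vec d → Counted (Vec d)} {xs : Vec d}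
    (hg : ∀ x, (g x).Meets c (fun w => w = M (x - xs))) (x₀ : Vec d) (T : ℕ) :
    (agd g x₀ l μ T).Meets (T * c)
      (fun x => ‖x - xs‖ ^ 2 ≤ 2 * (l / μ) * (1 - 1 / √(l / μ)) ^ T * ‖x₀ - xs‖ ^ 2) := by
  obtain ⟨ha0, ha1, ha2, ha3⟩ := sqrt_div_facts hμ hl
  have hl0 : 0 < l := hμ.trans_le hl
  unfold agd
  simp only [ha3]
  set a := 1 / √(l / μ) with ha
  refine Meets.bind_pure (p := fun s : Vec d × Vec d => ∃ v, (1 + a) • (s.2 - xs) = (s.1 - xs) + a • v ∧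
      energy M μ (s.1 - xs) v ≤ (1 - a) ^ T * energy M μ (x₀ - xs) (x₀ - xs)) ?_ ?_
  · have := meets_iter (σ := Vec d × Vec d) (c := c) (I := fun t s => ∃ v,
        (1 + a) • (s.2 - xs) = (s.1 - xs) + a • v ∧
        energy M μ (s.1 - xs) v ≤ (1 - a) ^ t * energy M μ (x₀ - xs) (x₀ - xs))
      (body := fun s : Vec d × Vec d => do
        let G ← g s.2
        let x' := s.2 - (1 / l) • G
        pure (x', x' + ((1 - a) / (1 + a)) • (x' - s.1))) ?_ T 0 (x₀, x₀) ?_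
    · simpa using this
    · rintro t ⟨x, xt⟩ ⟨v, hv1, hv2⟩
      refine Meets.bind_pure (hg xt) ?_
      rintro G rfl
      refine ⟨(1 - a) • v + a • (xt - xs) - (a / μ) • M (xt - xs), ?_, ?_⟩
      · have := agd_momentum ha0 rfl hμ hl0 ha2 hv1 (g := M (xt - xs))
          (e' := xt - (1 / l) • M (xt - xs) - xs) (by abel)
        rw [← this]
        module
      · have := energy_step h hμ hl0 ha2 ha0 ha1 hv1
        have e1 : xt - (1 / l) • M (xt - xs) - xs = xt - xs - (1 / l) • M (xt - xs) := by abel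
        simp only [e1]
        refine this.trans ?_
        rw [pow_succ, mul_comm ((1 - a) ^ t), mul_assoc]
        exact mul_le_mul_of_nonneg_left hv2 (sub_nonneg.2 ha1)
    · exact ⟨x₀ - xs, by simp only []; module, by simp⟩
  · rintro s ⟨v, -, hv⟩
    have h1 := le_energy (M := M) hμ.le (s.1 - xs) v
    have h2 := energy_self_le h (x₀ - xs)
    have h3 := h.lower (s.1 - xs)
    have h4 := h.upper (x₀ - xs)
    have h5 : 0 ≤ (1 - a) ^ T := pow_nonneg (sub_nonneg.2 ha1) T
    have h6 := mul_le_mul_of_nonneg_left (h2.trans h4) h5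
    have h7 : μ * ‖s.1 - xs‖ ^ 2 ≤ 2 * ((1 - a) ^ T * (l * ‖x₀ - xs‖ ^ 2)) := by linarith
    have e : 2 * (l / μ) * (1 - a) ^ T * ‖x₀ - xs‖ ^ 2
        = 2 * ((1 - a) ^ T * (l * ‖x₀ - xs‖ ^ 2)) / μ := by field_simp
    rw [e, le_div_iff₀ hμ]
    linarith

/-- With `agdSteps` steps, accelerated gradient descent gains a factor `16`. -/
theorem meets_agd_agdSteps {d : ℕ} {M : Vec d →ₗ[ℝ] Vec d} {μ l c : ℝ} (h : SymBdd M μ l)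
    (hμ : 0 < μ) (hl : μ ≤ l) {g : Vec d → Counted (Vec d)} {xs : Vec d}
    (hg : ∀ x, (g x).Meets c (fun w => w = M (x - xs))) (x₀ : Vec d) :
    (agd g x₀ l μ (agdSteps (l / μ))).Meets (agdSteps (l / μ) * c)
      (fun x => ‖x - xs‖ ≤ 1 / 16 * ‖x₀ - xs‖) := by
  refine (meets_agd h hμ hl hg x₀ _).mono le_rfl fun x hx => ?_
  have hκ : 1 ≤ l / μ := by rwa [le_div_iff₀ hμ, one_mul]
  obtain ⟨ha0, ha1, -, -⟩ := sqrt_div_facts hμ hl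
  have h1 := pow_one_sub_le_exp ha1 (agdSteps (l / μ))
  set κ := l / μ
  have h2 : 2 * √κ * Real.log (24 * κ) ≤ agdSteps κ := Nat.le_ceil _
  have hs : 0 < √κ := by positivity
  -- The step count `2 √κ ln (24 κ)` makes the decay at most `(24 κ)⁻²`. Against the loss `2 κ` from
  -- comparing energy and norm this leaves `1 / (288 κ) ≤ (1 / 16) ^ 2`.
  have h3 : Real.exp (-(1 / √κ * agdSteps κ)) ≤ 1 / (24 * κ) ^ 2 := by
    have h4 : 2 * Real.log (24 * κ) ≤ 1 / √κ * agdSteps κ := by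
      rw [one_div, inv_mul_eq_div, le_div_iff₀ hs]; linarith
    calc Real.exp (-(1 / √κ * agdSteps κ)) ≤ Real.exp (-(2 * Real.log (24 * κ))) := by gcongr
      _ = 1 / (24 * κ) ^ 2 := by
        rw [Real.exp_neg, two_mul, Real.exp_add, Real.exp_log (by positivity)]
        field_simp
  refine le_of_sq_le_sq ?_ (by positivity)
  refine hx.trans ?_
  rw [mul_pow]
  refine mul_le_mul_of_nonneg_right ?_ (sq_nonneg _)
  calc 2 * κ * (1 - 1 / √κ) ^ agdSteps κ ≤ 2 * κ * (1 / (24 * κ) ^ 2) := by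
        gcongr; exact h1.trans h3
    _ = 1 / (288 * κ) := by field_simp; norm_num
    _ ≤ (1 / 16) ^ 2 := by
        rw [div_le_iff₀ (by positivity)]; linarith

/-! ### Conjugate gradient -/

section

variable {E : Type*} [NormedAddCommGroup E] [InnerProductSpace ℝ E]

/-- The conjugacy relations of conjugate gradient, with respect to the Krylov space `K`. -/
structure Conjugate (M : E →ₗ[ℝ] E) (x₀ xs : E) (K : Submodule ℝ E) (x r p : E) : Prop where
  res : r = M (xs - x)
  mem : x - x₀ ∈ K
  dir : r - p ∈ K
  ortho : ∀ k ∈ K, ⟪k, r⟫_ℝ = 0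
  conj : ∀ k ∈ K, ⟪k, M p⟫_ℝ = 0
  map : ∀ k ∈ K, M k ∈ K ⊔ Submodule.span ℝ {r}
  zero : r = 0 → p = 0

theorem Conjugate.inner_res_dir {M : E →ₗ[ℝ] E} {x₀ xs : E} {K : Submodule ℝ E} {x r p : E}
    (hc : Conjugate M x₀ xs K x r p) : ⟪p, r⟫_ℝ = ⟪r, r⟫_ℝ := by
  have := hc.ortho _ hc.dir
  rw [inner_sub_left] at this
  linarith

/-- The Krylov space is kept abstract: all that is needed is that `M` maps `K` into `K` enlarged by
the residual. The choice of `a` makes the new residual orthogonal to `p`, and the choice of `c`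
makes the new direction conjugate to `p`; the older directions follow from the mapping property and
symmetry. -/
theorem Conjugate.step {M : E →ₗ[ℝ] E} {μ l : ℝ} (h : SymBdd M μ l) (hμ : 0 < μ) {x₀ xs : E}
    {K : Submodule ℝ E} {x r p : E} (hc : Conjugate M x₀ xs K x r p) {a c : ℝ} {r' : E}
    (ha : a = ⟪r, r⟫_ℝ / ⟪p, M p⟫_ℝ) (hr' : r' = r - a • M p)
    (hcc : c = ⟪r', r'⟫_ℝ / ⟪r, r⟫_ℝ) :
    Conjugate M x₀ xs (K ⊔ Submodule.span ℝ {r}) (x + a • p) r' (r' + c • p) := by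
  have hrK : r ∈ K ⊔ Submodule.span ℝ {r} :=
    Submodule.mem_sup_right (Submodule.mem_span_singleton_self r)
  have hKK : K ≤ K ⊔ Submodule.span ℝ {r} := le_sup_left
  have hpK : p ∈ K ⊔ Submodule.span ℝ {r} := by
    have := (K ⊔ Submodule.span ℝ {r}).sub_mem hrK (hKK hc.dir)
    simpa using this
  have hres : r' = M (xs - (x + a • p)) := by
    rw [hr', hc.res]; simp only [map_sub, map_add, map_smul]; abel
  -- With zero residual the quotients have zero numerators and denominators. The body can still run,
  -- since it precedes the first test, but the direction is zero too and nothing moves.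
  by_cases hr : r = 0
  · have hp := hc.zero hr
    subst hr hp
    obtain rfl : r' = 0 := by simp [hr']
    have e : K ⊔ Submodule.span ℝ {(0 : E)} = K := by simp
    rw [e] at *
    exact ⟨hres, by simpa using hc.mem, by simp, by simp, by simp,
      fun k hk => by simpa using hc.map k hk, by simp⟩
  · have hrr : 0 < ⟪r, r⟫_ℝ := real_inner_self_pos.2 hr
    have hp : p ≠ 0 := by
      rintro rfl
      have := hc.inner_res_dir
      rw [inner_zero_left] at this
      exact hrr.ne this
    have hpp : 0 < ⟪p, M p⟫_ℝ := lt_of_lt_of_le (by positivity) (h.lower p)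
    have ha0 : 0 < a := ha ▸ div_pos hrr hpp
    -- `M p` is a combination of consecutive residuals. This drives both the conjugacy of the new
    -- direction and the growth of the Krylov space.
    have hMp : M p = a⁻¹ • (r - r') := by
      rw [hr', sub_sub_cancel, smul_smul, inv_mul_cancel₀ ha0.ne', one_smul]
    have horth : ∀ k ∈ K ⊔ Submodule.span ℝ {r}, ⟪k, r'⟫_ℝ = 0 := by
      intro k hk
      obtain ⟨k₁, hk₁, k₂, hk₂, rfl⟩ := Submodule.mem_sup.1 hk
      obtain ⟨s, rfl⟩ := Submodule.mem_span_singleton.1 hk₂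
      have e1 : ⟪k₁, r'⟫_ℝ = 0 := by
        rw [hr', inner_sub_right, inner_smul_right, hc.ortho _ hk₁, hc.conj _ hk₁]; simp
      have e2 : ⟪p, r'⟫_ℝ = 0 := by
        rw [hr', inner_sub_right, inner_smul_right, hc.inner_res_dir, ha,
          div_mul_cancel₀ _ hpp.ne', sub_self]
      have e3 : ⟪r - p, r'⟫_ℝ = 0 := by
        rw [hr', inner_sub_right, inner_smul_right, hc.ortho _ hc.dir, hc.conj _ hc.dir]; simp
      rw [inner_sub_left, e2, sub_zero] at e3
      rw [inner_add_left, inner_smul_left, e1, e3]; simp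
    refine ⟨hres, ?_, ?_, horth, ?_, ?_, ?_⟩
    · have : x + a • p - x₀ = (x - x₀) + a • p := by abel
      rw [this]
      exact Submodule.add_mem _ (hKK hc.mem) (Submodule.smul_mem _ _ hpK)
    · have : r' - (r' + c • p) = (-c) • p := by simp
      rw [this]
      exact Submodule.smul_mem _ _ hpK
    · intro k hk
      obtain ⟨k₁, hk₁, k₂, hk₂, rfl⟩ := Submodule.mem_sup.1 hk
      obtain ⟨s, rfl⟩ := Submodule.mem_span_singleton.1 hk₂
      have e1 : ⟪k₁, M (r' + c • p)⟫_ℝ = 0 := by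
        rw [map_add, map_smul, inner_add_right, inner_smul_right, hc.conj _ hk₁, ← h.symm,
          horth _ (hc.map _ hk₁)]; simp
      have e2 : ⟪r - p, M (r' + c • p)⟫_ℝ = 0 := by
        rw [map_add, map_smul, inner_add_right, inner_smul_right, hc.conj _ hc.dir, ← h.symm,
          horth _ (hc.map _ hc.dir)]; simp
      have e3 : ⟪p, M (r' + c • p)⟫_ℝ = 0 := by
        rw [map_add, map_smul, inner_add_right, inner_smul_right, ← h.symm, hcc]
        have e4 : ⟪M p, r'⟫_ℝ = - (a⁻¹ * ⟪r', r'⟫_ℝ) := by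
          rw [hMp, inner_smul_left, inner_sub_left, horth _ hrK]; simp
        rw [e4, ha]
        field_simp
        ring
      rw [inner_sub_left, e3, sub_zero] at e2
      rw [inner_add_left, inner_smul_left, e1, e2]; simp
    · intro k hk
      obtain ⟨k₁, hk₁, k₂, hk₂, rfl⟩ := Submodule.mem_sup.1 hk
      obtain ⟨s, rfl⟩ := Submodule.mem_span_singleton.1 hk₂
      have hle : K ⊔ Submodule.span ℝ {r} ≤ K ⊔ Submodule.span ℝ {r} ⊔ Submodule.span ℝ {r'} :=
        le_sup_left
      have hr'K : r' ∈ K ⊔ Submodule.span ℝ {r} ⊔ Submodule.span ℝ {r'} :=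
        Submodule.mem_sup_right (Submodule.mem_span_singleton_self r')
      have hMpK : M p ∈ K ⊔ Submodule.span ℝ {r} ⊔ Submodule.span ℝ {r'} := by
        rw [hMp]
        exact Submodule.smul_mem _ _ (Submodule.sub_mem _ (hle hrK) hr'K)
      have hMrK : M r ∈ K ⊔ Submodule.span ℝ {r} ⊔ Submodule.span ℝ {r'} := by
        have := Submodule.add_mem _ (hle (hc.map _ hc.dir)) hMpK
        rwa [← map_add, sub_add_cancel] at this
      rw [map_add, map_smul]
      exact Submodule.add_mem _ (hle (hc.map _ hk₁)) (Submodule.smul_mem _ _ hMrK)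
    · intro h0
      rw [hcc, h0]; simp

/-- The iterate of conjugate gradient is optimal in `x₀ + K`. -/
theorem Conjugate.optimal {M : E →ₗ[ℝ] E} {μ l : ℝ} (h : SymBdd M μ l) (hμ : 0 < μ) {x₀ xs : E}
    {K : Submodule ℝ E} {x r p y : E} (hc : Conjugate M x₀ xs K x r p) (hy : y - x₀ ∈ K) :
    ⟪x - xs, M (x - xs)⟫_ℝ ≤ ⟪y - xs, M (y - xs)⟫_ℝ := by
  have h1 : y - x ∈ K := by
    have := K.sub_mem hy hc.mem
    simpa using this
  have h2 := hc.ortho _ h1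
  have h3 : y - xs = (y - x) + (x - xs) := by abel
  have h4 : M (x - xs) = - r := by rw [hc.res, ← map_neg]; simp
  have h5 : 0 ≤ ⟪y - x, M (y - x)⟫_ℝ := le_trans (by positivity) (h.lower (y - x))
  have h6 : ⟪x - xs, M (y - x)⟫_ℝ = 0 := by
    rw [← h.symm, h4, inner_neg_left, real_inner_comm, h2, neg_zero]
  rw [h3, map_add, inner_add_left, inner_add_right, inner_add_right, h6, h4, inner_neg_right,
    inner_neg_right, h2]
  linarith

end

/-- Accelerated gradient descent from the same point takes its gradients in the Krylov space, so its
iterates compete in the minimisation that conjugate gradient solves exactly. The invariant carries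
such a ghost run `y`, `yt`, `v`, which replaces the usual argument with Chebyshev polynomials.
Passing from energies to residuals at both ends costs the factor `2 l / μ` inside the logarithm. -/
theorem meets_conjGrad {n m : ℕ} {op : PVec n m → Counted (PVec n m)}
    {M : PVec n m →ₗ[ℝ] PVec n m} {μ l ε : ℝ} (h : SymBdd M μ l) (hμ : 0 < μ) (hl : μ ≤ l)
    (hop : ∀ v, (op v).Meets 2 (fun w => w = M v)) {b xs : PVec n m} (hb : M xs = b)
    (x₀ : PVec n m) (hε : 0 < ε) :
    (conjGrad op b x₀ ε).Meets
      (2 * (max 0 (Real.log (2 * (l / μ) / ε ^ 2)) * √(l / μ) + 2) + 2)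
      (fun x => ‖b - M x‖ ≤ ε * ‖b - M x₀‖) := by
  obtain ⟨ha0, ha1, ha2, -⟩ := sqrt_div_facts hμ hl
  have hl0 : 0 < l := hμ.trans_le hl
  obtain ⟨T, hT1, hT2⟩ := exists_steps ha0 ha1 (X := 2 * (l / μ) / ε ^ 2) (by positivity)
  set a := 1 / √(l / μ) with ha
  rw [show max 0 (Real.log (2 * (l / μ) / ε ^ 2)) * √(l / μ)
    = max 0 (Real.log (2 * (l / μ) / ε ^ 2)) / a by rw [ha]; field_simp]
  unfold conjGrad
  rw [add_comm]
  refine (hop x₀).bind ?_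
  rintro q rfl
  have hr0 : b - M x₀ = M (xs - x₀) := by rw [map_sub, hb]
  have key := meets_repeatUntil (σ := PVec n m × PVec n m × PVec n m) (c := 2) (T := T)
      (s := (x₀, b - M x₀, b - M x₀)) (halt := fun s => ‖s.2.1‖ ≤ ε * ‖b - M x₀‖)
      (body := fun s : PVec n m × PVec n m × PVec n m => do
        let x := s.1
        let r := s.2.1
        let p := s.2.2
        let w ← op p
        let a : ℝ := inner ℝ r r / inner ℝ p w
        let r' := r - a • w
        let c : ℝ := inner ℝ r' r' / inner ℝ r r
        pure (x + a • p, r', r' + c • p))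
      (I := fun t s => ∃ K : Submodule ℝ (PVec n m), Conjugate M x₀ xs K s.1 s.2.1 s.2.2 ∧
        ∃ y yt v, y - x₀ ∈ K ∧ yt - x₀ ∈ K ∧ (1 + a) • (yt - xs) = (y - xs) + a • v ∧
          energy M μ (y - xs) v ≤ (1 - a) ^ t * energy M μ (x₀ - xs) (x₀ - xs))
      (by norm_num) ?_ ?_ ?_
  · refine (key.bind_pure (f := fun s => s.1) (q := fun x => ‖b - M x‖ ≤ ε * ‖b - M x₀‖) ?_).mono
      ?_ (fun _ h => h)
    · rintro s ⟨h1, t, K, h2, -⟩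
      have : b - M s.1 = s.2.1 := by rw [h2.res, map_sub, hb]
      simpa [this] using h1
    · linarith
  · refine ⟨⊥, ⟨hr0, by simp, by simp, by simp, by simp, by simp, fun h => h⟩, x₀, x₀, x₀ - xs,
      by simp, by simp, by module, by simp⟩
  · rintro t ⟨x, r, p⟩ ⟨K, hc, y, yt, v, hy, hyt, hv1, hv2⟩
    simp only at hc
    refine Meets.bind_pure (hop p) ?_
    rintro w rfl
    refine ⟨_, hc.step h hμ rfl rfl rfl, yt - (1 / l) • M (yt - xs),
      yt - (1 / l) • M (yt - xs) + ((1 - a) / (1 + a)) • (yt - (1 / l) • M (yt - xs) - y),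
      (1 - a) • v + a • (yt - xs) - (a / μ) • M (yt - xs), ?_⟩
    have hKK : K ≤ K ⊔ Submodule.span ℝ {r} := le_sup_left
    have hrK : r ∈ K ⊔ Submodule.span ℝ {r} :=
      Submodule.mem_sup_right (Submodule.mem_span_singleton_self r)
    -- The ghost gradient is the current conjugate gradient residual, up to sign, plus images under
    -- `M` of elements of `K`.
    have hg : M (yt - xs) ∈ K ⊔ Submodule.span ℝ {r} := by
      have e : M (yt - xs) = M (yt - x₀) - M (x - x₀) - r := by
        rw [hc.res]; simp only [map_sub]; abel
      rw [e]
      exact Submodule.sub_mem _ (Submodule.sub_mem _ (hc.map _ hyt) (hc.map _ hc.mem)) hrK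
    have hy' : yt - (1 / l) • M (yt - xs) - x₀ ∈ K ⊔ Submodule.span ℝ {r} := by
      rw [sub_right_comm]
      exact Submodule.sub_mem _ (hKK hyt) (Submodule.smul_mem _ _ hg)
    refine ⟨hy', ?_, ?_, ?_⟩
    · have e : yt - (1 / l) • M (yt - xs) + ((1 - a) / (1 + a)) • (yt - (1 / l) • M (yt - xs) - y)
          - x₀ = (yt - (1 / l) • M (yt - xs) - x₀)
            + ((1 - a) / (1 + a)) • ((yt - (1 / l) • M (yt - xs) - x₀) - (y - x₀)) := by
        rw [sub_sub_sub_cancel_right]; abel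
      rw [e]
      exact Submodule.add_mem _ hy' (Submodule.smul_mem _ _ (Submodule.sub_mem _ hy' (hKK hy)))
    · have := agd_momentum ha0 rfl hμ hl0 ha2 hv1 (g := M (yt - xs))
        (e' := yt - (1 / l) • M (yt - xs) - xs) (by abel)
      rw [← this]
      module
    · have := energy_step h hμ hl0 ha2 ha0 ha1 hv1
      have e1 : yt - (1 / l) • M (yt - xs) - xs = yt - xs - (1 / l) • M (yt - xs) := by abel
      rw [e1]
      refine this.trans ?_
      rw [pow_succ, mul_comm ((1 - a) ^ t), mul_assoc]
      exact mul_le_mul_of_nonneg_left hv2 (sub_nonneg.2 ha1)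
  · rintro ⟨x, r, p⟩ ⟨K, hc, y, yt, v, hy, hyt, hv1, hv2⟩
    simp only at hc
    have h1 := hc.optimal h hμ hy
    have h2 : ‖r‖ ^ 2 ≤ l * ⟪x - xs, M (x - xs)⟫_ℝ := by
      have e : r = - M (x - xs) := by rw [hc.res, ← map_neg]; simp
      rw [e, norm_neg]
      exact h.norm_sq_le hμ.le hl0 _
    have h3 := le_energy (M := M) hμ.le (y - xs) v
    have h4 := energy_self_le h (x₀ - xs)
    set r₀ := b - M x₀ with hr₀
    have h5 : ⟪x₀ - xs, M (x₀ - xs)⟫_ℝ ≤ ‖r₀‖ ^ 2 / μ := by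
      have e : M (x₀ - xs) = - r₀ := by rw [hr0, ← map_neg]; simp
      have e1 := real_inner_le_norm (x₀ - xs) (M (x₀ - xs))
      have e2 := h.lower_norm (x₀ - xs)
      rw [e, norm_neg] at e1 e2
      rw [e, le_div_iff₀ hμ]
      nlinarith [norm_nonneg r₀, mul_le_mul_of_nonneg_right e2 (norm_nonneg r₀)]
    have h6 : 0 ≤ (1 - a) ^ (T + 1) := pow_nonneg (sub_nonneg.2 ha1) _
    have h7 := mul_le_mul_of_nonneg_left (h4.trans h5) h6
    refine le_of_sq_le_sq ?_ (by positivity)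
    calc ‖r‖ ^ 2 ≤ l * (2 * ((1 - a) ^ (T + 1) * (‖r₀‖ ^ 2 / μ))) := by
          refine h2.trans (mul_le_mul_of_nonneg_left ?_ hl0.le)
          linarith
      _ = (2 * (l / μ) / ε ^ 2 * (1 - a) ^ (T + 1)) * (ε * ‖r₀‖) ^ 2 := by field_simp
      _ ≤ 1 * (ε * ‖r₀‖) ^ 2 := by gcongr
      _ = (ε * ‖r₀‖) ^ 2 := one_mul _

/-! ### The inexact accelerated proximal point method -/

section

variable {E F : Type*} [NormedAddCommGroup E] [InnerProductSpace ℝ E]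
  [NormedAddCommGroup F] [InnerProductSpace ℝ F]

theorem norm_add_sq_le_two {G : Type*} [SeminormedAddCommGroup G] (x y : G) : ‖x + y‖ ^ 2 ≤ 2 * ‖x‖ ^ 2 + 2 * ‖y‖ ^ 2 := by
  have h1 := norm_add_le x y
  nlinarith [norm_nonneg (x + y), norm_nonneg x, norm_nonneg y, sq_nonneg (‖x‖ - ‖y‖)]

theorem norm_sub_sq_le_two {G : Type*} [SeminormedAddCommGroup G] (x y : G) : ‖x - y‖ ^ 2 ≤ 2 * ‖x‖ ^ 2 + 2 * ‖y‖ ^ 2 := by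
  simpa [sub_eq_add_neg] using norm_add_sq_le_two x (-y)

/-- Young's inequality for the energy. The cross term of the Hessian part is controlled by
positivity of `H` at `s • e - d`. -/
theorem energy_add_le {H : E →ₗ[ℝ] E} {μ m h s : ℝ} (hH : SymBdd H m h) (hm : 0 ≤ m)
    (hμ : 0 ≤ μ) (hs : 0 < s) (e v d d' : E) :
    energy H μ (e + d) (v + d') ≤ (1 + s) * energy H μ e v + (1 + 1 / s) * energy H μ d d' := by
  have h1 : ⟪e + d, H (e + d)⟫_ℝ ≤ (1 + s) * ⟪e, H e⟫_ℝ + (1 + 1 / s) * ⟪d, H d⟫_ℝ := by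
    have h2 := (mul_nonneg hm (sq_nonneg _)).trans (hH.lower (s • e - d))
    have h3 : ⟪d, H e⟫_ℝ = ⟪e, H d⟫_ℝ := by rw [← hH.symm, real_inner_comm]
    simp only [map_sub, map_add, map_smul, inner_sub_left, inner_sub_right, inner_add_left,
      inner_add_right, inner_smul_left, inner_smul_right, RCLike.conj_to_real, h3] at h2 ⊢
    have h4 : 0 ≤ 1 / s * (s * (s * ⟪e, H e⟫_ℝ) - s * ⟪e, H d⟫_ℝ - (s * ⟪e, H d⟫_ℝ - ⟪d, H d⟫_ℝ)) :=
      mul_nonneg (by positivity) (by linarith)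
    have h5 : 1 / s * (s * (s * ⟪e, H e⟫_ℝ) - s * ⟪e, H d⟫_ℝ - (s * ⟪e, H d⟫_ℝ - ⟪d, H d⟫_ℝ))
      = s * ⟪e, H e⟫_ℝ - 2 * ⟪e, H d⟫_ℝ + 1 / s * ⟪d, H d⟫_ℝ := by field_simp; ring
    linarith
  have h6 : ‖v + d'‖ ^ 2 ≤ (1 + s) * ‖v‖ ^ 2 + (1 + 1 / s) * ‖d'‖ ^ 2 := by
    have h7 := norm_add_le v d'
    have h8 : 0 ≤ 1 / s * (s * ‖v‖ - ‖d'‖) ^ 2 := by positivity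
    have h9 : 1 / s * (s * ‖v‖ - ‖d'‖) ^ 2
      = s * ‖v‖ ^ 2 - 2 * (‖v‖ * ‖d'‖) + 1 / s * ‖d'‖ ^ 2 := by field_simp; ring
    nlinarith [norm_nonneg (v + d'), norm_nonneg v, norm_nonneg d']
  have h10 := mul_le_mul_of_nonneg_left h6 (show 0 ≤ μ / 2 by linarith)
  unfold energy
  linarith

theorem energy_nonneg {H : E →ₗ[ℝ] E} {μ m h : ℝ} (hH : SymBdd H m h) (hm : 0 ≤ m)
    (hμ : 0 ≤ μ) (e v : E) : 0 ≤ energy H μ e v := by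
  have h1 := (mul_nonneg hm (sq_nonneg _)).trans (hH.lower e)
  unfold energy
  positivity

/-- One exact step of the accelerated proximal point method. -/
theorem energy_prox_step {H : E →ₗ[ℝ] E} {m h γ a : ℝ} (hH : SymBdd H m h) (hm : 0 < m)
    (hγ : 0 < γ) (ha : a ^ 2 = m / (2 * γ)) (ha0 : 0 < a) (ha1 : a ≤ 1 / 2) {e v eh ep : E}
    (heh : (1 + a) • eh = e + a • v) (hep : H ep = γ • (eh - ep)) :
    energy H (m / 2) ep ((1 - a) • v + a • ep - (1 / a) • (eh - ep))
      ≤ (1 - a) * energy H (m / 2) e v := by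
  set g := eh - ep with hg
  have hm' : m = 2 * γ * a ^ 2 := by rw [ha]; field_simp
  have h3 : 2 * γ * ⟪g, e - ep⟫_ℝ + ⟪ep, H ep⟫_ℝ + m * ‖e - ep‖ ^ 2 ≤ ⟪e, H e⟫_ℝ := by
    have := hH.lower (e - ep)
    have e1 : ⟪ep, H e⟫_ℝ = γ * ⟪g, e⟫_ℝ := by
      rw [← hH.symm, hep, inner_smul_left]; simp
    have e2 : ⟪e, H ep⟫_ℝ = γ * ⟪g, e⟫_ℝ := by
      rw [hep, inner_smul_right, real_inner_comm]
    have e3 : ⟪ep, H ep⟫_ℝ = γ * ⟪g, ep⟫_ℝ := by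
      rw [hep, inner_smul_right, real_inner_comm]
    simp only [map_sub, inner_sub_left, inner_sub_right, e1, e2, e3] at this ⊢
    linarith
  have h4 : m * ‖ep‖ ^ 2 ≤ γ * ⟪g, ep⟫_ℝ := by
    have := hH.lower ep
    rwa [hep, inner_smul_right, real_inner_comm] at this
  have h4' : ⟪ep, H ep⟫_ℝ = γ * ⟪g, ep⟫_ℝ := by
      rw [hep, inner_smul_right, real_inner_comm]
  set w := (1 - a) • v + a • ep with hw
  have h5 : ‖w‖ ^ 2 ≤ (1 - a) * ‖v‖ ^ 2 + a * ‖ep‖ ^ 2 := by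
    have e1 : ‖w‖ ^ 2 = (1 - a) * ‖v‖ ^ 2 + a * ‖ep‖ ^ 2 - a * (1 - a) * ‖v - ep‖ ^ 2 := by
      simp only [hw, ← real_inner_self_eq_norm_sq, inner_add_left, inner_add_right,
        inner_sub_left, inner_sub_right, inner_smul_left, inner_smul_right,
        RCLike.conj_to_real, real_inner_comm v ep]
      ring
    have : 0 ≤ a * (1 - a) * ‖v - ep‖ ^ 2 := by
      have : 0 ≤ 1 - a := by linarith
      positivity
    linarith
  have h6 : m / 4 * ‖w - (1 / a) • g‖ ^ 2
      = m / 4 * ‖w‖ ^ 2 - γ * (a * ⟪g, w⟫_ℝ) + γ / 2 * ‖g‖ ^ 2 := by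
    rw [norm_sub_sq_real, inner_smul_right, norm_smul, mul_pow, Real.norm_eq_abs, sq_abs,
      real_inner_comm, hm']
    field_simp
    ring
  have h7 : (1 - a) * ⟪g, e - ep⟫_ℝ + a * ⟪g, w⟫_ℝ = a * ⟪g, ep⟫_ℝ + (1 - a ^ 2) * ‖g‖ ^ 2 := by
    have e1 : e = (1 + a) • eh - a • v := by rw [heh]; simp
    have e2 : eh = g + ep := by rw [hg]; abel
    rw [e1, hw, e2]
    simp only [inner_sub_right, inner_add_right, inner_smul_right, real_inner_self_eq_norm_sq]
    ring
  have h7' : γ * ((1 - a) * ⟪g, e - ep⟫_ℝ) + γ * (a * ⟪g, w⟫_ℝ)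
      = γ * (a * ⟪g, ep⟫_ℝ) + γ * ((1 - a ^ 2) * ‖g‖ ^ 2) := by rw [← mul_add, h7, mul_add]
  -- The auxiliary sequence contributes `γ / 2 ‖g‖²` and the proximal step gains `γ (1 - a²) ‖g‖²`;
  -- `a ≤ 1 / 2` makes the gain prevail.
  have h8 : γ / 2 * ‖g‖ ^ 2 ≤ γ * ((1 - a ^ 2) * ‖g‖ ^ 2) := by
    have : 1 / 2 ≤ 1 - a ^ 2 := by nlinarith
    have := mul_le_mul_of_nonneg_right this (sq_nonneg ‖g‖)
    nlinarith
  have ha2 : 0 ≤ 1 - a := by linarith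
  have h11 : 0 ≤ (1 - a) * (m * ‖e - ep‖ ^ 2) := by positivity
  have h12 := mul_le_mul_of_nonneg_left h3 ha2
  have h13 := mul_le_mul_of_nonneg_left h4 ha0.le
  have h14 := mul_le_mul_of_nonneg_left h5 hm.le
  have h16 : 0 ≤ a * (m * ‖ep‖ ^ 2) := by positivity
  unfold energy
  rw [show m / 2 / 2 = m / 4 by ring, h6]
  rw [h4'] at h12 ⊢
  linarith

/-- The potential of the inexact accelerated proximal point method: `e` and `w` are the errors of
the block with the proximal term and of the other block, whose best response is `r`. -/
noncomputable def proxPot (H : E →ₗ[ℝ] E) (r : E →ₗ[ℝ] F) (m : ℝ) (e : E) (w : F) (v : E) : ℝ :=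
  energy H (m / 2) e v + m * ‖w - r e‖ ^ 2

/-- The bookkeeping of `prox_step`: `V`, `Vp`, `V'` are the energies before the step, after the
exact step and after the inexact one, `Vd` is that of the error, `X` and `X'` are squared distances
to the best response, and `D` is the squared distance from the warm start to the exact proximal
solution. Young's inequality with parameter `a / 2` turns the factor `1 - a` into `1 - a / 2`; the
bound on `δ` keeps the remaining loss below `a / 4`. -/
theorem prox_step_scalar {m a ℓ K δ V V' Vp Vd D X X' : ℝ} (hm : 0 < m) (ha0 : 0 < a)
    (ha1 : a ≤ 1 / 2) (hK0 : 0 < K) (hK' : m * (1 + ℓ ^ 2) ≤ 2 * K)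
    (hδ : 112 * (1 + 2 * ℓ ^ 2) * K * δ ^ 2 ≤ m * a ^ 2) (hD0 : 0 ≤ D) (hV0 : 0 ≤ V) (hX : 0 ≤ X)
    (h1 : V' ≤ (1 + a / 2) * Vp + (1 + 1 / (a / 2)) * Vd) (hV : Vp ≤ (1 - a) * V)
    (hVd : 0 ≤ Vd) (h2 : Vd ≤ K * (δ ^ 2 * D)) (h4 : X' ≤ (1 + ℓ ^ 2) * (δ ^ 2 * D))
    (h5 : D ≤ (1 + 2 * ℓ ^ 2) * (8 / m * V) + 2 * X) :
    V' + m * X' ≤ (1 - a / 4) * (V + m * X) := by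
  have h6 : (1 + 1 / (a / 2)) ≤ 5 / 2 / a := by
    rw [le_div_iff₀ ha0]; field_simp; linarith
  have h7 : V' ≤ (1 - a / 2) * V + 5 / 2 / a * (K * (δ ^ 2 * D)) := by
    have e1 : (1 + a / 2) * Vp ≤ (1 - a / 2) * V := by
      have := mul_le_mul_of_nonneg_left hV (show 0 ≤ 1 + a / 2 by linarith)
      nlinarith [mul_nonneg (sq_nonneg a) hV0]
    have e2 : (1 + 1 / (a / 2)) * Vd ≤ 5 / 2 / a * (K * (δ ^ 2 * D)) :=
      mul_le_mul h6 h2 hVd (by positivity)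
    linarith
  have h8 : m * X' ≤ 1 / a * (K * (δ ^ 2 * D)) := by
    have e1 := mul_le_mul_of_nonneg_left h4 hm.le
    have e2 := mul_le_mul_of_nonneg_right hK' (show 0 ≤ δ ^ 2 * D by positivity)
    have e3 : 2 * (K * (δ ^ 2 * D)) ≤ 1 / a * (K * (δ ^ 2 * D)) := by
      refine mul_le_mul_of_nonneg_right ?_ (by positivity)
      rw [le_div_iff₀ ha0]; linarith
    linarith
  have h9 : 7 / 2 / a * (K * (δ ^ 2 * D)) ≤ a / 4 * V + m * a / 16 * X := by
    have e0 : 0 ≤ 7 / 2 / a * (K * δ ^ 2) := by positivity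
    have e1 := mul_le_mul_of_nonneg_left h5 e0
    have e2 : 7 / 2 / a * (K * δ ^ 2) * ((1 + 2 * ℓ ^ 2) * (8 / m * V)) ≤ a / 4 * V := by
      have : 7 / 2 / a * (K * δ ^ 2) * ((1 + 2 * ℓ ^ 2) * (8 / m * V))
        = (112 * (1 + 2 * ℓ ^ 2) * K * δ ^ 2) * (V / (4 * a * m)) := by field_simp; ring
      rw [this]
      calc _ ≤ (m * a ^ 2) * (V / (4 * a * m)) :=
            mul_le_mul_of_nonneg_right hδ (by positivity)
        _ = a / 4 * V := by field_simp
    have e3 : 7 / 2 / a * (K * δ ^ 2) * (2 * X) ≤ m * a / 16 * X := by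
      have : 112 * K * δ ^ 2 ≤ m * a ^ 2 := by
        refine le_trans ?_ hδ
        have : 0 ≤ 112 * K * δ ^ 2 * (2 * ℓ ^ 2) := by positivity
        linarith
      calc 7 / 2 / a * (K * δ ^ 2) * (2 * X)
          = (112 * K * δ ^ 2) * (X / (16 * a)) := by field_simp; ring
        _ ≤ (m * a ^ 2) * (X / (16 * a)) :=
            mul_le_mul_of_nonneg_right this (by positivity)
        _ = m * a / 16 * X := by field_simp
    linarith
  have h10 : 7 / 2 / a * (K * (δ ^ 2 * D))
      = 5 / 2 / a * (K * (δ ^ 2 * D)) + 1 / a * (K * (δ ^ 2 * D)) := by field_simp; ring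
  have h11 : m * a / 16 * X ≤ (1 - a / 4) * (m * X) := by
    have : 0 ≤ m * X := by positivity
    nlinarith
  linarith

/-- The subproblem is solved relative to the distance from the warm start in both blocks. The
potential must therefore also control the block without proximal term, which is what its summand `m
* ‖w - r e‖ ^ 2` is for. The inexact step is treated as the exact step plus a perturbation `e' -
ep`. -/
theorem prox_step {H : E →ₗ[ℝ] E} {r : E →ₗ[ℝ] F} {m h γ a ℓ K δ : ℝ} (hH : SymBdd H m h)
    (hm : 0 < m) (hγ : 0 < γ) (ha : a ^ 2 = m / (2 * γ)) (ha0 : 0 < a) (ha1 : a ≤ 1 / 2)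
    (hr : ∀ x, ‖r x‖ ≤ ℓ * ‖x‖) (hK : h / 2 + γ ≤ K) (hK' : m * (1 + ℓ ^ 2) ≤ 2 * K)
    (hδ : 112 * (1 + 2 * ℓ ^ 2) * K * δ ^ 2 ≤ m * a ^ 2) {e v eh ep e' : E} {w w' : F}
    (heh : (1 + a) • eh = e + a • v) (hep : H ep = γ • (eh - ep))
    (hd : ‖e' - ep‖ ^ 2 + ‖w' - r ep‖ ^ 2 ≤ δ ^ 2 * (‖e - ep‖ ^ 2 + ‖w - r ep‖ ^ 2)) :
    ∃ v', (1 + a) • (e' + ((1 - a) / (1 + a)) • (e' - e) + (a ^ 2 / (1 + a)) • (e' - eh))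
        = e' + a • v' ∧ proxPot H r m e' w' v' ≤ (1 - a / 4) * proxPot H r m e w v := by
  have hK0 : 0 < K := by
    have : 0 < m * (1 + ℓ ^ 2) := by positivity
    linarith
  -- The auxiliary point of the exact step, corrected by the multiple `1 / a + a` of the error. The
  -- summand `a` comes from the second extrapolation coefficient, and the sum is what the coupling
  -- dictates.
  refine ⟨(1 - a) • v + a • ep - (1 / a) • (eh - ep) + (1 / a + a) • (e' - ep), ?_, ?_⟩
  · have h1 : (1 + a) • (e' + ((1 - a) / (1 + a)) • (e' - e) + (a ^ 2 / (1 + a)) • (e' - eh))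
        = (1 + a) • e' + ((1 + a) * ((1 - a) / (1 + a))) • (e' - e)
          + ((1 + a) * (a ^ 2 / (1 + a))) • (e' - eh) := by module
    have h2 : (1 + a) * ((1 - a) / (1 + a)) = 1 - a := by field_simp
    have h3 : (1 + a) * (a ^ 2 / (1 + a)) = a ^ 2 := by field_simp
    have h4 : a • ((1 - a) • v + a • ep - (1 / a) • (eh - ep) + (1 / a + a) • (e' - ep))
        = (1 - a) • (a • v) + a ^ 2 • ep - (a * (1 / a)) • (eh - ep)
          + (a * (1 / a) + a ^ 2) • (e' - ep) := by module
    have h5 : a * (1 / a) = 1 := by field_simp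
    have h6 : a • v = (1 + a) • eh - e := by rw [heh]; simp
    rw [h1, h2, h3, h4, h5, h6]
    module
  · set d := e' - ep with hd'
    set vp := (1 - a) • v + a • ep - (1 / a) • (eh - ep) with hvp
    have hV := energy_prox_step hH hm hγ ha ha0 ha1 heh hep
    rw [← hvp] at hV
    have hV0 := energy_nonneg hH hm.le (show 0 ≤ m / 2 by linarith) e v
    have h1 := energy_add_le hH hm.le (show 0 ≤ m / 2 by linarith)
      (show 0 < a / 2 by linarith) ep vp d ((1 / a + a) • d)
    rw [show ep + d = e' by rw [hd']; abel] at h1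
    have h2 : energy H (m / 2) d ((1 / a + a) • d) ≤ K * ‖d‖ ^ 2 := by
      have e1 := hH.upper d
      have e2 : m / 2 / 2 * ‖(1 / a + a) • d‖ ^ 2 = γ / 2 * (1 + a ^ 2) ^ 2 * ‖d‖ ^ 2 := by
        have : m = 2 * γ * a ^ 2 := by rw [ha]; field_simp
        rw [norm_smul, mul_pow, Real.norm_eq_abs, sq_abs, this]
        field_simp
      have e3 : γ / 2 * (1 + a ^ 2) ^ 2 ≤ γ := by
        have : (1 + a ^ 2) ^ 2 ≤ 2 := by
          have : a ^ 2 ≤ 1 / 4 := by nlinarith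
          nlinarith [sq_nonneg a]
        nlinarith
      have e4 := mul_le_mul_of_nonneg_right e3 (sq_nonneg ‖d‖)
      have e5 := mul_le_mul_of_nonneg_right hK (sq_nonneg ‖d‖)
      unfold energy
      rw [e2]
      linarith
    set D := ‖e - ep‖ ^ 2 + ‖w - r ep‖ ^ 2 with hD
    have hD0 : 0 ≤ D := by positivity
    have h3 : ‖d‖ ^ 2 ≤ δ ^ 2 * D := le_trans (by linarith [sq_nonneg ‖w' - r ep‖]) hd
    have h4 : ‖w' - r e'‖ ^ 2 ≤ (1 + ℓ ^ 2) * (δ ^ 2 * D) := by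
      have e1 : w' - r e' = (w' - r ep) - r d := by rw [hd', map_sub]; abel
      have e2 := norm_sub_le (w' - r ep) (r d)
      have e3 := hr d
      have e4 : ‖w' - r e'‖ ≤ ‖w' - r ep‖ + ℓ * ‖d‖ := by rw [e1]; linarith
      have e5 : ‖w' - r e'‖ ^ 2 ≤ (‖w' - r ep‖ + ℓ * ‖d‖) ^ 2 :=
        pow_le_pow_left₀ (norm_nonneg _) e4 2
      have e6 := mul_le_mul_of_nonneg_left hd (show 0 ≤ 1 + ℓ ^ 2 by positivity)
      nlinarith [sq_nonneg (ℓ * ‖w' - r ep‖ - ‖d‖)]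
    have h5 : D ≤ (1 + 2 * ℓ ^ 2) * (8 / m * energy H (m / 2) e v) + 2 * ‖w - r e‖ ^ 2 := by
      have e1 : w - r ep = (w - r e) + r (e - ep) := by rw [map_sub]; abel
      have e2 := norm_add_sq_le_two (w - r e) (r (e - ep))
      have e3 : ‖r (e - ep)‖ ^ 2 ≤ ℓ ^ 2 * ‖e - ep‖ ^ 2 := by
        rw [← mul_pow]; exact pow_le_pow_left₀ (norm_nonneg _) (hr _) 2
      have e4 := norm_sub_sq_le_two e ep
      have e5 := (hH.lower e).trans (le_energy (M := H) (show 0 ≤ m / 2 by linarith) e v)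
      have e6 := (hH.lower ep).trans (le_energy (M := H) (show 0 ≤ m / 2 by linarith) ep vp)
      have e7 : m * ‖e - ep‖ ^ 2 ≤ 8 * energy H (m / 2) e v := by nlinarith
      have e8 : ‖e - ep‖ ^ 2 ≤ 8 / m * energy H (m / 2) e v := by
        rw [div_mul_eq_mul_div, le_div_iff₀ hm]; linarith
      rw [← e1] at e2
      have e9 := mul_le_mul_of_nonneg_left e8 (show 0 ≤ 1 + 2 * ℓ ^ 2 by positivity)
      rw [hD]
      linarith
    exact prox_step_scalar hm ha0 ha1 hK0 hK' hδ hD0 hV0 (sq_nonneg _) h1 hV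
      (energy_nonneg hH hm.le (by linarith) _ _) (h2.trans (mul_le_mul_of_nonneg_left h3 hK0.le))
      h4 h5

theorem proxPot_self_le {H : E →ₗ[ℝ] E} {r : E →ₗ[ℝ] F} {m h ℓ K : ℝ} (hH : SymBdd H m h)
    (hm : 0 < m) (hr : ∀ x, ‖r x‖ ≤ ℓ * ‖x‖) (hK : h / 2 ≤ K)
    (hK' : m * (1 + ℓ ^ 2) ≤ 2 * K) (e : E) (w : F) :
    proxPot H r m e w e ≤ 6 * K * (‖e‖ ^ 2 + ‖w‖ ^ 2) := by
  have h1 : energy H (m / 2) e e ≤ 2 * K * ‖e‖ ^ 2 := by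
    have := hH.upper e
    have := hH.lower e
    have : h * ‖e‖ ^ 2 ≤ 2 * K * ‖e‖ ^ 2 := mul_le_mul_of_nonneg_right (by linarith) (sq_nonneg _)
    have : 0 ≤ m * ‖e‖ ^ 2 := by positivity
    unfold energy
    linarith
  have h2 := norm_sub_sq_le_two w (r e)
  have h3 : ‖r e‖ ^ 2 ≤ ℓ ^ 2 * ‖e‖ ^ 2 := by
    rw [← mul_pow]; exact pow_le_pow_left₀ (norm_nonneg _) (hr _) 2
  have h4 : m * ‖w - r e‖ ^ 2 ≤ m * (2 * ‖w‖ ^ 2 + 2 * (ℓ ^ 2 * ‖e‖ ^ 2)) :=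
    mul_le_mul_of_nonneg_left (by linarith) hm.le
  have h5 : m * ‖w‖ ^ 2 ≤ 2 * K * ‖w‖ ^ 2 := by
    refine mul_le_mul_of_nonneg_right ?_ (sq_nonneg _)
    nlinarith [mul_nonneg hm.le (sq_nonneg ℓ)]
  have h6 : m * (ℓ ^ 2 * ‖e‖ ^ 2) ≤ 2 * K * ‖e‖ ^ 2 := by
    rw [← mul_assoc]
    refine mul_le_mul_of_nonneg_right ?_ (sq_nonneg _)
    nlinarith
  have h7 : 0 ≤ K * ‖w‖ ^ 2 := by nlinarith [sq_nonneg ‖w‖]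
  unfold proxPot
  linarith

theorem norm_sq_le_proxPot {H : E →ₗ[ℝ] E} {r : E →ₗ[ℝ] F} {m h ℓ : ℝ} (hH : SymBdd H m h)
    (hm : 0 < m) (hr : ∀ x, ‖r x‖ ≤ ℓ * ‖x‖) (e : E) (w : F) (v : E) :
    m * (‖e‖ ^ 2 + ‖w‖ ^ 2) ≤ 4 * (1 + ℓ ^ 2) * proxPot H r m e w v := by
  have h1 := (hH.lower e).trans (le_energy (M := H) (show 0 ≤ m / 2 by linarith) e v)
  have h2 := norm_add_sq_le_two (w - r e) (r e)
  rw [sub_add_cancel] at h2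
  have h3 : ‖r e‖ ^ 2 ≤ ℓ ^ 2 * ‖e‖ ^ 2 := by
    rw [← mul_pow]; exact pow_le_pow_left₀ (norm_nonneg _) (hr _) 2
  have h4 := mul_le_mul_of_nonneg_left h2 hm.le
  have h5 := mul_le_mul_of_nonneg_left h3 hm.le
  have h6 := mul_le_mul_of_nonneg_left h1 (sq_nonneg ℓ)
  have h7 := energy_nonneg hH hm.le (show 0 ≤ m / 2 by linarith) e v
  have h8 : 0 ≤ ℓ ^ 2 * (m * ‖w - r e‖ ^ 2) := by positivity
  have h9 : 0 ≤ m * ‖w - r e‖ ^ 2 := by positivity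
  unfold proxPot
  nlinarith

end

/-! ### Reduced Hessians -/

section

variable {E F : Type*} [NormedAddCommGroup E] [InnerProductSpace ℝ E]
  [NormedAddCommGroup F] [InnerProductSpace ℝ F] [FiniteDimensional ℝ F]

/-- The best response `r` and the Hessian `H = a + b r` after elimination of a block. -/
theorem exists_reduced {a : E →ₗ[ℝ] E} {b : F →ₗ[ℝ] E} {bt : E →ₗ[ℝ] F} {c : F →ₗ[ℝ] F}
    {m l m' l' q : ℝ} (ha : SymBdd a m l) (hc : SymBdd c m' l') (hm' : 0 < m')
    (hb : ∀ y x, ⟪b y, x⟫_ℝ = ⟪y, bt x⟫_ℝ) (hbt : ∀ x, ‖bt x‖ ≤ q * ‖x‖) (hq : 0 ≤ q) :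
    ∃ r : E →ₗ[ℝ] F, (∀ x, c (r x) = bt x) ∧ (∀ x y, c y = bt x → y = r x) ∧
      (∀ x, ‖r x‖ ≤ q / m' * ‖x‖) ∧ SymBdd (a + b ∘ₗ r) m (l + q ^ 2 / m') := by
  obtain ⟨N, hN1, hN2⟩ := exists_inverse hm' hc.lower
  have hr : ∀ x, ‖N (bt x)‖ ≤ q / m' * ‖x‖ := by
    intro x
    have h1 := hc.lower_norm (N (bt x))
    rw [hN1] at h1
    rw [div_mul_eq_mul_div, le_div_iff₀ hm', mul_comm]
    exact h1.trans (hbt x)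
  have hin : ∀ x y, ⟪b (N (bt x)), y⟫_ℝ = ⟪N (bt x), c (N (bt y))⟫_ℝ := fun x y => by
    rw [hb, hN1]
  refine ⟨N ∘ₗ bt, fun x => by simp [hN1], fun x y h => by simp [← h, hN2], hr, ?_, ?_, ?_⟩
  · intro x y
    have e1 : ⟪x, b (N (bt y))⟫_ℝ = ⟪N (bt x), c (N (bt y))⟫_ℝ := by
      rw [real_inner_comm, hin, ← hc.symm, real_inner_comm]
    simp only [LinearMap.add_apply, LinearMap.comp_apply, inner_add_left, inner_add_right,
      ha.symm, hin, e1]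
  · intro x
    have e1 : ⟪x, b (N (bt x))⟫_ℝ = ⟪N (bt x), c (N (bt x))⟫_ℝ := by
      rw [real_inner_comm, hin]
    have e2 := (mul_nonneg hm'.le (sq_nonneg _)).trans (hc.lower (N (bt x)))
    simp only [LinearMap.add_apply, LinearMap.comp_apply, inner_add_right, e1]
    linarith [ha.lower x]
  · intro x
    have e1 : ⟪x, b (N (bt x))⟫_ℝ = ⟪N (bt x), bt x⟫_ℝ := by
      rw [real_inner_comm, hb]
    have e2 := real_inner_le_norm (N (bt x)) (bt x)
    have e3 : ‖N (bt x)‖ * ‖bt x‖ ≤ (q / m' * ‖x‖) * (q * ‖x‖) :=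
      mul_le_mul (hr x) (hbt x) (norm_nonneg _) (by positivity)
    simp only [LinearMap.add_apply, LinearMap.comp_apply, inner_add_right, e1]
    have e4 : (l + q ^ 2 / m') * ‖x‖ ^ 2 = l * ‖x‖ ^ 2 + (q / m' * ‖x‖) * (q * ‖x‖) := by
      field_simp
    linarith [ha.upper x]

end

/-! ### Block operators -/

theorem matVec_eq {a b : ℕ} (M : Matrix (Fin a) (Fin b) ℝ) (v : Vec b) :
    matVec M v = Matrix.toEuclideanLin M v := rfl

@[simp] theorem pair_fst (x : Vec n) (y : Vec m) : (pair x y).fst = x := rfl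
@[simp] theorem pair_snd (x : Vec n) (y : Vec m) : (pair x y).snd = y := rfl

theorem pair_fst_snd (z : PVec n m) : pair z.fst z.snd = z := rfl

theorem pvec_ext {z w : PVec n m} (h1 : z.fst = w.fst) (h2 : z.snd = w.snd) : z = w := by
  rw [← pair_fst_snd z, ← pair_fst_snd w, h1, h2]

theorem pvec_norm_sq (z : PVec n m) : ‖z‖ ^ 2 = ‖z.fst‖ ^ 2 + ‖z.snd‖ ^ 2 :=
  WithLp.prod_norm_sq_eq_of_L2 z

theorem pvec_inner (z w : PVec n m) :
    ⟪z, w⟫_ℝ = ⟪z.fst, w.fst⟫_ℝ + ⟪z.snd, w.snd⟫_ℝ :=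
  WithLp.prod_inner_apply z w

theorem norm_fst_le (z : PVec n m) : ‖z.fst‖ ≤ ‖z‖ := by
  refine le_of_sq_le_sq ?_ (norm_nonneg _)
  rw [pvec_norm_sq]; linarith [sq_nonneg ‖z.snd‖]

theorem norm_snd_le (z : PVec n m) : ‖z.snd‖ ≤ ‖z‖ := by
  refine le_of_sq_le_sq ?_ (norm_nonneg _)
  rw [pvec_norm_sq]; linarith [sq_nonneg ‖z.fst‖]

/-- `[A, 0; 0, C]` as a linear map. -/
noncomputable def diagOp (A : Matrix (Fin n) (Fin n) ℝ) (C : Matrix (Fin m) (Fin m) ℝ) :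
    PVec n m →ₗ[ℝ] PVec n m where
  toFun z := pair (matVec A z.fst) (matVec C z.snd)
  map_add' z w := pvec_ext (by simp [matVec_eq]) (by simp [matVec_eq])
  map_smul' s z := pvec_ext (by simp [matVec_eq]) (by simp [matVec_eq])

/-- `[0, B; -Bᵀ, 0]` as a linear map. -/
noncomputable def skewOp (B : Matrix (Fin n) (Fin m) ℝ) : PVec n m →ₗ[ℝ] PVec n m where
  toFun z := pair (matVec B z.snd) (-matVec B.transpose z.fst)
  map_add' z w := pvec_ext (by simp [matVec_eq]) (by simp [matVec_eq]; abel)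
  map_smul' s z := pvec_ext (by simp [matVec_eq]) (by simp [matVec_eq])

@[simp] theorem diagOp_fst (A : Matrix (Fin n) (Fin n) ℝ) (C : Matrix (Fin m) (Fin m) ℝ)
    (z : PVec n m) : (diagOp A C z).fst = matVec A z.fst := rfl
@[simp] theorem diagOp_snd (A : Matrix (Fin n) (Fin n) ℝ) (C : Matrix (Fin m) (Fin m) ℝ)
    (z : PVec n m) : (diagOp A C z).snd = matVec C z.snd := rfl
@[simp] theorem skewOp_fst (B : Matrix (Fin n) (Fin m) ℝ) (z : PVec n m) :
    (skewOp B z).fst = matVec B z.snd := rfl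
@[simp] theorem skewOp_snd (B : Matrix (Fin n) (Fin m) ℝ) (z : PVec n m) :
    (skewOp B z).snd = -matVec B.transpose z.fst := rfl

theorem inner_matVec {a b : ℕ} (B : Matrix (Fin a) (Fin b) ℝ) (y : Vec b) (x : Vec a) :
    ⟪matVec B y, x⟫_ℝ = ⟪y, matVec B.transpose x⟫_ℝ := by
  have h := Matrix.toEuclideanLin_conjTranspose_eq_adjoint B
  rw [Matrix.conjTranspose_eq_transpose_of_trivial] at h
  rw [matVec_eq, matVec_eq, h, LinearMap.adjoint_inner_right]

theorem inner_matVec_transpose {a b : ℕ} (B : Matrix (Fin a) (Fin b) ℝ) (x : Vec a) (y : Vec b) :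
    ⟪matVec B.transpose x, y⟫_ℝ = ⟪x, matVec B y⟫_ℝ := by
  rw [real_inner_comm, ← inner_matVec, real_inner_comm]

theorem norm_matVec_transpose_le {a b : ℕ} {B : Matrix (Fin a) (Fin b) ℝ} {q : ℝ} (hq : 0 ≤ q)
    (hB : ∀ y, ‖matVec B y‖ ≤ q * ‖y‖) (x : Vec a) : ‖matVec B.transpose x‖ ≤ q * ‖x‖ := by
  rcases (norm_nonneg (matVec B.transpose x)).eq_or_lt with h0 | h0
  · rw [← h0]; positivity
  · have h1 := inner_matVec B (matVec B.transpose x) x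
    rw [real_inner_self_eq_norm_sq] at h1
    have h2 := real_inner_le_norm (matVec B (matVec B.transpose x)) x
    have h3 := mul_le_mul_of_nonneg_right (hB (matVec B.transpose x)) (norm_nonneg x)
    refine le_of_mul_le_mul_left ?_ h0
    nlinarith

theorem inner_skewOp (B : Matrix (Fin n) (Fin m) ℝ) (z w : PVec n m) :
    ⟪skewOp B z, w⟫_ℝ = -⟪z, skewOp B w⟫_ℝ := by
  rw [pvec_inner, pvec_inner]
  simp only [skewOp_fst, skewOp_snd, inner_neg_left, inner_neg_right]
  rw [inner_matVec, inner_matVec_transpose]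
  ring

theorem inner_self_skewOp (B : Matrix (Fin n) (Fin m) ℝ) (z : PVec n m) :
    ⟪z, skewOp B z⟫_ℝ = 0 := by
  have h := inner_skewOp B z z
  rw [real_inner_comm] at h
  linarith

theorem norm_skewOp_le {B : Matrix (Fin n) (Fin m) ℝ} {q : ℝ} (hq : 0 ≤ q)
    (hB : ∀ y, ‖matVec B y‖ ≤ q * ‖y‖) (z : PVec n m) : ‖skewOp B z‖ ≤ q * ‖z‖ := by
  refine le_of_sq_le_sq ?_ (by positivity)
  have h1 := pow_le_pow_left₀ (norm_nonneg _) (hB z.snd) 2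
  have h2 := pow_le_pow_left₀ (norm_nonneg _) (norm_matVec_transpose_le hq hB z.fst) 2
  rw [mul_pow] at h1 h2 ⊢
  rw [pvec_norm_sq (skewOp B z), pvec_norm_sq z, skewOp_fst, skewOp_snd, norm_neg]
  linarith

theorem symBdd_diagOp {A : Matrix (Fin n) (Fin n) ℝ} {C : Matrix (Fin m) (Fin m) ℝ} {l u : ℝ}
    (hA : SymBdd (Matrix.toEuclideanLin A) l u) (hC : SymBdd (Matrix.toEuclideanLin C) l u) :
    SymBdd (diagOp A C) l u := by
  refine ⟨fun x y => ?_, fun x => ?_, fun x => ?_⟩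
  · simp only [pvec_inner, diagOp_fst, diagOp_snd, matVec_eq, hA.symm, hC.symm]
  · have h1 := hA.lower x.fst
    have h2 := hC.lower x.snd
    rw [pvec_inner, pvec_norm_sq]
    simp only [diagOp_fst, diagOp_snd, matVec_eq]
    linarith
  · have h1 := hA.upper x.fst
    have h2 := hC.upper x.snd
    rw [pvec_inner, pvec_norm_sq]
    simp only [diagOp_fst, diagOp_snd, matVec_eq]
    linarith

/-- `[A, B; -Bᵀ, C]` as a linear map. -/
noncomputable def saddleOp (A : Matrix (Fin n) (Fin n) ℝ) (B : Matrix (Fin n) (Fin m) ℝ)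
    (C : Matrix (Fin m) (Fin m) ℝ) : PVec n m →ₗ[ℝ] PVec n m := diagOp A C + skewOp B

@[simp] theorem saddleOp_snd (A : Matrix (Fin n) (Fin n) ℝ) (B : Matrix (Fin n) (Fin m) ℝ)
    (C : Matrix (Fin m) (Fin m) ℝ) (z : PVec n m) :
    (saddleOp A B C z).snd = -matVec B.transpose z.fst + matVec C z.snd := by
  simp [saddleOp, add_comm]

/-- The function class in terms of linear maps, with separate bounds for all blocks. -/
structure QuadSaddle.Bounded (Q : QuadSaddle n m) (mx my lx ly q : ℝ) : Prop where
  A : SymBdd (Matrix.toEuclideanLin Q.A) mx lx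
  C : SymBdd (Matrix.toEuclideanLin Q.C) my ly
  B : ∀ y, ‖matVec Q.B y‖ ≤ q * ‖y‖

/-- The operator `J` of a quadratic saddle point problem. -/
noncomputable def QuadSaddle.op (Q : QuadSaddle n m) : PVec n m →ₗ[ℝ] PVec n m :=
  saddleOp Q.A Q.B Q.C

namespace QuadSaddle

variable {Q : QuadSaddle n m} {mx my lx ly q : ℝ}

@[simp] theorem op_fst (Q : QuadSaddle n m) (z : PVec n m) :
    (Q.op z).fst = matVec Q.A z.fst + matVec Q.B z.snd := rfl
@[simp] theorem op_snd (Q : QuadSaddle n m) (z : PVec n m) :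
    (Q.op z).snd = -matVec Q.B.transpose z.fst + matVec Q.C z.snd := saddleOp_snd _ _ _ z
@[simp] theorem rhs_fst (Q : QuadSaddle n m) : Q.rhs.fst = -Q.u := rfl
@[simp] theorem rhs_snd (Q : QuadSaddle n m) : Q.rhs.snd = Q.v := rfl

theorem Bounded.monotone (h : Q.Bounded mx my lx ly q) {μ : ℝ} (h1 : μ ≤ mx) (h2 : μ ≤ my)
    (z : PVec n m) : μ * ‖z‖ ^ 2 ≤ ⟪z, Q.op z⟫_ℝ := by
  have h3 := (symBdd_diagOp (h.A.mono h1 (le_max_left lx ly))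
    (h.C.mono h2 (le_max_right lx ly))).lower z
  have h4 := inner_self_skewOp Q.B z
  unfold op saddleOp
  rw [LinearMap.add_apply, inner_add_right, h4, add_zero]
  exact h3

theorem Bounded.norm_op_le (h : Q.Bounded mx my lx ly q) (h0 : 0 ≤ mx) (h0' : 0 ≤ my)
    (hq : 0 ≤ q) {l : ℝ} (hl : 0 < l) (h1 : lx ≤ l) (h2 : ly ≤ l)
    (z : PVec n m) : ‖Q.op z‖ ≤ (l + q) * ‖z‖ := by
  have h3 := (symBdd_diagOp (h.A.mono h0 h1) (h.C.mono h0' h2)).norm_le le_rfl hl z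
  have h4 := norm_skewOp_le hq h.B z
  unfold op saddleOp
  rw [LinearMap.add_apply]
  refine (norm_add_le _ _).trans ?_
  linarith

theorem Bounded.exists_sol (h : Q.Bounded mx my lx ly q) (h0 : 0 < mx) (h0' : 0 < my) :
    ∃ z, Q.op z = Q.rhs := by
  obtain ⟨N, hN, -⟩ := exists_inverse (lt_min h0 h0')
    (h.monotone (min_le_left mx my) (min_le_right mx my))
  exact ⟨N Q.rhs, hN _⟩

end QuadSaddle

theorem meets_residual (Q : QuadSaddle n m) (z : PVec n m) :
    (Q.residual z).Meets 4 (fun w => w = Q.op z - Q.rhs) := by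
  refine (meets_saddleMul Q.A Q.B Q.C z).bind_pure fun p hp => ?_
  rw [hp]
  congr 1
  exact pvec_ext (by simp) (by simp)

/-! ### Alternating Best Response -/

/-- Exact best responses are `1 / 2`-Lipschitz because the coupling is at most half of either
modulus, and descent solves them up to a factor `1 / 16`. The weight `4` on the second block
reflects the order of updates: the new first block depends mainly on the old second block. -/
theorem meets_abr_step {g : QuadSaddle n m} {μx μy lx ly q : ℝ} (hg : g.Bounded μx μy lx ly q)
    (hμx : 0 < μx) (hμy : 0 < μy) (hlx : μx ≤ lx) (hly : μy ≤ ly) (hq : 0 ≤ q) (hqx : q ≤ μx / 2)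
    (hqy : q ≤ μy / 2) {zs : PVec n m} (hs : g.op zs = g.rhs) (z : PVec n m) :
    (do
      let x' ← agd (fun x => g.gradX x z.snd) z.fst lx μx (agdSteps (lx / μx))
      let y' ← agd (fun y => do
        let G ← g.gradY x' y
        pure (-G)) z.snd ly μy (agdSteps (ly / μy))
      pure (pair x' y') : Counted (PVec n m)).Meets
      (agdSteps (lx / μx) * 2 + agdSteps (ly / μy) * 2)
      (fun w => ‖(w - zs).fst‖ + 4 * ‖(w - zs).snd‖
        ≤ 1 / 2 * (‖(z - zs).fst‖ + 4 * ‖(z - zs).snd‖)) := by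
  have hs1 : matVec g.A zs.fst + matVec g.B zs.snd = -g.u := by
    rw [← QuadSaddle.op_fst, hs]; rfl
  have hs2 : -matVec g.B.transpose zs.fst + matVec g.C zs.snd = g.v := by
    rw [← QuadSaddle.op_snd, hs]; rfl
  obtain ⟨NA, hNA, -⟩ := exists_inverse hμx hg.A.lower
  obtain ⟨NC, hNC, -⟩ := exists_inverse hμy hg.C.lower
  set A := Matrix.toEuclideanLin g.A
  set C := Matrix.toEuclideanLin g.C
  set B := Matrix.toEuclideanLin g.B
  set Bt := Matrix.toEuclideanLin g.B.transpose
  simp only [matVec_eq] at hs1 hs2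
  have hBx : ∀ y, ‖NA (B y)‖ ≤ 1 / 2 * ‖y‖ := fun y => by
    have h1 := hg.A.lower_norm (NA (B y))
    rw [hNA] at h1
    have h2 := h1.trans (hg.B y)
    have h3 := mul_le_mul_of_nonneg_right hqx (norm_nonneg y)
    exact le_of_mul_le_mul_left (by linarith) hμx
  have hBy : ∀ x, ‖NC (Bt x)‖ ≤ 1 / 2 * ‖x‖ := fun x => by
    have h1 := hg.C.lower_norm (NC (Bt x))
    rw [hNC] at h1
    have h2 := h1.trans (norm_matVec_transpose_le hq hg.B x)
    have h3 := mul_le_mul_of_nonneg_right hqy (norm_nonneg x)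
    exact le_of_mul_le_mul_left (by linarith) hμy
  -- The partial gradient is `A` applied to the distance from the exact best response, here written
  -- relative to the saddle point.
  refine (meets_agd_agdSteps hg.A hμx hlx (c := 2)
    (xs := zs.fst - NA (B (z.snd - zs.snd))) (fun x => ?_) z.fst).bind fun x' hx' => ?_
  · refine (meets_gradX g x z.snd).mono le_rfl ?_
    rintro w rfl
    have e : g.u = -(A zs.fst + B zs.snd) := by rw [hs1, neg_neg]
    change A x + B z.snd + g.u = A (x - (zs.fst - NA (B (z.snd - zs.snd))))
    simp only [map_sub, hNA, e]
    abel
  refine (meets_agd_agdSteps hg.C hμy hly (c := 2)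
    (xs := zs.snd + NC (Bt (x' - zs.fst))) (fun y => ?_) z.snd).bind_pure fun y' hy' => ?_
  · refine (meets_gradY g x' y).bind_pure ?_
    rintro w rfl
    change -(Bt x' - C y + g.v) = C (y - (zs.snd + NC (Bt (x' - zs.fst))))
    rw [map_sub, map_add, hNC, map_sub, ← hs2]
    abel
  · have h1 := hBx (z.snd - zs.snd)
    have h2 := hBy (x' - zs.fst)
    have e1 : x' - zs.fst = (x' - (zs.fst - NA (B (z.snd - zs.snd)))) - NA (B (z.snd - zs.snd)) := by
      abel
    have e2 : y' - zs.snd = (y' - (zs.snd + NC (Bt (x' - zs.fst)))) + NC (Bt (x' - zs.fst)) := by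
      abel
    have e3 : z.fst - (zs.fst - NA (B (z.snd - zs.snd)))
        = (z.fst - zs.fst) + NA (B (z.snd - zs.snd)) := by abel
    have e4 : z.snd - (zs.snd + NC (Bt (x' - zs.fst)))
        = (z.snd - zs.snd) - NC (Bt (x' - zs.fst)) := by abel
    have h3 := norm_sub_le (x' - (zs.fst - NA (B (z.snd - zs.snd)))) (NA (B (z.snd - zs.snd)))
    have h4 := norm_add_le (y' - (zs.snd + NC (Bt (x' - zs.fst)))) (NC (Bt (x' - zs.fst)))
    have h5 := norm_add_le (z.fst - zs.fst) (NA (B (z.snd - zs.snd)))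
    have h6 := norm_sub_le (z.snd - zs.snd) (NC (Bt (x' - zs.fst)))
    rw [← e1] at h3
    rw [← e2] at h4
    rw [← e3] at h5
    rw [← e4] at h6
    change ‖x' - zs.fst‖ + 4 * ‖y' - zs.snd‖
      ≤ 1 / 2 * (‖z.fst - zs.fst‖ + 4 * ‖z.snd - zs.snd‖)
    linarith [norm_nonneg (z.fst - zs.fst), norm_nonneg (z.snd - zs.snd)]

theorem meets_abr {g : QuadSaddle n m} {μx μy lx ly q ε : ℝ} (hg : g.Bounded μx μy lx ly q)
    (hμx : 0 < μx) (hμy : 0 < μy) (hlx : μx ≤ lx) (hly : μy ≤ ly) (hq : 0 ≤ q) (hqx : q ≤ μx / 2)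
    (hqy : q ≤ μy / 2) {zs : PVec n m} (hs : g.op zs = g.rhs) (z₀ : PVec n m) (hε : 0 < ε) :
    (abr g z₀ ε μx μy lx ly).Meets
      ((⌈Real.logb 2 (4 * √(lx / μx + ly / μy) / ε)⌉₊ + 1)
        * (agdSteps (lx / μx) * 2 + agdSteps (ly / μy) * 2))
      (fun z => ‖z - zs‖ ≤ ε * ‖z₀ - zs‖) := by
  unfold abr
  simp only []
  set T := ⌈Real.logb 2 (4 * √(lx / μx + ly / μy) / ε)⌉₊ with hT
  have key := meets_iter (I := fun t (z : PVec n m) => ‖(z - zs).fst‖ + 4 * ‖(z - zs).snd‖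
        ≤ (1 / 2) ^ t * (‖(z₀ - zs).fst‖ + 4 * ‖(z₀ - zs).snd‖))
      (c := agdSteps (lx / μx) * 2 + agdSteps (ly / μy) * 2)
      (body := fun z => do
        let x' ← agd (fun x => g.gradX x z.snd) z.fst lx μx (agdSteps (lx / μx))
        let y' ← agd (fun y => do
          let G ← g.gradY x' y
          pure (-G)) z.snd ly μy (agdSteps (ly / μy))
        pure (pair x' y')) ?_ (T + 1) 0 z₀ (by simp)
  · refine key.mono (by push_cast; rfl) fun z hz => ?_
    have hκx : 1 ≤ lx / μx := by rwa [le_div_iff₀ hμx, one_mul]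
    have hκy : 1 ≤ ly / μy := by rwa [le_div_iff₀ hμy, one_mul]
    set s := √(lx / μx + ly / μy) with hs'
    have hs1 : 1 ≤ s := by rw [hs', Real.one_le_sqrt]; linarith
    have h1 : (1 / 2 : ℝ) ^ T ≤ ε / (4 * s) := by
      have h2 : Real.logb 2 (4 * s / ε) ≤ T := Nat.le_ceil _
      rw [Real.logb_le_iff_le_rpow (by norm_num) (by positivity), Real.rpow_natCast] at h2
      rw [one_div, inv_pow, ← inv_div]
      exact inv_anti₀ (by positivity) h2
    -- Of the square root inside `T` only the bound `s ≥ 1` is used. The resulting factor `ε / 8`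
    -- pays for comparing the weighted sum of block norms with the Euclidean norm.
    have h2 : ε / (4 * s) ≤ ε / 4 := by
      rw [div_le_div_iff_of_pos_left hε (by linarith) (by norm_num)]; linarith
    have h3 : ‖z - zs‖ ≤ ‖(z - zs).fst‖ + ‖(z - zs).snd‖ := by
      refine le_of_sq_le_sq ?_ (by positivity)
      rw [pvec_norm_sq]
      nlinarith [norm_nonneg (z - zs).fst, norm_nonneg (z - zs).snd]
    have h4 := norm_fst_le (z₀ - zs)
    have h5 := norm_snd_le (z₀ - zs)
    have h6 : (1 / 2 : ℝ) ^ (0 + (T + 1)) ≤ ε / 8 := by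
      rw [zero_add, pow_succ]; linarith
    have h7 := mul_le_mul_of_nonneg_right h6
      (show 0 ≤ ‖(z₀ - zs).fst‖ + 4 * ‖(z₀ - zs).snd‖ by positivity)
    have h8 : ε / 8 * (‖(z₀ - zs).fst‖ + 4 * ‖(z₀ - zs).snd‖) ≤ ε / 8 * (8 * ‖z₀ - zs‖) := by
      refine mul_le_mul_of_nonneg_left ?_ (by positivity)
      linarith [norm_nonneg (z₀ - zs)]
    linarith [norm_nonneg (z - zs).snd]
  · intro t z hz
    refine (meets_abr_step hg hμx hμy hlx hly hq hqx hqy hs z).mono le_rfl fun w hw => ?_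
    rw [pow_succ]
    linarith

/-! ### Proximal Best Response: the inner proximal loop -/

/-- The admissible parameters. -/
structure Params.Ok (P : Params) : Prop where
  mx_pos : 0 < P.mx
  mx_le : P.mx ≤ P.my
  my_le_Lxy : P.my ≤ P.Lxy
  my_le_Lx : P.my ≤ P.Lx

namespace Params.Ok

variable {P : Params}

theorem my_pos (hP : P.Ok) : 0 < P.my := hP.mx_pos.trans_le hP.mx_le
theorem Lxy_pos (hP : P.Ok) : 0 < P.Lxy := hP.my_pos.trans_le hP.my_le_Lxy
theorem Lx_pos (hP : P.Ok) : 0 < P.Lx := hP.my_pos.trans_le hP.my_le_Lx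
theorem Lx_le (_ : P.Ok) : P.Lx ≤ P.L := le_max_left _ _
theorem Lxy_le (_ : P.Ok) : P.Lxy ≤ P.L := le_max_right _ _
theorem my_le (hP : P.Ok) : P.my ≤ P.L := hP.my_le_Lx.trans hP.Lx_le
theorem L_pos (hP : P.Ok) : 0 < P.L := hP.my_pos.trans_le hP.my_le

end Params.Ok

theorem toEuclideanLin_one (d : ℕ) (x : Vec d) :
    Matrix.toEuclideanLin (1 : Matrix (Fin d) (Fin d) ℝ) x = x := by
  simp [Matrix.toEuclideanLin]

theorem SymBdd.add_smul_one {d : ℕ} {A : Matrix (Fin d) (Fin d) ℝ} {l u : ℝ}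
    (h : SymBdd (Matrix.toEuclideanLin A) l u) (s : ℝ) :
    SymBdd (Matrix.toEuclideanLin (A + s • (1 : Matrix (Fin d) (Fin d) ℝ))) (l + s) (u + s) := by
  have e : ∀ x, Matrix.toEuclideanLin (A + s • (1 : Matrix (Fin d) (Fin d) ℝ)) x
      = Matrix.toEuclideanLin A x + s • x := fun x => by
    rw [map_add, map_smul, LinearMap.add_apply, LinearMap.smul_apply, toEuclideanLin_one]
  refine ⟨fun x y => ?_, fun x => ?_, fun x => ?_⟩
  · rw [e, e, inner_add_left, inner_add_right, h.symm, inner_smul_left, inner_smul_right]; rfl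
  · rw [e, inner_add_right, inner_smul_right, real_inner_self_eq_norm_sq]
    linarith [h.lower x]
  · rw [e, inner_add_right, inner_smul_right, real_inner_self_eq_norm_sq]
    linarith [h.upper x]

theorem QuadSaddle.Bounded.addProxX {Q : QuadSaddle n m} {mx my lx ly q : ℝ}
    (h : Q.Bounded mx my lx ly q) (β : ℝ) (xh : Vec n) :
    (Q.addProxX β xh).Bounded (mx + 2 * β) my (lx + 2 * β) ly q :=
  ⟨h.A.add_smul_one _, h.C, h.B⟩

theorem QuadSaddle.Bounded.subProxY {Q : QuadSaddle n m} {mx my lx ly q : ℝ}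
    (h : Q.Bounded mx my lx ly q) (β : ℝ) (yh : Vec m) :
    (Q.subProxY β yh).Bounded mx (my + 2 * β) lx (ly + 2 * β) q :=
  ⟨h.A, h.C.add_smul_one _, h.B⟩

theorem QuadSaddle.norm_grad (Q : QuadSaddle n m) (z : PVec n m) :
    ‖pair (matVec Q.A z.fst + matVec Q.B z.snd + Q.u)
      (matVec Q.B.transpose z.fst - matVec Q.C z.snd + Q.v)‖ = ‖Q.op z - Q.rhs‖ := by
  have h : ‖pair (matVec Q.A z.fst + matVec Q.B z.snd + Q.u)
      (matVec Q.B.transpose z.fst - matVec Q.C z.snd + Q.v)‖ ^ 2 = ‖Q.op z - Q.rhs‖ ^ 2 := by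
    rw [pvec_norm_sq, pvec_norm_sq]
    congr 2
    · simp
    · rw [← norm_neg]
      congr 1
      simp only [pair_snd, WithLp.sub_snd, op_snd, rhs_snd]
      abel
  exact (pow_left_inj₀ (norm_nonneg _) (norm_nonneg _) two_ne_zero).1 h

/-- The parameter `a = 1 / (2 √κ)` of the accelerated proximal point method. -/
theorem prox_params {κ a : ℝ} (hκ : 1 ≤ κ) (ha : a = 1 / (2 * √κ)) :
    0 < a ∧ a ≤ 1 / 2 ∧ a ^ 2 = 1 / (4 * κ) ∧ proxTheta κ = (1 - a) / (1 + a) ∧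
      proxTau κ = a ^ 2 / (1 + a) := by
  have h1 : 1 ≤ √κ := by rwa [Real.one_le_sqrt]
  have h2 : √κ ^ 2 = κ := Real.sq_sqrt (by linarith)
  have h3 : a ^ 2 = 1 / (4 * κ) := by
    rw [ha, div_pow, mul_pow, h2]; norm_num
  refine ⟨by rw [ha]; positivity, ?_, h3, ?_, ?_⟩
  · rw [ha]
    exact one_div_le_one_div_of_le (by norm_num) (by linarith)
  · rw [ha, proxTheta]; field_simp
  · rw [ha, proxTau, show 2 * √κ + 4 * κ = 2 * √κ + 4 * √κ ^ 2 by rw [h2]]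
    field_simp
    ring

/-- The number of products used by one call of Alternating Best Response. -/
noncomputable def abrCost (P : Params) : ℝ :=
  (⌈Real.logb 2 (4 * √(3 * P.L / (2 * P.Lxy) + 3 * P.L / (2 * P.Lxy))
      / (1 / (96 * P.L ^ (5 / 2 : ℝ) / (P.mx * P.my ^ (3 / 2 : ℝ)))))⌉₊ + 1)
    * (agdSteps (3 * P.L / (2 * P.Lxy)) * 2 + agdSteps (3 * P.L / (2 * P.Lxy)) * 2)

theorem abrCost_nonneg (P : Params) : 0 ≤ abrCost P := by unfold abrCost; positivity

/-- This is the accuracy hypothesis of `prox_step` for the inner loop, with `ℓ = 1 / 2`, `K = 11 / 4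
* L` and `a² = m_y / (4 L_xy)`. It is what the precision `96 L ^ (5 / 2) / (m_x m_y ^ (3 / 2))` has
to satisfy. -/
theorem inner_precision {P : Params} (hP : P.Ok) :
    112 * (1 + 2 * (1 / 2) ^ 2) * (11 / 4 * P.L)
      * (1 / (96 * P.L ^ (5 / 2 : ℝ) / (P.mx * P.my ^ (3 / 2 : ℝ)))) ^ 2
      ≤ P.my * (1 / (4 * (P.Lxy / P.my))) := by
  have hL := hP.L_pos
  have hmx := hP.mx_pos
  have hmy := hP.my_pos
  have hxy := hP.Lxy_pos
  have e1 : (P.L ^ (5 / 2 : ℝ)) ^ 2 = P.L ^ 5 := by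
    rw [← Real.rpow_natCast, ← Real.rpow_mul hL.le]; norm_num
  have e2 : (P.my ^ (3 / 2 : ℝ)) ^ 2 = P.my ^ 3 := by
    rw [← Real.rpow_natCast, ← Real.rpow_mul hmy.le]; norm_num
  have e3 : (1 / (96 * P.L ^ (5 / 2 : ℝ) / (P.mx * P.my ^ (3 / 2 : ℝ)))) ^ 2
      = P.mx ^ 2 * P.my ^ 3 / (96 ^ 2 * P.L ^ 5) := by
    rw [← e1, ← e2]; field_simp
  rw [e3]
  have h1 : P.mx ^ 2 * P.my ≤ P.L ^ 3 := by
    have := hP.mx_le.trans hP.my_le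
    calc P.mx ^ 2 * P.my ≤ P.L ^ 2 * P.L := by gcongr; exact hP.my_le
      _ = P.L ^ 3 := by ring
  have h2 : P.my * (1 / (4 * (P.L / P.my))) ≤ P.my * (1 / (4 * (P.Lxy / P.my))) := by
    gcongr; exact hP.Lxy_le
  refine le_trans ?_ h2
  rw [show 112 * (1 + 2 * (1 / 2) ^ 2) * (11 / 4 * P.L)
      * (P.mx ^ 2 * P.my ^ 3 / (96 ^ 2 * P.L ^ 5))
      = (77 / 1536) * (P.mx ^ 2 * P.my) * P.my ^ 2 / P.L ^ 4 by field_simp; norm_num,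
    show P.my * (1 / (4 * (P.L / P.my))) = (1 / 4) * P.L ^ 3 * P.my ^ 2 / P.L ^ 4 by field_simp]
  have h3 : 77 / 1536 * (P.mx ^ 2 * P.my) ≤ 1 / 4 * P.L ^ 3 := by
    have : 0 ≤ P.mx ^ 2 * P.my := by positivity
    linarith
  gcongr ?_ * _ / _

/-- The proximal term acts on `y`, so `x` is eliminated. The outer proximal term already gives the
`x` block modulus at least `2 L_xy`, hence the best response of `x` is `1 / 2`-Lipschitz and the
reduced Hessian has size `O(L)`. -/
theorem meets_appaAbr {P : Params} (hP : P.Ok) {g : QuadSaddle n m}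
    (hg : g.Bounded (P.mx + 2 * P.Lxy) P.my (P.Lx + 2 * P.Lxy) P.Lx P.Lxy) {M₁ : ℝ} (hM : 0 < M₁)
    {zs : PVec n m} (hs : g.op zs = g.rhs) (z₀ : PVec n m) :
    (appaAbr P g z₀ M₁).Meets
      (4 + (max 0 (Real.log (1320 * 81 * P.L ^ 5 * M₁ ^ 2 / (P.my * P.mx ^ 4)))
        * (8 * √(P.Lxy / P.my)) + 2) * (abrCost P + 4))
      (fun z => ‖g.op z - g.rhs‖ ≤ P.mx / (9 * P.L * M₁) * ‖g.op z₀ - g.rhs‖) := by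
  have hL := hP.L_pos
  have hmx := hP.mx_pos
  have hmy := hP.my_pos
  have hxy := hP.Lxy_pos
  have hκ : 1 ≤ P.Lxy / P.my := by rw [le_div_iff₀ hmy, one_mul]; exact hP.my_le_Lxy
  set κ := P.Lxy / P.my with hκdef
  set a := 1 / (2 * √κ) with ha
  obtain ⟨ha0, ha1, ha2, hθ, hτ⟩ := prox_params hκ ha
  have hβ1 : max P.mx P.Lxy = P.Lxy := max_eq_right (hP.mx_le.trans hP.my_le_Lxy)
  have hβ2 : max P.my P.Lxy = P.Lxy := max_eq_right hP.my_le_Lxy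
  have hmin : min P.mx P.my = P.mx := min_eq_left hP.mx_le
  unfold appaAbr
  simp only [hβ1, hβ2, hmin, ← hκdef, hθ, hτ]
  set δ := 1 / (96 * P.L ^ (5 / 2 : ℝ) / (P.mx * P.my ^ (3 / 2 : ℝ))) with hδ
  have hδ0 : 0 < δ := by rw [hδ]; positivity
  -- the reduced problem
  obtain ⟨r, hr1, hr2, hr3, hH⟩ := exists_reduced (b := -Matrix.toEuclideanLin g.B.transpose)
    (bt := -Matrix.toEuclideanLin g.B) (q := P.Lxy) hg.C hg.A (by linarith)
    (fun x y => by
      have := inner_matVec_transpose g.B x y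
      simp only [matVec_eq] at this
      rw [LinearMap.neg_apply, LinearMap.neg_apply, inner_neg_left, inner_neg_right, this])
    (fun y => by rw [LinearMap.neg_apply, norm_neg]; exact hg.B y) hxy.le
  set H := Matrix.toEuclideanLin g.C + (-Matrix.toEuclideanLin g.B.transpose) ∘ₗ r with hHdef
  have hr : ∀ x, ‖r x‖ ≤ 1 / 2 * ‖x‖ := fun x => by
    refine (hr3 x).trans (mul_le_mul_of_nonneg_right ?_ (norm_nonneg _))
    rw [div_le_iff₀ (by linarith)]; linarith
  have hh : (P.Lx + P.Lxy ^ 2 / (P.mx + 2 * P.Lxy)) / 2 + 2 * P.Lxy ≤ 11 / 4 * P.L := by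
    have : P.Lxy ^ 2 / (P.mx + 2 * P.Lxy) ≤ P.Lxy / 2 := by
      rw [div_le_iff₀ (by linarith)]; nlinarith
    linarith [hP.Lx_le, hP.Lxy_le]
  have hK' : P.my * (1 + (1 / 2 : ℝ) ^ 2) ≤ 2 * (11 / 4 * P.L) := by
    linarith [hP.my_le]
  have haγ : a ^ 2 = P.my / (2 * (2 * P.Lxy)) := by rw [ha2, hκdef]; field_simp; ring
  have hprec : 112 * (1 + 2 * (1 / 2 : ℝ) ^ 2) * (11 / 4 * P.L) * δ ^ 2 ≤ P.my * a ^ 2 := by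
    rw [ha2, hκdef]; exact inner_precision hP
  have hs1 : matVec g.A zs.fst + matVec g.B zs.snd = -g.u := by
    rw [← QuadSaddle.op_fst, hs]; rfl
  have hs2 : -matVec g.B.transpose zs.fst + matVec g.C zs.snd = g.v := by
    rw [← QuadSaddle.op_snd, hs]; rfl
  -- the number of steps
  set X := 1320 * 81 * P.L ^ 5 * M₁ ^ 2 / (P.my * P.mx ^ 4) with hX
  obtain ⟨T, hT1, hT2⟩ := exists_steps (q := a / 4) (X := X) (by linarith) (by linarith)
    (by positivity)
  refine (meets_grad g z₀).bind fun G₀ hG₀ => ?_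
  have hG₀n : ‖G₀‖ = ‖g.op z₀ - g.rhs‖ := by rw [hG₀, g.norm_grad]
  refine ((meets_repeatUntil (c := abrCost P + 4) (T := T)
    (I := fun t (s : PVec n m × Vec m × PVec n m) =>
      ‖s.2.2‖ = ‖g.op s.1 - g.rhs‖ ∧
      ∃ v, (1 + a) • (s.2.1 - zs.snd) = (s.1 - zs).snd + a • v ∧
        proxPot H r P.my (s.1 - zs).snd (s.1 - zs).fst v
          ≤ (1 - a / 4) ^ t * proxPot H r P.my (z₀ - zs).snd (z₀ - zs).fst (z₀ - zs).snd)
    (by have := abrCost_nonneg P; linarith) ?_ ?_ ?_).bind_pure ?_).mono ?_ (fun _ h => h)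
  · exact ⟨hG₀n, (z₀ - zs).snd, by
      change (1 + a) • (z₀ - zs).snd = _
      module, by simp⟩
  · rintro t ⟨z, yh, G⟩ ⟨-, v, hv1, hv2⟩
    obtain ⟨zh, hzh⟩ := (hg.subProxY P.Lxy yh).exists_sol (by linarith) (by linarith)
    have hh1 : matVec g.A zh.fst + matVec g.B zh.snd = -g.u :=
      (QuadSaddle.op_fst (g.subProxY P.Lxy yh) zh).symm.trans (congrArg WithLp.fst hzh)
    have hh2 : -matVec g.B.transpose zh.fst
        + matVec (g.C + (2 * P.Lxy) • (1 : Matrix (Fin m) (Fin m) ℝ)) zh.snd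
        = g.v + (2 * P.Lxy) • yh :=
      (QuadSaddle.op_snd (g.subProxY P.Lxy yh) zh).symm.trans (congrArg WithLp.snd hzh)
    have hb := (hg.subProxY P.Lxy yh)
    -- With both proximal terms present, each modulus is at least `2 L_xy` and each upper bound at
    -- most `3 L`, which is the regime of Alternating Best Response.
    have hb' : (g.subProxY P.Lxy yh).Bounded (2 * P.Lxy) (2 * P.Lxy) (3 * P.L) (3 * P.L) P.Lxy :=
      ⟨hb.A.mono (by linarith) (by linarith [hP.Lx_le, hP.Lxy_le]),
        hb.C.mono (by linarith) (by linarith [hP.Lx_le, hP.Lxy_le]), hb.B⟩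
    have hle : 2 * P.Lxy ≤ 3 * P.L := by linarith [hP.Lxy_le]
    refine (meets_abr hb' (by linarith) (by linarith) hle hle hxy.le
      (by linarith) (by linarith) hzh z hδ0).bind fun z' hz' => ?_
    refine (meets_grad g z').bind_pure fun G' hG' => ?_
    refine ⟨by rw [hG', g.norm_grad], ?_⟩
    have hrw : (zh - zs).fst = r (zh - zs).snd := by
      apply hr2
      change Matrix.toEuclideanLin g.A (zh.fst - zs.fst) = -Matrix.toEuclideanLin g.B (zh.snd - zs.snd)
      rw [map_sub, map_sub]
      have := hh1.trans hs1.symm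
      simp only [matVec_eq] at this
      rw [← sub_eq_zero] at this ⊢
      rw [← this]; abel
    have hep : H (zh - zs).snd = (2 * P.Lxy) • ((yh - zs.snd) - (zh - zs).snd) := by
      rw [hHdef, LinearMap.add_apply, LinearMap.comp_apply, ← hrw]
      change Matrix.toEuclideanLin g.C (zh.snd - zs.snd)
        + -Matrix.toEuclideanLin g.B.transpose (zh.fst - zs.fst)
        = (2 * P.Lxy) • ((yh - zs.snd) - (zh.snd - zs.snd))
      have h3 := hh2
      rw [← hs2] at h3
      simp only [matVec_eq, map_add, map_smul, LinearMap.add_apply, LinearMap.smul_apply,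
        toEuclideanLin_one] at h3
      rw [map_sub, map_sub, ← sub_eq_zero]
      rw [← sub_eq_zero] at h3
      rw [← h3]
      module
    obtain ⟨v', hv1', hv2'⟩ := prox_step hH hmy (show 0 < 2 * P.Lxy by linarith) haγ ha0 ha1 hr
      hh hK' hprec hv1 hep (e' := (z' - zs).snd) (w := (z - zs).fst) (w' := (z' - zs).fst) (by
        have e1 : (z' - zs).snd - (zh - zs).snd = (z' - zh).snd := by simp
        have e2 : (z' - zs).fst - (zh - zs).fst = (z' - zh).fst := by simp
        have e3 : (z - zs).snd - (zh - zs).snd = (z - zh).snd := by simp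
        have e4 : (z - zs).fst - (zh - zs).fst = (z - zh).fst := by simp
        rw [← hrw, e1, e2, e3, e4, add_comm, ← pvec_norm_sq, add_comm, ← pvec_norm_sq, ← mul_pow]
        exact pow_le_pow_left₀ (norm_nonneg _) hz' 2)
    refine ⟨v', ?_, hv2'.trans ?_⟩
    · rw [← hv1']
      simp only [WithLp.sub_snd]
      module
    · rw [pow_succ, mul_comm ((1 - a / 4) ^ t), mul_assoc]
      exact mul_le_mul_of_nonneg_left hv2 (by linarith)
  · rintro ⟨z, yh, G⟩ ⟨hG, v, -, hv⟩
    simp only at hG hv ⊢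
    rw [hG, hG₀n]
    have h1 := norm_sq_le_proxPot hH hmy hr (z - zs).snd (z - zs).fst v
    have h2 := proxPot_self_le hH hmy hr (K := 11 / 4 * P.L) (by linarith) hK'
      (z₀ - zs).snd (z₀ - zs).fst
    rw [add_comm, ← pvec_norm_sq] at h1 h2
    have h3 : ‖g.op z - g.rhs‖ ≤ 4 * P.L * ‖z - zs‖ := by
      rw [← hs, ← map_sub]
      refine (hg.norm_op_le (by linarith) hmy.le hxy.le (l := 3 * P.L) (by linarith)
        (by linarith [hP.Lx_le, hP.Lxy_le]) (by linarith [hP.Lx_le, hP.Lxy_le]) _).trans ?_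
      exact mul_le_mul_of_nonneg_right (by linarith [hP.Lxy_le]) (norm_nonneg _)
    have h4 : P.mx * ‖z₀ - zs‖ ≤ ‖g.op z₀ - g.rhs‖ := by
      rw [← hs, ← map_sub]
      exact mul_norm_le_of_monotone (hg.monotone (by linarith) hP.mx_le) _
    set R₀ := ‖g.op z₀ - g.rhs‖
    have h5 : ‖z₀ - zs‖ ^ 2 ≤ R₀ ^ 2 / P.mx ^ 2 := by
      rw [← div_pow]
      exact pow_le_pow_left₀ (norm_nonneg _) (by rwa [le_div_iff₀ hmx, mul_comm]) 2
    have hpw : 0 ≤ (1 - a / 4) ^ (T + 1) := pow_nonneg (by linarith) _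
    have h6 : P.my * ‖z - zs‖ ^ 2
        ≤ 5 * ((1 - a / 4) ^ (T + 1) * (6 * (11 / 4 * P.L) * (R₀ ^ 2 / P.mx ^ 2))) := by
      have e1 := hv.trans (mul_le_mul_of_nonneg_left
        (h2.trans (mul_le_mul_of_nonneg_left h5 (by positivity))) hpw)
      linarith
    refine le_of_sq_le_sq ?_ (by positivity)
    have h7 := pow_le_pow_left₀ (norm_nonneg _) h3 2
    refine h7.trans ?_
    have h8 : ‖z - zs‖ ^ 2
        ≤ 5 * ((1 - a / 4) ^ (T + 1) * (6 * (11 / 4 * P.L) * (R₀ ^ 2 / P.mx ^ 2))) / P.my := by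
      rw [le_div_iff₀ hmy]; linarith
    calc (4 * P.L * ‖z - zs‖) ^ 2 = 16 * P.L ^ 2 * ‖z - zs‖ ^ 2 := by ring
      _ ≤ 16 * P.L ^ 2 * (5 * ((1 - a / 4) ^ (T + 1)
          * (6 * (11 / 4 * P.L) * (R₀ ^ 2 / P.mx ^ 2))) / P.my) := by gcongr
      _ = (X * (1 - a / 4) ^ (T + 1)) * (P.mx / (9 * P.L * M₁) * R₀) ^ 2 := by
          rw [hX]; field_simp; ring
      _ ≤ 1 * (P.mx / (9 * P.L * M₁) * R₀) ^ 2 := by gcongr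
      _ = _ := one_mul _
  · rintro ⟨z, yh, G⟩ ⟨h1, t, h2, -⟩
    simp only at h1 h2 ⊢
    rwa [h2, hG₀n] at h1
  · have e : max 0 (Real.log X) / (a / 4) = max 0 (Real.log X) * (8 * √κ) := by
      rw [ha]; field_simp; ring
    rw [e] at hT2
    have := abrCost_nonneg P
    gcongr

/-! ### Proximal Best Response: the outer proximal loop -/

/-- The precision parameter of the inner loop of Proximal Best Response. -/
noncomputable def pbrM (P : Params) : ℝ :=
  80 * P.L ^ 3 / (P.mx ^ (3 / 2 : ℝ) * P.my ^ (3 / 2 : ℝ))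

theorem pbrM_pos {P : Params} (hP : P.Ok) : 0 < pbrM P := by
  have hL := hP.L_pos
  have hmx := hP.mx_pos
  have hmy := hP.my_pos
  unfold pbrM; positivity

theorem pbrM_sq {P : Params} (hP : P.Ok) :
    pbrM P ^ 2 = 6400 * P.L ^ 6 / (P.mx ^ 3 * P.my ^ 3) := by
  have hmx := hP.mx_pos
  have hmy := hP.my_pos
  have e1 : (P.mx ^ (3 / 2 : ℝ)) ^ 2 = P.mx ^ 3 := by
    rw [← Real.rpow_natCast, ← Real.rpow_mul hmx.le]; norm_num
  have e2 : (P.my ^ (3 / 2 : ℝ)) ^ 2 = P.my ^ 3 := by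
    rw [← Real.rpow_natCast, ← Real.rpow_mul hmy.le]; norm_num
  unfold pbrM
  rw [div_pow, mul_pow, mul_pow, e1, e2]
  ring

/-- The accuracy hypothesis of `prox_step` for the outer loop, with `ℓ = L_xy / m_y` and `K = 3 L ^
2 / m_y`. The error `4 / (9 pbrM)` is the inner residual test divided by `m_x` and multiplied by the
operator bound `4 L`. -/
theorem outer_precision {P : Params} (hP : P.Ok) :
    112 * (1 + 2 * (P.Lxy / P.my) ^ 2) * (3 * P.L ^ 2 / P.my) * (4 / (9 * pbrM P)) ^ 2
      ≤ P.mx * (1 / (4 * (P.Lxy / P.mx))) := by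
  have hL := hP.L_pos
  have hmx := hP.mx_pos
  have hmy := hP.my_pos
  have hxy := hP.Lxy_pos
  have h2 : P.mx * (1 / (4 * (P.L / P.mx))) ≤ P.mx * (1 / (4 * (P.Lxy / P.mx))) := by
    gcongr; exact hP.Lxy_le
  have h1 : 1 + 2 * (P.Lxy / P.my) ^ 2 ≤ 3 * P.L ^ 2 / P.my ^ 2 := by
    have e1 : (P.Lxy / P.my) ^ 2 ≤ (P.L / P.my) ^ 2 := by gcongr; exact hP.Lxy_le
    have e2 : 1 ≤ (P.L / P.my) ^ 2 := by
      rw [one_le_sq_iff₀ (by positivity), le_div_iff₀ hmy, one_mul]; exact hP.my_le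
    have e3 : 3 * P.L ^ 2 / P.my ^ 2 = 3 * (P.L / P.my) ^ 2 := by field_simp
    linarith
  refine le_trans ?_ h2
  have h3 : (4 / (9 * pbrM P)) ^ 2 = P.mx ^ 3 * P.my ^ 3 / (32400 * P.L ^ 6) := by
    rw [div_pow, mul_pow, pbrM_sq hP]; field_simp; norm_num
  rw [h3]
  calc _ ≤ 112 * (3 * P.L ^ 2 / P.my ^ 2) * (3 * P.L ^ 2 / P.my)
        * (P.mx ^ 3 * P.my ^ 3 / (32400 * P.L ^ 6)) := by gcongr
    _ = P.mx ^ 2 / P.L * (1008 / 32400 * P.mx / P.L) := by field_simp; norm_num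
    _ ≤ P.mx ^ 2 / P.L * (1 / 4) := by
        refine mul_le_mul_of_nonneg_left ?_ (by positivity)
        rw [div_le_iff₀ hL]
        linarith [hP.mx_le.trans hP.my_le]
    _ = _ := by field_simp

/-- The number of products used by one call of the inner loop of Proximal Best Response. -/
noncomputable def innerCost (P : Params) : ℝ :=
  4 + (max 0 (Real.log (1320 * 81 * P.L ^ 5 * pbrM P ^ 2 / (P.my * P.mx ^ 4)))
        * (8 * √(P.Lxy / P.my)) + 2) * (abrCost P + 4)

theorem innerCost_nonneg (P : Params) : 0 ≤ innerCost P := by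
  have := abrCost_nonneg P
  unfold innerCost; positivity

/-- Now `y` is eliminated without any added convexity, so the reduced Hessian can be as large as
`L_x + L_xy ^ 2 / m_y` and the best response has Lipschitz constant `L_xy / m_y`. This affects only
the logarithms; the rate depends on the proximal coefficient `2 L_xy` relative to `m_x`. -/
theorem meets_pbr {P : Params} (hP : P.Ok) {Q : QuadSaddle n m}
    (hQ : Q.Bounded P.mx P.my P.Lx P.Lx P.Lxy) (z₀ : PVec n m) {ε : ℝ} (hε : 0 < ε) :
    (pbr P Q z₀ ε).Meets
      (4 + (max 0 (Real.log (576 * P.L ^ 6 / (P.mx ^ 3 * P.my ^ 3) / epsTilde P ε ^ 2))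
        * (8 * √(P.Lxy / P.mx)) + 2) * (innerCost P + 4))
      (fun z => ‖Q.op z - Q.rhs‖ ≤ epsTilde P ε * ‖Q.op z₀ - Q.rhs‖) := by
  have hL := hP.L_pos
  have hmx := hP.mx_pos
  have hmy := hP.my_pos
  have hxy := hP.Lxy_pos
  have hLx := hP.Lx_pos
  have het : 0 < epsTilde P ε := by unfold epsTilde; positivity
  obtain ⟨zs, hs⟩ := hQ.exists_sol hmx hmy
  have hκ : 1 ≤ P.Lxy / P.mx := by
    rw [le_div_iff₀ hmx, one_mul]; exact hP.mx_le.trans hP.my_le_Lxy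
  set κ := P.Lxy / P.mx with hκdef
  set a := 1 / (2 * √κ) with ha
  obtain ⟨ha0, ha1, ha2, hθ, hτ⟩ := prox_params hκ ha
  have hβ1 : max P.mx P.Lxy = P.Lxy := max_eq_right (hP.mx_le.trans hP.my_le_Lxy)
  unfold pbr
  simp only [hβ1, ← hκdef, hθ, hτ]
  rw [← pbrM]
  have hM := pbrM_pos hP
  set δ := 4 / (9 * pbrM P) with hδ
  have hδ0 : 0 < δ := by rw [hδ]; positivity
  -- the reduced problem
  obtain ⟨r, hr1, hr2, hr, hH⟩ := exists_reduced (b := Matrix.toEuclideanLin Q.B)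
    (bt := Matrix.toEuclideanLin Q.B.transpose) (q := P.Lxy) hQ.A hQ.C hmy
    (fun y x => inner_matVec Q.B y x) (fun x => norm_matVec_transpose_le hxy.le hQ.B x) hxy.le
  set H := Matrix.toEuclideanLin Q.A + (Matrix.toEuclideanLin Q.B) ∘ₗ r with hHdef
  set K := 3 * P.L ^ 2 / P.my with hKdef
  have hLK : P.L ≤ P.L ^ 2 / P.my := by
    rw [le_div_iff₀ hmy]; nlinarith [hP.my_le]
  have hKL : K = 3 * (P.L ^ 2 / P.my) := by rw [hKdef]; ring
  have hxyL : P.Lxy ^ 2 / P.my ≤ P.L ^ 2 / P.my := by gcongr; exact hP.Lxy_le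
  have hh : (P.Lx + P.Lxy ^ 2 / P.my) / 2 + 2 * P.Lxy ≤ K := by
    rw [hKL]
    linarith [hP.Lx_le, hP.Lxy_le]
  have hK' : P.mx * (1 + (P.Lxy / P.my) ^ 2) ≤ 2 * K := by
    have e1 : P.mx * (P.Lxy / P.my) ^ 2 ≤ P.my * (P.Lxy / P.my) ^ 2 := by
      gcongr; exact hP.mx_le
    have e2 : P.my * (P.Lxy / P.my) ^ 2 = P.Lxy ^ 2 / P.my := by field_simp
    rw [hKL]
    linarith [hP.mx_le.trans hP.my_le]
  have haγ : a ^ 2 = P.mx / (2 * (2 * P.Lxy)) := by rw [ha2, hκdef]; field_simp; ring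
  have hprec : 112 * (1 + 2 * (P.Lxy / P.my) ^ 2) * K * δ ^ 2 ≤ P.mx * a ^ 2 := by
    rw [ha2, hκdef]; exact outer_precision hP
  have hs1 : matVec Q.A zs.fst + matVec Q.B zs.snd = -Q.u := by
    rw [← QuadSaddle.op_fst, hs]; rfl
  have hs2 : -matVec Q.B.transpose zs.fst + matVec Q.C zs.snd = Q.v := by
    rw [← QuadSaddle.op_snd, hs]; rfl
  -- the number of steps
  set X := 576 * P.L ^ 6 / (P.mx ^ 3 * P.my ^ 3) / epsTilde P ε ^ 2 with hX
  obtain ⟨T, hT1, hT2⟩ := exists_steps (q := a / 4) (X := X) (by linarith) (by linarith)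
    (by positivity)
  refine (meets_residual Q z₀).bind fun R₀ hR₀ => ?_
  refine ((meets_repeatUntil (c := innerCost P + 4) (T := T)
    (I := fun t (s : PVec n m × Vec n × PVec n m) =>
      s.2.2 = Q.op s.1 - Q.rhs ∧
      ∃ v, (1 + a) • (s.2.1 - zs.fst) = (s.1 - zs).fst + a • v ∧
        proxPot H r P.mx (s.1 - zs).fst (s.1 - zs).snd v
          ≤ (1 - a / 4) ^ t * proxPot H r P.mx (z₀ - zs).fst (z₀ - zs).snd (z₀ - zs).fst)
    (by have := innerCost_nonneg P; linarith) ?_ ?_ ?_).bind_pure ?_).mono ?_ (fun _ h => h)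
  · exact ⟨hR₀, (z₀ - zs).fst, by
      change (1 + a) • (z₀ - zs).fst = _
      module, by simp⟩
  · rintro t ⟨z, xh, R⟩ ⟨-, v, hv1, hv2⟩
    have hb := hQ.addProxX P.Lxy xh
    obtain ⟨zh, hzh⟩ := hb.exists_sol (by linarith) (by linarith)
    have hh1 : matVec (Q.A + (2 * P.Lxy) • (1 : Matrix (Fin n) (Fin n) ℝ)) zh.fst
        + matVec Q.B zh.snd = -(Q.u - (2 * P.Lxy) • xh) :=
      (QuadSaddle.op_fst (Q.addProxX P.Lxy xh) zh).symm.trans (congrArg WithLp.fst hzh)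
    have hh2 : -matVec Q.B.transpose zh.fst + matVec Q.C zh.snd = Q.v :=
      (QuadSaddle.op_snd (Q.addProxX P.Lxy xh) zh).symm.trans (congrArg WithLp.snd hzh)
    refine (meets_appaAbr hP hb hM hzh z).bind fun z' hz' => ?_
    refine (meets_residual Q z').bind_pure fun R' hR' => ?_
    refine ⟨hR', ?_⟩
    -- The inner loop stops on the gradient norm. Strong monotonicity below and `4 L` above convert
    -- this into a contraction of the distance to the exact proximal solution.
    have hz'' : ‖z' - zh‖ ≤ δ * ‖z - zh‖ := by
      rw [← hzh, ← map_sub, ← map_sub] at hz'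
      have e1 := mul_norm_le_of_monotone (hb.monotone (μ := P.mx) (by linarith) hP.mx_le) (z' - zh)
      have e2 : ‖(Q.addProxX P.Lxy xh).op (z - zh)‖ ≤ 4 * P.L * ‖z - zh‖ := by
        refine (hb.norm_op_le (by linarith) hmy.le hxy.le (l := 3 * P.L) (by linarith)
          (by linarith [hP.Lx_le, hP.Lxy_le]) (by linarith [hP.Lx_le, hP.Lxy_le]) _).trans ?_
        exact mul_le_mul_of_nonneg_right (by linarith [hP.Lxy_le]) (norm_nonneg _)
      have e3 : P.mx * ‖z' - zh‖ ≤ P.mx * (δ * ‖z - zh‖) := by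
        refine e1.trans (hz'.trans ?_)
        calc _ ≤ P.mx / (9 * P.L * pbrM P) * (4 * P.L * ‖z - zh‖) := by gcongr
          _ = P.mx * (δ * ‖z - zh‖) := by rw [hδ]; field_simp
      exact le_of_mul_le_mul_left e3 hmx
    have hrw : (zh - zs).snd = r (zh - zs).fst := by
      apply hr2
      change Matrix.toEuclideanLin Q.C (zh.snd - zs.snd)
        = Matrix.toEuclideanLin Q.B.transpose (zh.fst - zs.fst)
      rw [map_sub, map_sub]
      have := hh2.trans hs2.symm
      simp only [matVec_eq] at this
      rw [← sub_eq_zero] at this ⊢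
      rw [← this]; abel
    have hep : H (zh - zs).fst = (2 * P.Lxy) • ((xh - zs.fst) - (zh - zs).fst) := by
      rw [hHdef, LinearMap.add_apply, LinearMap.comp_apply, ← hrw]
      change Matrix.toEuclideanLin Q.A (zh.fst - zs.fst)
        + Matrix.toEuclideanLin Q.B (zh.snd - zs.snd)
        = (2 * P.Lxy) • ((xh - zs.fst) - (zh.fst - zs.fst))
      have h3 := hh1
      rw [neg_sub, sub_eq_add_neg, ← hs1] at h3
      simp only [matVec_eq, map_add, map_smul, LinearMap.add_apply, LinearMap.smul_apply,
        toEuclideanLin_one] at h3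
      rw [map_sub, map_sub, ← sub_eq_zero]
      rw [← sub_eq_zero] at h3
      rw [← h3]
      module
    obtain ⟨v', hv1', hv2'⟩ := prox_step hH hmx (show 0 < 2 * P.Lxy by linarith) haγ ha0 ha1 hr
      hh hK' hprec hv1 hep (e' := (z' - zs).fst) (w := (z - zs).snd) (w' := (z' - zs).snd) (by
        have e1 : (z' - zs).snd - (zh - zs).snd = (z' - zh).snd := by simp
        have e2 : (z' - zs).fst - (zh - zs).fst = (z' - zh).fst := by simp
        have e3 : (z - zs).snd - (zh - zs).snd = (z - zh).snd := by simp
        have e4 : (z - zs).fst - (zh - zs).fst = (z - zh).fst := by simp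
        rw [← hrw, e1, e2, e3, e4, ← pvec_norm_sq, ← pvec_norm_sq, ← mul_pow]
        exact pow_le_pow_left₀ (norm_nonneg _) hz'' 2)
    refine ⟨v', ?_, hv2'.trans ?_⟩
    · rw [← hv1']
      simp only [WithLp.sub_fst]
      module
    · rw [pow_succ, mul_comm ((1 - a / 4) ^ t), mul_assoc]
      exact mul_le_mul_of_nonneg_left hv2 (by linarith)
  · rintro ⟨z, xh, R⟩ ⟨hR, v, -, hv⟩
    simp only at hR hv ⊢
    rw [hR, hR₀]
    have h1 := norm_sq_le_proxPot hH hmx hr (z - zs).fst (z - zs).snd v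
    have h2 := proxPot_self_le hH hmx hr (K := K) (by linarith) hK'
      (z₀ - zs).fst (z₀ - zs).snd
    rw [← pvec_norm_sq] at h1 h2
    have h3 : ‖Q.op z - Q.rhs‖ ≤ 2 * P.L * ‖z - zs‖ := by
      rw [← hs, ← map_sub]
      refine (hQ.norm_op_le hmx.le hmy.le hxy.le hL hP.Lx_le hP.Lx_le _).trans ?_
      exact mul_le_mul_of_nonneg_right (by linarith [hP.Lxy_le]) (norm_nonneg _)
    have h4 : P.mx * ‖z₀ - zs‖ ≤ ‖Q.op z₀ - Q.rhs‖ := by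
      rw [← hs, ← map_sub]
      exact mul_norm_le_of_monotone (hQ.monotone le_rfl hP.mx_le) _
    set N₀ := ‖Q.op z₀ - Q.rhs‖
    have h5 : ‖z₀ - zs‖ ^ 2 ≤ N₀ ^ 2 / P.mx ^ 2 := by
      rw [← div_pow]
      exact pow_le_pow_left₀ (norm_nonneg _) (by rwa [le_div_iff₀ hmx, mul_comm]) 2
    have hpw : 0 ≤ (1 - a / 4) ^ (T + 1) := pow_nonneg (by linarith) _
    have hK0 : 0 < K := by rw [hKdef]; positivity
    have hℓ : 4 * (1 + (P.Lxy / P.my) ^ 2) ≤ 8 * (P.L / P.my) ^ 2 := by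
      have e1 : (P.Lxy / P.my) ^ 2 ≤ (P.L / P.my) ^ 2 := by gcongr; exact hP.Lxy_le
      have e2 : 1 ≤ (P.L / P.my) ^ 2 := by
        rw [one_le_sq_iff₀ (by positivity), le_div_iff₀ hmy, one_mul]; exact hP.my_le
      linarith
    have h6 : P.mx * ‖z - zs‖ ^ 2
        ≤ 8 * (P.L / P.my) ^ 2 * ((1 - a / 4) ^ (T + 1) * (6 * K * (N₀ ^ 2 / P.mx ^ 2))) := by
      have e1 := hv.trans (mul_le_mul_of_nonneg_left
        (h2.trans (mul_le_mul_of_nonneg_left h5 (by positivity))) hpw)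
      refine h1.trans ((mul_le_mul_of_nonneg_left e1 (by positivity)).trans ?_)
      exact mul_le_mul_of_nonneg_right hℓ (by positivity)
    refine le_of_sq_le_sq ?_ (by positivity)
    have h7 := pow_le_pow_left₀ (norm_nonneg _) h3 2
    refine h7.trans ?_
    have h8 : ‖z - zs‖ ^ 2 ≤ 8 * (P.L / P.my) ^ 2
        * ((1 - a / 4) ^ (T + 1) * (6 * K * (N₀ ^ 2 / P.mx ^ 2))) / P.mx := by
      rw [le_div_iff₀ hmx]; linarith
    calc (2 * P.L * ‖z - zs‖) ^ 2 = 4 * P.L ^ 2 * ‖z - zs‖ ^ 2 := by ring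
      _ ≤ 4 * P.L ^ 2 * (8 * (P.L / P.my) ^ 2
        * ((1 - a / 4) ^ (T + 1) * (6 * K * (N₀ ^ 2 / P.mx ^ 2))) / P.mx) := by gcongr
      _ = (X * (1 - a / 4) ^ (T + 1)) * (epsTilde P ε * N₀) ^ 2 := by
          rw [hX, hKdef]; field_simp; ring
      _ ≤ 1 * (epsTilde P ε * N₀) ^ 2 := by gcongr
      _ = _ := one_mul _
  · rintro ⟨z, xh, R⟩ ⟨h1, t, h2, -⟩
    simp only at h1 h2 ⊢
    rwa [h2, hR₀] at h1
  · have e : max 0 (Real.log X) / (a / 4) = max 0 (Real.log X) * (8 * √κ) := by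
      rw [ha]; field_simp; ring
    rw [e] at hT2
    have := innerCost_nonneg P
    gcongr

/-! ### Weighted norms for the Hermitian/skew-Hermitian splitting -/

section

variable {E F : Type*} [NormedAddCommGroup E] [InnerProductSpace ℝ E]
  [NormedAddCommGroup F] [InnerProductSpace ℝ F]

/-- `w ↦ ‖D w‖` is the norm `√⟨w, N⁻¹ w⟩`, where `N` commutes with `G`. -/
structure IsWeight (N G : E →ₗ[ℝ] E) (D : E →ₗ[ℝ] F) (lo hi q c : ℝ) : Prop where
  dual : ∀ x y, ⟪D (N x), D y⟫_ℝ = ⟪x, y⟫_ℝ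
  contract : ∀ x, ‖D (N x - G x)‖ ≤ q * ‖D (N x + G x)‖
  lower : ∀ x, lo * ‖D x‖ ^ 2 ≤ ‖x‖ ^ 2
  upper : ∀ x, ‖x‖ ^ 2 ≤ hi * ‖D x‖ ^ 2
  bound : ∀ x, ‖D (G x)‖ ≤ c * ‖D (N x)‖

/-- `N` and `G` share the orthonormal eigenbasis `v`. Taking `D` as the coordinates divided by `√(p
i)` reduces each property to a scalar inequality between eigenvalues. -/
theorem exists_weight {ι : Type} [Fintype ι] (v : OrthonormalBasis ι ℝ E) {N G : E →ₗ[ℝ] E}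
    (hN : ∀ x y, ⟪N x, y⟫_ℝ = ⟪x, N y⟫_ℝ) (hG : ∀ x y, ⟪G x, y⟫_ℝ = ⟪x, G y⟫_ℝ) {p g : ι → ℝ}
    (hp : ∀ i, N (v i) = p i • v i) (hg : ∀ i, G (v i) = g i • v i) {lo hi q c : ℝ}
    (hlo : 0 < lo) (hplo : ∀ i, lo ≤ p i) (hphi : ∀ i, p i ≤ hi) (hq0 : 0 ≤ q) (hc0 : 0 ≤ c)
    (hq : ∀ i, |p i - g i| ≤ q * (p i + g i)) (hg0 : ∀ i, 0 ≤ g i) (hc : ∀ i, g i ≤ c * p i) :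
    ∃ D : E →ₗ[ℝ] EuclideanSpace ℝ ι, IsWeight N G D lo hi q c := by
  have hpos : ∀ i, 0 < p i := fun i => hlo.trans_le (hplo i)
  let D : E →ₗ[ℝ] EuclideanSpace ℝ ι :=
    { toFun := fun x => WithLp.toLp 2 fun i => (√(p i))⁻¹ * ⟪v i, x⟫_ℝ
      map_add' := fun x y => by ext i; simp [inner_add_right, mul_add]
      map_smul' := fun s x => by ext i; simp [inner_smul_right]; ring }
  have hD : ∀ x i, D x i = (√(p i))⁻¹ * ⟪v i, x⟫_ℝ := fun x i => rfl
  have hNi : ∀ x i, ⟪v i, N x⟫_ℝ = p i * ⟪v i, x⟫_ℝ := fun x i => by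
    rw [← hN, hp, inner_smul_left]; rfl
  have hGi : ∀ x i, ⟪v i, G x⟫_ℝ = g i * ⟪v i, x⟫_ℝ := fun x i => by
    rw [← hG, hg, inner_smul_left]; rfl
  have hsq : ∀ i, (√(p i))⁻¹ ^ 2 = (p i)⁻¹ := fun i => by
    rw [inv_pow, Real.sq_sqrt (hpos i).le]
  have hDn : ∀ x, ‖D x‖ ^ 2 = ∑ i, (p i)⁻¹ * ⟪v i, x⟫_ℝ ^ 2 := fun x => by
    rw [EuclideanSpace.real_norm_sq_eq]
    refine Finset.sum_congr rfl fun i _ => ?_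
    rw [hD, mul_pow, hsq]
  have hn : ∀ x, ‖x‖ ^ 2 = ∑ i, ⟪v i, x⟫_ℝ ^ 2 := fun x => by
    rw [← v.sum_sq_norm_inner_right x]
    refine Finset.sum_congr rfl fun i _ => ?_
    rw [Real.norm_eq_abs, sq_abs]
  refine ⟨D, fun x y => ?_, fun x => ?_, fun x => ?_, fun x => ?_, fun x => ?_⟩
  · rw [PiLp.inner_apply, ← v.sum_inner_mul_inner]
    refine Finset.sum_congr rfl fun i _ => ?_
    rw [hD, hD, hNi, real_inner_comm (v i) x]
    change (√(p i))⁻¹ * ⟪v i, y⟫_ℝ * ((√(p i))⁻¹ * (p i * ⟪v i, x⟫_ℝ)) = _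
    have : (√(p i))⁻¹ * (√(p i))⁻¹ * p i = 1 := by
      rw [← sq, hsq, inv_mul_cancel₀ (hpos i).ne']
    linear_combination ⟪v i, y⟫_ℝ * ⟪v i, x⟫_ℝ * this
  · refine le_of_sq_le_sq ?_ (by positivity)
    rw [mul_pow, hDn, hDn, Finset.mul_sum]
    refine Finset.sum_le_sum fun i _ => ?_
    rw [inner_sub_right, inner_add_right, hNi, hGi, ← sub_mul, ← add_mul, mul_pow, mul_pow]
    have h1 := pow_le_pow_left₀ (abs_nonneg _) (hq i) 2
    rw [sq_abs, mul_pow] at h1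
    have h2 : 0 ≤ (p i)⁻¹ * ⟪v i, x⟫_ℝ ^ 2 := by have := hpos i; positivity
    nlinarith [mul_le_mul_of_nonneg_right h1 h2]
  · rw [hDn, hn, Finset.mul_sum]
    refine Finset.sum_le_sum fun i _ => ?_
    have h1 : lo * (p i)⁻¹ ≤ 1 := by
      rw [← div_eq_mul_inv, div_le_one (hpos i)]; exact hplo i
    nlinarith [sq_nonneg ⟪v i, x⟫_ℝ]
  · rw [hDn, hn, Finset.mul_sum]
    refine Finset.sum_le_sum fun i _ => ?_
    have h1 : 1 ≤ hi * (p i)⁻¹ := by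
      rw [← div_eq_mul_inv, le_div_iff₀ (hpos i), one_mul]; exact hphi i
    nlinarith [sq_nonneg ⟪v i, x⟫_ℝ]
  · refine le_of_sq_le_sq ?_ (by positivity)
    rw [mul_pow, hDn, hDn, Finset.mul_sum]
    refine Finset.sum_le_sum fun i _ => ?_
    rw [hNi, hGi, mul_pow, mul_pow]
    have h1 := pow_le_pow_left₀ (hg0 i) (hc i) 2
    rw [mul_pow] at h1
    have h2 : 0 ≤ (p i)⁻¹ * ⟪v i, x⟫_ℝ ^ 2 := by have := hpos i; positivity
    nlinarith [mul_le_mul_of_nonneg_right h1 h2]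

namespace IsWeight

variable {N G S : E →ₗ[ℝ] E} {D : E →ₗ[ℝ] F} {lo hi q c : ℝ}

/-- `N x` and `S x` are orthogonal for the weight `N⁻¹`, since their weighted product is `⟪x, S x⟫`.
Changing the sign of `S` therefore does not change the size (`norm_sq_sub`), so the skew half step
is an isometry. -/
theorem norm_sq_add (h : IsWeight N G D lo hi q c) (hS : ∀ x, ⟪x, S x⟫_ℝ = 0) (x : E) :
    ‖D (N x + S x)‖ ^ 2 = ‖D (N x)‖ ^ 2 + ‖D (S x)‖ ^ 2 := by
  rw [map_add, norm_add_sq_real, h.dual, hS]; ring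

theorem norm_sq_sub (h : IsWeight N G D lo hi q c) (hS : ∀ x, ⟪x, S x⟫_ℝ = 0) (x : E) :
    ‖D (N x - S x)‖ = ‖D (N x + S x)‖ := by
  refine (pow_left_inj₀ (norm_nonneg _) (norm_nonneg _) two_ne_zero).1 ?_
  rw [h.norm_sq_add hS, map_sub, norm_sub_sq_real, h.dual, hS]; ring

theorem norm_residual_le (h : IsWeight N G D lo hi q c) (hc : 0 ≤ c) (hS : ∀ x, ⟪x, S x⟫_ℝ = 0)
    (x : E) : ‖D (G x + S x)‖ ≤ (c + 1) * ‖D (N x + S x)‖ := by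
  have h1 := h.norm_sq_add hS x
  have h2 : ‖D (N x)‖ ≤ ‖D (N x + S x)‖ :=
    le_of_sq_le_sq (by rw [h1]; linarith [sq_nonneg ‖D (S x)‖]) (norm_nonneg _)
  have h3 : ‖D (S x)‖ ≤ ‖D (N x + S x)‖ :=
    le_of_sq_le_sq (by rw [h1]; linarith [sq_nonneg ‖D (N x)‖]) (norm_nonneg _)
  have h4 := h.bound x
  have h5 := mul_le_mul_of_nonneg_left h2 hc
  rw [map_add]
  refine (norm_add_le _ _).trans ?_
  linarith

/-- The inner solvers certify Euclidean relative errors. Measuring them in the weighted norm costs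
the square root `χ` of the condition number of `N`. -/
theorem norm_le_of_le (h : IsWeight N G D lo hi q c) (hlo : 0 < lo) {χ ε : ℝ} (hχ : 0 ≤ χ)
    (hε : 0 ≤ ε) (hhi : hi ≤ χ ^ 2 * lo) {w w' : E} (hw : ‖w‖ ≤ ε * ‖w'‖) :
    ‖D w‖ ≤ ε * χ * ‖D w'‖ := by
  refine le_of_sq_le_sq ?_ (by positivity)
  have h1 := h.lower w
  have h2 := h.upper w'
  have h3 := pow_le_pow_left₀ (norm_nonneg _) hw 2
  have h4 : lo * ‖D w‖ ^ 2 ≤ lo * (ε * χ * ‖D w'‖) ^ 2 := by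
    calc lo * ‖D w‖ ^ 2 ≤ ε ^ 2 * ‖w'‖ ^ 2 := by rw [← mul_pow]; exact h1.trans h3
      _ ≤ ε ^ 2 * (χ ^ 2 * lo * ‖D w'‖ ^ 2) := by
          refine mul_le_mul_of_nonneg_left (h2.trans ?_) (sq_nonneg _)
          exact mul_le_mul_of_nonneg_right hhi (sq_nonneg _)
      _ = lo * (ε * χ * ‖D w'‖) ^ 2 := by ring
  exact le_of_mul_le_mul_left h4 hlo

/-- One inexact step of the splitting iteration. -/
theorem step (h : IsWeight N G D lo hi q c) (hlo : 0 < lo) (hS : ∀ x, ⟪x, S x⟫_ℝ = 0)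
    {χ ε₁ ε₂ ρ : ℝ} (hχ : 0 ≤ χ) (hhi : hi ≤ χ ^ 2 * lo) (hρ0 : 0 < ρ) (hρ1 : ρ ≤ 1)
    (hq0 : 0 ≤ q) (hc0 : 0 ≤ c)
    (hq : q ≤ 1 - 2 * ρ / 3) (hε₁ : 0 ≤ ε₁) (hε₂ : 0 ≤ ε₂) (h1 : ε₁ * χ * (c + 1) ≤ ρ / 24)
    (h2 : ε₂ * χ ≤ ρ / 16) {e eh e' s s' : E} (hs : N eh + G eh = N e - S e + s)
    (hs1 : ‖s‖ ≤ ε₁ * ‖G e + S e‖) (hs' : N e' + S e' = N eh - G eh + s')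
    (hs1' : ‖s'‖ ≤ ε₂ * ‖N e + S e - (N eh - G eh)‖) :
    ‖D (N e' + S e')‖ ≤ (1 - ρ / 3) * ‖D (N e + S e)‖ := by
  set ν := ‖D (N e + S e)‖ with hν
  have hν0 : 0 ≤ ν := norm_nonneg _
  have a1 : ‖D s‖ ≤ ρ / 24 * ν := by
    have := h.norm_le_of_le hlo hχ hε₁ hhi hs1
    refine this.trans ?_
    calc _ ≤ ε₁ * χ * ((c + 1) * ν) :=
          mul_le_mul_of_nonneg_left (h.norm_residual_le hc0 hS e) (by positivity)
      _ = ε₁ * χ * (c + 1) * ν := by ring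
      _ ≤ _ := mul_le_mul_of_nonneg_right h1 hν0
  have a2 : ‖D (N eh - G eh)‖ ≤ q * (ν + ‖D s‖) := by
    refine (h.contract eh).trans (mul_le_mul_of_nonneg_left ?_ hq0)
    rw [hs, map_add, hν, ← h.norm_sq_sub hS]
    exact norm_add_le _ _
  have a3 : ‖D s'‖ ≤ ρ / 16 * (ν + ‖D (N eh - G eh)‖) := by
    refine (h.norm_le_of_le hlo hχ hε₂ hhi hs1').trans ?_
    refine mul_le_mul h2 ?_ (norm_nonneg _) (by positivity)
    rw [map_sub]
    exact norm_sub_le _ _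
  have a4 : ‖D (N e' + S e')‖ ≤ ‖D (N eh - G eh)‖ + ‖D s'‖ := by
    rw [hs', map_add]; exact norm_add_le _ _
  have a5 : q * (ν + ‖D s‖) ≤ (1 - 2 * ρ / 3) * (ν + ρ / 24 * ν) :=
    mul_le_mul hq (by linarith) (by positivity) (by linarith)
  -- The first error costs about `ρ / 24` and the second at most `ρ / 8`, so `1 - 2 ρ / 3` degrades
  -- only to `1 - ρ / 2`, within the claimed factor.
  have a6 : (1 - 2 * ρ / 3) * (ν + ρ / 24 * ν) ≤ ν - 15 / 24 * (ρ * ν) := by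
    nlinarith [mul_nonneg (mul_nonneg hρ0.le hρ0.le) hν0]
  have a7 : 0 ≤ ρ * ν := by positivity
  have a8 : ρ / 16 * (ν + ‖D (N eh - G eh)‖) ≤ ρ / 16 * (ν + ν) := by
    refine mul_le_mul_of_nonneg_left ?_ (by positivity)
    linarith
  linarith

end IsWeight

end

/-- The eigenvalue bounds behind the contraction of the splitting iteration. -/
theorem hss_ratio {ρ μ t : ℝ} (hρ0 : 0 < ρ) (hρ1 : ρ ≤ 1) (hμ : 0 < μ) (ht : μ ≤ t) :
    |(μ / ρ + ρ * t) - t| ≤ (1 - 2 * ρ / 3) * ((μ / ρ + ρ * t) + t) ∧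
      t ≤ 1 / ρ * (μ / ρ + ρ * t) := by
  have ht0 : 0 < t := hμ.trans_le ht
  have hx : ρ * (μ / ρ) = μ := by field_simp
  set x := μ / ρ with hxdef
  have hx0 : 0 < x := by positivity
  constructor
  · rw [abs_le]
    constructor
    · nlinarith [mul_pos hρ0 ht0, mul_pos hρ0 hx0, mul_pos (mul_pos hρ0 hρ0) ht0,
        mul_nonneg (sub_nonneg.2 hρ1) hx0.le, mul_nonneg (sub_nonneg.2 hρ1) (mul_pos hρ0 ht0).le]
    · nlinarith [mul_pos hρ0 ht0, mul_pos hρ0 hx0, mul_pos (mul_pos hρ0 hρ0) ht0,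
        mul_nonneg (sub_nonneg.2 hρ1) hx0.le, mul_nonneg (sub_nonneg.2 hρ1) (mul_pos hρ0 ht0).le]
  · rw [mul_add]
    have : 1 / ρ * (ρ * t) = t := by field_simp
    rw [this]
    have : 0 ≤ 1 / ρ * x := by positivity
    linarith

/-- Each block of `η P` is a polynomial in the corresponding block of `G`, so eigenvectors are
shared. Both shifts are the modulus of the block over the same `ρ`, thanks to the scaling `α = m_x /
m_y`; hence `hss_ratio` gives one contraction factor for both blocks. -/
theorem exists_weight_diagOp {A : Matrix (Fin n) (Fin n) ℝ} {C : Matrix (Fin m) (Fin m) ℝ}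
    {DX : Matrix (Fin n) (Fin n) ℝ} {DY : Matrix (Fin m) (Fin m) ℝ} {mx my l ρ hi : ℝ}
    (hA : SymBdd (Matrix.toEuclideanLin A) mx l) (hC : SymBdd (Matrix.toEuclideanLin C) my l)
    (hmx : 0 < mx) (hmy : mx ≤ my) (hρ0 : 0 < ρ) (hρ1 : ρ ≤ 1)
    (hDX : ∀ x, Matrix.toEuclideanLin DX x = (mx / ρ) • x + ρ • Matrix.toEuclideanLin A x)
    (hDY : ∀ y, Matrix.toEuclideanLin DY y = (my / ρ) • y + ρ • Matrix.toEuclideanLin C y)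
    (hhi : my / ρ + ρ * l ≤ hi) :
    ∃ D : PVec n m →ₗ[ℝ] EuclideanSpace ℝ (Fin n ⊕ Fin m),
      IsWeight (diagOp DX DY) (diagOp A C) D (mx / ρ) hi (1 - 2 * ρ / 3) (1 / ρ) := by
  have sA : (Matrix.toEuclideanLin A).IsSymmetric := hA.symm
  have sC : (Matrix.toEuclideanLin C).IsSymmetric := hC.symm
  have hn : Module.finrank ℝ (Vec n) = n := finrank_euclideanSpace_fin
  have hm : Module.finrank ℝ (Vec m) = m := finrank_euclideanSpace_fin
  set vA := sA.eigenvectorBasis hn with hvA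
  set vC := sC.eigenvectorBasis hm with hvC
  have eA : ∀ i, Matrix.toEuclideanLin A (vA i) = sA.eigenvalues hn i • vA i := fun i =>
    sA.apply_eigenvectorBasis hn i
  have eC : ∀ i, Matrix.toEuclideanLin C (vC i) = sC.eigenvalues hm i • vC i := fun i =>
    sC.apply_eigenvectorBasis hm i
  set a := sA.eigenvalues hn
  set c := sC.eigenvalues hm
  have hal : ∀ i, mx ≤ a i ∧ a i ≤ l := fun i => by
    have h1 := hA.lower (vA i)
    have h2 := hA.upper (vA i)
    rw [eA, inner_smul_right, real_inner_self_eq_norm_sq, vA.norm_eq_one] at h1 h2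
    constructor <;> linarith
  have hcl : ∀ i, my ≤ c i ∧ c i ≤ l := fun i => by
    have h1 := hC.lower (vC i)
    have h2 := hC.upper (vC i)
    rw [eC, inner_smul_right, real_inner_self_eq_norm_sq, vC.norm_eq_one] at h1 h2
    constructor <;> linarith
  have sDX : ∀ x y, ⟪Matrix.toEuclideanLin DX x, y⟫_ℝ = ⟪x, Matrix.toEuclideanLin DX y⟫_ℝ :=
    fun x y => by
      simp only [hDX, inner_add_left, inner_add_right, inner_smul_left, inner_smul_right, hA.symm]
      rfl
  have sDY : ∀ x y, ⟪Matrix.toEuclideanLin DY x, y⟫_ℝ = ⟪x, Matrix.toEuclideanLin DY y⟫_ℝ :=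
    fun x y => by
      simp only [hDY, inner_add_left, inner_add_right, inner_smul_left, inner_smul_right, hC.symm]
      rfl
  have hmy0 : 0 < my := hmx.trans_le hmy
  have hmm : mx / ρ ≤ my / ρ := by gcongr
  refine exists_weight (vA.prod vC) (p := Sum.elim (fun i => mx / ρ + ρ * a i)
    (fun i => my / ρ + ρ * c i)) (g := Sum.elim a c) (fun z w => ?_) (fun z w => ?_) ?_ ?_
    (by positivity) ?_ ?_ (by linarith) (by positivity) ?_ ?_ ?_
  · simp only [pvec_inner, diagOp_fst, diagOp_snd, matVec_eq, sDX, sDY]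
  · simp only [pvec_inner, diagOp_fst, diagOp_snd, matVec_eq, hA.symm, hC.symm]
  · rintro (i | i)
    · refine pvec_ext ?_ ?_
      · simp [matVec_eq, hDX, eA, add_smul, smul_smul]
      · simp [matVec_eq]
    · refine pvec_ext ?_ ?_
      · simp [matVec_eq]
      · simp [matVec_eq, hDY, eC, add_smul, smul_smul]
  · rintro (i | i)
    · refine pvec_ext ?_ ?_
      · simp [matVec_eq, eA]
      · simp [matVec_eq]
    · refine pvec_ext ?_ ?_
      · simp [matVec_eq]
      · simp [matVec_eq, eC]
  · rintro (i | i)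
    · have := mul_pos hρ0 (hmx.trans_le (hal i).1)
      simp only [Sum.elim_inl]; linarith
    · have := mul_pos hρ0 (hmy0.trans_le (hcl i).1)
      simp only [Sum.elim_inr]; linarith
  · rintro (i | i)
    · have := mul_le_mul_of_nonneg_left (hal i).2 hρ0.le
      simp only [Sum.elim_inl]; linarith
    · have := mul_le_mul_of_nonneg_left (hcl i).2 hρ0.le
      simp only [Sum.elim_inr]; linarith
  · rintro (i | i)
    · exact (hss_ratio hρ0 hρ1 hmx (hal i).1).1
    · exact (hss_ratio hρ0 hρ1 hmy0 (hcl i).1).1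
  · rintro (i | i)
    · exact hmx.le.trans (hal i).1
    · exact hmy0.le.trans (hcl i).1
  · rintro (i | i)
    · exact (hss_ratio hρ0 hρ1 hmx (hal i).1).2
    · exact (hss_ratio hρ0 hρ1 hmy0 (hcl i).1).2

/-! ### Parameters of the splitting in terms of `ρ` -/

/-- `ρ = (m_y / L_xy)^(1/k)`. -/
noncomputable def hssRho (k : ℕ) (P : Params) : ℝ := (P.my / P.Lxy) ^ (1 / (k : ℝ))

section

variable {P : Params} {k : ℕ}

theorem hssRho_pos (hP : P.Ok) : 0 < hssRho k P :=
  Real.rpow_pos_of_pos (div_pos hP.my_pos hP.Lxy_pos) _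

theorem hssRho_le_one (hP : P.Ok) : hssRho k P ≤ 1 :=
  Real.rpow_le_one (div_pos hP.my_pos hP.Lxy_pos).le
    ((div_le_one hP.Lxy_pos).2 hP.my_le_Lxy) (by positivity)

theorem hssRho_pow (hP : P.Ok) (hk : k ≠ 0) : hssRho k P ^ k = P.my / P.Lxy := by
  unfold hssRho
  rw [one_div, Real.rpow_inv_natCast_pow (div_pos hP.my_pos hP.Lxy_pos).le hk]

theorem hssRho_one (hP : P.Ok) : hssRho 1 P = P.my / P.Lxy := by
  have := hssRho_pow hP one_ne_zero
  rwa [pow_one] at this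

theorem le_hssRho (hP : P.Ok) (hk : k ≠ 0) : P.my / P.Lxy ≤ hssRho k P := by
  rw [← hssRho_pow hP hk]
  exact pow_le_of_le_one (hssRho_pos hP).le (hssRho_le_one hP) hk

theorem my_div_hssRho_le (hP : P.Ok) (hk : k ≠ 0) : P.my / hssRho k P ≤ P.Lxy := by
  have := le_hssRho hP hk
  rw [div_le_iff₀ hP.Lxy_pos] at this
  rw [div_le_iff₀ (hssRho_pos hP)]
  linarith

/-- With the companion identities `η β = ρ` and `η α = m_x / ρ`, this removes all fractional powers:
from here on only `ρ` appears. -/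
theorem hssEta_eq (hP : P.Ok) : hssEta k P = P.my / hssRho k P := by
  have hy := hP.my_pos
  have hxy := hP.Lxy_pos
  unfold hssEta hssRho
  rw [Real.div_rpow hy.le hxy.le, Real.rpow_sub hy, Real.rpow_one]
  field_simp

theorem hssEta_mul_hssBeta (hP : P.Ok) (hk : k ≠ 0) :
    hssEta k P * hssBeta k P = hssRho k P := by
  have hy := hP.my_pos
  have hxy := hP.Lxy_pos
  have hk' : (k : ℝ) ≠ 0 := by exact_mod_cast hk
  unfold hssEta hssRho hssBeta
  rw [Real.div_rpow hy.le hxy.le]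
  have e1 : P.Lxy ^ (1 / (k : ℝ)) * P.my ^ (1 - 1 / (k : ℝ))
      * (P.Lxy ^ (-(2 / (k : ℝ))) * P.my ^ (-(((k : ℝ) - 2) / (k : ℝ))))
      = (P.Lxy ^ (1 / (k : ℝ)) * P.Lxy ^ (-(2 / (k : ℝ))))
        * (P.my ^ (1 - 1 / (k : ℝ)) * P.my ^ (-(((k : ℝ) - 2) / (k : ℝ)))) := by ring
  have e2 : P.my ^ (1 / (k : ℝ)) / P.Lxy ^ (1 / (k : ℝ))
      = P.Lxy ^ (-(1 / (k : ℝ))) * P.my ^ (1 / (k : ℝ)) := by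
    rw [Real.rpow_neg hxy.le]; field_simp
  rw [e1, e2, ← Real.rpow_add hxy, ← Real.rpow_add hy]
  congr 2
  · field_simp; ring
  · field_simp; ring

theorem hssEta_mul_hssAlpha (hP : P.Ok) : hssEta k P * hssAlpha P = P.mx / hssRho k P := by
  have hy := hP.my_pos
  have hρ := hssRho_pos (k := k) hP
  rw [hssEta_eq hP]
  unfold hssAlpha
  field_simp

theorem hssParams_mx (hP : P.Ok) : (hssParams k P).mx = P.mx / hssRho k P :=
  hssEta_mul_hssAlpha hP

theorem hssParams_my (hP : P.Ok) : (hssParams k P).my = P.my / hssRho k P := hssEta_eq hP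

theorem hssParams_Lxy : (hssParams k P).Lxy = P.Lxy := rfl

theorem hssParams_Lx (hP : P.Ok) (hk : k ≠ 0) :
    (hssParams k P).Lx = 2 * max (P.my / hssRho k P) (hssRho k P * P.Lx) := by
  have hη : 0 ≤ hssEta k P := by
    have := hP.my_pos
    have := hssRho_pos (k := k) hP
    rw [hssEta_eq hP]; positivity
  have : (hssParams k P).Lx = 2 * (hssEta k P * max 1 (hssBeta k P * P.Lx)) := by
    unfold hssParams; ring
  rw [this, mul_max_of_nonneg _ _ hη, ← mul_assoc, hssEta_mul_hssBeta hP hk, mul_one,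
    hssEta_eq hP]

theorem hssParams_Lx_le (hP : P.Ok) (hk : k ≠ 0) : (hssParams k P).Lx ≤ 2 * P.L := by
  rw [hssParams_Lx hP hk]
  have h1 := (my_div_hssRho_le hP hk).trans hP.Lxy_le
  have h2 : hssRho k P * P.Lx ≤ P.L :=
    (mul_le_of_le_one_left hP.Lx_pos.le (hssRho_le_one hP)).trans hP.Lx_le
  linarith [max_le h1 h2]

/-- Dividing `m_y` by `ρ` stays below `L_xy` because `ρ ≥ m_y / L_xy`. The maximum with `1` in the
new `L_x` keeps it above the new `m_y` even if `β L_x < 1`. -/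
theorem hssParams_ok (hP : P.Ok) (hk : k ≠ 0) : (hssParams k P).Ok := by
  have hρ := hssRho_pos (k := k) hP
  refine ⟨?_, ?_, ?_, ?_⟩
  · rw [hssParams_mx hP]; exact div_pos hP.mx_pos hρ
  · rw [hssParams_mx hP, hssParams_my hP]
    exact div_le_div_of_nonneg_right hP.mx_le hρ.le
  · rw [hssParams_my hP]; exact my_div_hssRho_le hP hk
  · rw [hssParams_my hP, hssParams_Lx hP hk]
    have h1 := le_max_left (P.my / hssRho k P) (hssRho k P * P.Lx)
    have h2 := div_pos hP.my_pos hρ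
    linarith

theorem hssBlockX_apply (hP : P.Ok) (hk : k ≠ 0) (Q : QuadSaddle n m) (x : Vec n) :
    Matrix.toEuclideanLin (hssBlockX k P Q) x
      = (P.mx / hssRho k P) • x + hssRho k P • Matrix.toEuclideanLin Q.A x := by
  unfold hssBlockX
  rw [smul_add, smul_smul, smul_smul, hssEta_mul_hssAlpha hP, hssEta_mul_hssBeta hP hk, map_add,
    map_smul, map_smul, LinearMap.add_apply, LinearMap.smul_apply, LinearMap.smul_apply,
    toEuclideanLin_one]

theorem hssBlockY_apply (hP : P.Ok) (hk : k ≠ 0) (Q : QuadSaddle n m) (y : Vec m) :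
    Matrix.toEuclideanLin (hssBlockY k P Q) y
      = (P.my / hssRho k P) • y + hssRho k P • Matrix.toEuclideanLin Q.C y := by
  unfold hssBlockY
  rw [smul_add, smul_smul, hssEta_mul_hssBeta hP hk, hssEta_eq hP, map_add,
    map_smul, map_smul, LinearMap.add_apply, LinearMap.smul_apply, LinearMap.smul_apply,
    toEuclideanLin_one]

end

theorem SymBdd.of_apply {E : Type*} [NormedAddCommGroup E] [InnerProductSpace ℝ E]
    {M N : E →ₗ[ℝ] E} {l u s t : ℝ} (h : SymBdd M l u) (ht : 0 ≤ t)
    (hN : ∀ x, N x = s • x + t • M x) : SymBdd N (s + t * l) (s + t * u) := by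
  refine ⟨fun x y => ?_, fun x => ?_, fun x => ?_⟩
  · rw [hN, hN, inner_add_left, inner_add_right, inner_smul_left, inner_smul_left,
      inner_smul_right, inner_smul_right, h.symm]
    rfl
  · rw [hN, inner_add_right, inner_smul_right, inner_smul_right, real_inner_self_eq_norm_sq]
    nlinarith [mul_le_mul_of_nonneg_left (h.lower x) ht]
  · rw [hN, inner_add_right, inner_smul_right, inner_smul_right, real_inner_self_eq_norm_sq]
    nlinarith [mul_le_mul_of_nonneg_left (h.upper x) ht]

/-! ### One level of the splitting recursion -/

/-- The number of products used by one call of conjugate gradient. -/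
noncomputable def cgCost (k : ℕ) (P : Params) : ℝ :=
  2 * (max 0 (Real.log (2 * (((hssParams k P).Lx + P.Lx) / (hssParams k P).mx)
      / (1 / (192 * P.L ^ 5 / (P.mx ^ 2 * P.my ^ 3))) ^ 2))
    * √(((hssParams k P).Lx + P.Lx) / (hssParams k P).mx) + 2) + 2

theorem cgCost_nonneg (k : ℕ) (P : Params) : 0 ≤ cgCost k P := by
  unfold cgCost; positivity

/-- The first accuracy hypothesis of `IsWeight.step`. It explains `192 L ^ 5 / (m_x ^ 2 m_y ^ 3)`:
the weight costs at most `2 L / m_x`, the residual bound at most `2 L / m_y`, and `ρ ≥ m_y / L`. -/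
theorem cg_precision {P : Params} (hP : P.Ok) {k : ℕ} (hk : k ≠ 0) :
    1 / (192 * P.L ^ 5 / (P.mx ^ 2 * P.my ^ 3)) * √((hssParams k P).Lx / (hssParams k P).mx)
      * (1 / hssRho k P + 1) ≤ hssRho k P / 24 := by
  have hL := hP.L_pos
  have hmx := hP.mx_pos
  have hmy := hP.my_pos
  have hρ := hssRho_pos (k := k) hP
  have hρ1 := hssRho_le_one (k := k) hP
  have hρ2 : P.my / P.L ≤ hssRho k P := by
    refine le_trans ?_ (le_hssRho hP hk)
    exact div_le_div_of_nonneg_left hmy.le hP.Lxy_pos hP.Lxy_le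
  have hmL := hP.mx_le.trans hP.my_le
  set ρ := hssRho k P
  have h1 : √((hssParams k P).Lx / (hssParams k P).mx) ≤ 2 * P.L / P.mx := by
    rw [Real.sqrt_le_left (by positivity), hssParams_mx hP]
    have e1 := hssParams_Lx_le hP hk
    calc (hssParams k P).Lx / (P.mx / ρ) ≤ 2 * P.L / (P.mx / ρ) := by gcongr
      _ = ρ * (2 * P.L / P.mx) := by field_simp
      _ ≤ 1 * (2 * P.L / P.mx) := by gcongr
      _ ≤ (2 * P.L / P.mx) * (2 * P.L / P.mx) := by
          gcongr
          rw [le_div_iff₀ hmx]; linarith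
      _ = (2 * P.L / P.mx) ^ 2 := by ring
  have h2 : 1 / ρ + 1 ≤ 2 * (P.L / P.my) := by
    have e1 : 1 / ρ ≤ P.L / P.my := by
      rw [div_le_div_iff₀ hρ hmy]
      rw [div_le_iff₀ hL] at hρ2
      linarith
    have e2 : 1 ≤ P.L / P.my := by rw [le_div_iff₀ hmy, one_mul]; exact hP.my_le
    linarith
  have h3 : P.mx / P.L ≤ 1 := by rw [div_le_one hL]; exact hmL
  have h4 : P.my / P.L ≤ 1 := by rw [div_le_one hL]; exact hP.my_le
  calc _ ≤ 1 / (192 * P.L ^ 5 / (P.mx ^ 2 * P.my ^ 3)) * (2 * P.L / P.mx)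
        * (2 * (P.L / P.my)) := by gcongr
    _ = P.mx / P.L * (P.my / P.L) * (P.my / P.L) / 48 := by field_simp; norm_num
    _ ≤ 1 * 1 * (P.my / P.L) / 48 := by gcongr
    _ ≤ ρ / 24 := by linarith

/-- The second accuracy hypothesis of `IsWeight.step`. The factor `m_x' / (L_xy + L_x')` hidden in
the residual test of the recursive call already pays for the condition number of the weight, so `16
L_xy / m_y` only has to beat `16 / ρ`. -/
theorem rec_precision {P : Params} (hP : P.Ok) {k : ℕ} (hk : k ≠ 0) :
    epsTilde (hssParams k P) (1 / (16 * P.Lxy / P.my))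
      * √((hssParams k P).Lx / (hssParams k P).mx) ≤ hssRho k P / 16 := by
  have hmy := hP.my_pos
  have hxy := hP.Lxy_pos
  have hP' := hssParams_ok hP hk
  have h1 := le_hssRho hP hk
  have hx := hP'.Lx_pos
  have hm := hP'.mx_pos
  set P' := hssParams k P with hPd
  have hxy' : P'.Lxy = P.Lxy := rfl
  have h2 : P'.mx * √(P'.Lx / P'.mx) ≤ P'.Lx := by
    have h3 : √(P'.Lx / P'.mx) ≤ P'.Lx / P'.mx := by
      rw [Real.sqrt_le_left (by positivity)]
      refine le_self_pow₀ ?_ two_ne_zero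
      rw [le_div_iff₀ hm, one_mul]
      exact hP'.mx_le.trans hP'.my_le_Lx
    rw [le_div_iff₀ hm] at h3
    linarith
  unfold epsTilde
  rw [hxy']
  calc _ = (P'.mx * √(P'.Lx / P'.mx)) / (P.Lxy + P'.Lx) * (P.my / P.Lxy) / 16 := by field_simp
    _ ≤ 1 * (P.my / P.Lxy) / 16 := by
        gcongr
        rw [div_le_one (by positivity)]
        linarith
    _ ≤ hssRho k P / 16 := by linarith

/-- The potential is the weighted norm of `(N + S)` applied to the error. The recursive call enters
only through its cost `N` and its final relative residual, which is why the stopping rule, not the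
distance guarantee, is carried through the induction. -/
theorem meets_rhss_succ {P : Params} (hP : P.Ok) {Q : QuadSaddle n m}
    (hQ : Q.Bounded P.mx P.my P.Lx P.Lx P.Lxy) {k : ℕ} {N : ℝ}
    (hN : ∀ (R : QuadSaddle n m) (z : PVec n m),
      R.Bounded (hssParams (k + 2) P).mx (hssParams (k + 2) P).my (hssParams (k + 2) P).Lx
        (hssParams (k + 2) P).Lx (hssParams (k + 2) P).Lxy →
      (rhss (k + 1) (hssParams (k + 2) P) R z (1 / (16 * P.Lxy / P.my))).Meets N
        (fun w => ‖R.op w - R.rhs‖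
          ≤ epsTilde (hssParams (k + 2) P) (1 / (16 * P.Lxy / P.my)) * ‖R.op z - R.rhs‖))
    (hN0 : 0 ≤ N) (z₀ : PVec n m) {ε : ℝ} (hε : 0 < ε) :
    (rhss (k + 2) P Q z₀ ε).Meets
      (4 + (max 0 (Real.log (72 * P.L ^ 5 / (P.mx ^ 3 * P.my ^ 2) / epsTilde P ε ^ 2))
        * (3 / hssRho (k + 2) P) + 2) * (cgCost (k + 2) P + N + 10))
      (fun z => ‖Q.op z - Q.rhs‖ ≤ epsTilde P ε * ‖Q.op z₀ - Q.rhs‖) := by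
  have hL := hP.L_pos
  have hmx := hP.mx_pos
  have hmy := hP.my_pos
  have hxy := hP.Lxy_pos
  have hLx := hP.Lx_pos
  have hk : k + 2 ≠ 0 := by omega
  have het : 0 < epsTilde P ε := by unfold epsTilde; positivity
  have hP' := hssParams_ok hP hk
  have hLx' := hssParams_Lx_le hP hk
  have hmx' := hssParams_mx (k := k + 2) hP
  have hLx'e := hssParams_Lx hP hk
  have hcg := cg_precision hP hk
  have hrec := rec_precision hP hk
  have hX := hssBlockX_apply hP hk Q
  have hY := hssBlockY_apply hP hk Q
  have hρ := hssRho_pos (k := k + 2) hP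
  have hρ1 := hssRho_le_one (k := k + 2) hP
  have hρ2 := le_hssRho hP hk
  have hcgc := cgCost_nonneg (k + 2) P
  obtain ⟨zs, hs⟩ := hQ.exists_sol hmx hmy
  rw [rhss]
  simp only []
  unfold cgCost at *
  set DX := hssBlockX (k + 2) P Q
  set DY := hssBlockY (k + 2) P Q
  set ρ := hssRho (k + 2) P with hρdef
  set P' := hssParams (k + 2) P with hP'def
  have hxy' : P'.Lxy = P.Lxy := rfl
  set lo := P'.mx with hlo
  have hlo0 : 0 < lo := hP'.mx_pos
  set hi := P'.Lx with hhi
  have hhi0 : 0 < hi := hP'.Lx_pos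
  set ε₁ := 1 / (192 * P.L ^ 5 / (P.mx ^ 2 * P.my ^ 3)) with hε₁
  have hε₁0 : 0 < ε₁ := by rw [hε₁]; positivity
  set ε₂ := epsTilde P' (1 / (16 * P.Lxy / P.my)) with hε₂
  have hε₂0 : 0 < ε₂ := by
    rw [hε₂]; unfold epsTilde; rw [hxy']; positivity
  -- The factor `2` in the new `L_x` is needed here: the sum of the two terms is at most twice their
  -- maximum.
  have hmyhi : P.my / ρ + ρ * P.Lx ≤ hi := by
    rw [hLx'e]
    have h1 := le_max_left (P.my / ρ) (ρ * P.Lx)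
    have h2 := le_max_right (P.my / ρ) (ρ * P.Lx)
    linarith
  have hmxmy : P.mx / ρ ≤ P.my / ρ := div_le_div_of_nonneg_right hP.mx_le hρ.le
  obtain ⟨D, hD⟩ := exists_weight_diagOp hQ.A hQ.C hmx hP.mx_le hρ hρ1 hX hY hmyhi
  rw [← hmx'] at hD
  set N₁ := diagOp DX DY with hN₁
  set G := diagOp Q.A Q.C with hG
  set S := skewOp Q.B with hS
  have hS0 : ∀ x, ⟪x, S x⟫_ℝ = 0 := inner_self_skewOp Q.B
  have hop : ∀ z, Q.op z = G z + S z := fun z => rfl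
  have hDXb : SymBdd (Matrix.toEuclideanLin DX) lo hi := by
    refine (hQ.A.of_apply hρ.le hX).mono ?_ ?_
    · rw [hmx']; have := mul_pos hρ hmx; linarith
    · linarith
  have hDYb : SymBdd (Matrix.toEuclideanLin DY) P'.my hi := by
    refine (hQ.C.of_apply hρ.le hY).mono ?_ hmyhi
    rw [hssParams_my hP]; have := mul_pos hρ hmy; linarith
  -- the operator of conjugate gradient
  have hMadd : ∀ z, diagOp (DX + Q.A) (DY + Q.C) z = N₁ z + G z := fun z =>
    pvec_ext (by simp [hN₁, hG, matVec_eq]) (by simp [hN₁, hG, matVec_eq])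
  have hMsub : ∀ z, diagOp (DX - Q.A) (DY - Q.C) z = N₁ z - G z := fun z =>
    pvec_ext (by simp [hN₁, hG, matVec_eq]) (by simp [hN₁, hG, matVec_eq])
  have hMb : SymBdd (diagOp (DX + Q.A) (DY + Q.C)) lo (hi + P.Lx) := by
    have h1 := symBdd_diagOp hDXb (hDYb.mono hP'.mx_le le_rfl)
    have h2 := symBdd_diagOp (hQ.A.mono hmx.le le_rfl) (hQ.C.mono hmy.le le_rfl)
    refine ⟨fun x y => ?_, fun x => ?_, fun x => ?_⟩
    · rw [hMadd, hMadd, inner_add_left, inner_add_right, h1.symm, h2.symm]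
    · rw [hMadd, inner_add_right]; linarith [h1.lower x, h2.lower x]
    · rw [hMadd, inner_add_right]; linarith [h1.upper x, h2.upper x]
  have hlohi : lo ≤ hi + P.Lx := by linarith [hP'.mx_le.trans hP'.my_le_Lx]
  obtain ⟨MI, hMI, -⟩ := exists_inverse hlo0 hMb.lower
  -- the number of steps
  set X := 72 * P.L ^ 5 / (P.mx ^ 3 * P.my ^ 2) / epsTilde P ε ^ 2 with hXdef
  obtain ⟨T, hT1, hT2⟩ := exists_steps (q := ρ / 3) (X := X) (by linarith) (by linarith)
    (by positivity)
  set cg := 2 * (max 0 (Real.log (2 * ((hi + P.Lx) / lo) / ε₁ ^ 2)) * √((hi + P.Lx) / lo) + 2) + 2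
    with hcgdef
  refine (meets_residual Q z₀).bind fun R₀ hR₀ => ?_
  refine ((meets_repeatUntil (c := cg + N + 10) (T := T)
    (I := fun t (s : PVec n m × PVec n m) =>
      s.2 = Q.op s.1 - Q.rhs ∧
      ‖D (N₁ (s.1 - zs) + S (s.1 - zs))‖
          ≤ (1 - ρ / 3) ^ t * ‖D (N₁ (z₀ - zs) + S (z₀ - zs))‖)
    (by linarith) ?_ ?_ ?_).bind_pure ?_).mono ?_ (fun _ h => h)
  · exact ⟨hR₀, by simp⟩
  · rintro t ⟨z, R⟩ ⟨-, hz⟩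
    simp only at hz
    refine Meets.mono ((meets_saddleMul DX (-Q.B) DY z).bind fun p hp =>
      (meets_conjGrad (xs := MI (p + Q.rhs)) hMb hlo0 hlohi
        (fun v => (meets_diagMul (DX + Q.A) (DY + Q.C) v)) (hMI _) z hε₁0).bind fun zh hzh =>
      (meets_diagMul (DX - Q.A) (DY - Q.C) zh).bind fun q hq =>
      (hN { A := DX, B := Q.B, C := DY, u := -(q + Q.rhs).fst, v := (q + Q.rhs).snd } z
        ⟨hDXb, hDYb, hQ.B⟩).bind fun z' hz' =>
      (meets_residual Q z').bind_pure fun R' hR' => ?_)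
      (show 4 + (cg + (2 + (N + 4))) ≤ cg + N + 10 by linarith) (fun _ h => h)
    refine ⟨hR', ?_⟩
    have hp' : p = N₁ z - S z := by
      rw [hp]
      have e : (-Q.B).transpose = -Q.B.transpose := rfl
      refine pvec_ext ?_ ?_
      · simp [hN₁, hS, matVec_eq]; abel
      · simp [hN₁, hS, matVec_eq, e]; abel
    have hq' : q = N₁ zh - G zh := by rw [hq]; exact hMsub zh
    have hrhs : QuadSaddle.rhs
        { A := DX, B := Q.B, C := DY, u := -(q + Q.rhs).fst, v := (q + Q.rhs).snd } = q + Q.rhs :=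
      pvec_ext (by simp) (by simp)
    have hop' : ∀ w, QuadSaddle.op
        { A := DX, B := Q.B, C := DY, u := -(q + Q.rhs).fst, v := (q + Q.rhs).snd } w
        = N₁ w + S w := fun w => rfl
    rw [hrhs, hop', hop'] at hz'
    rw [hMadd, hMadd, hp'] at hzh
    have hb : Q.rhs = G zs + S zs := by rw [← hs, hop]
    rw [pow_succ, mul_comm ((1 - ρ / 3) ^ t), mul_assoc]
    refine le_trans ?_ (mul_le_mul_of_nonneg_left hz (show 0 ≤ 1 - ρ / 3 by linarith))
    -- The perturbations `s` and `s'` are the final residuals of the two inner solves. Both solves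
    -- start at `z`, so their initial residuals are the vectors to which `IsWeight.step` compares
    -- them.
    refine hD.step hlo0 hS0 (χ := √(hi / lo)) (ε₁ := ε₁) (ε₂ := ε₂) (by positivity) ?_ hρ hρ1
      (by linarith) (by positivity) le_rfl hε₁0.le hε₂0.le hcg hrec
      (eh := zh - zs) (s := N₁ zh + G zh - (N₁ z - S z + Q.rhs))
      (s' := N₁ z' + S z' - (q + Q.rhs)) ?_ ?_ ?_ ?_
    · rw [Real.sq_sqrt (by positivity)]; field_simp; rfl
    · rw [hb]; simp only [map_sub]; abel
    · rw [← norm_neg, neg_sub]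
      refine hzh.trans (le_of_eq ?_)
      rw [← norm_neg]
      congr 2
      rw [hb]; simp only [map_sub]; abel
    · rw [hq', hb]; simp only [map_sub]; abel
    · refine hz'.trans (le_of_eq ?_)
      congr 2
      rw [hq', hb]; simp only [map_sub]; abel
  · rintro ⟨z, R⟩ ⟨hR, hz⟩
    simp only at hR hz ⊢
    rw [hR, hR₀]
    have h1 : ‖Q.op z - Q.rhs‖ ^ 2
        ≤ hi * ((1 / ρ + 1) * ‖D (N₁ (z - zs) + S (z - zs))‖) ^ 2 := by
      rw [← hs, ← map_sub, hop]
      refine (hD.upper _).trans (mul_le_mul_of_nonneg_left ?_ hhi0.le)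
      exact pow_le_pow_left₀ (norm_nonneg _) (hD.norm_residual_le (by positivity) hS0 _) 2
    have h4 : P.mx * ‖z₀ - zs‖ ≤ ‖Q.op z₀ - Q.rhs‖ := by
      rw [← hs, ← map_sub]
      exact mul_norm_le_of_monotone (hQ.monotone le_rfl hP.mx_le) _
    have h2 : lo * ‖D (N₁ (z₀ - zs) + S (z₀ - zs))‖ ^ 2 ≤ (3 * P.L * ‖z₀ - zs‖) ^ 2 := by
      refine (hD.lower _).trans (pow_le_pow_left₀ (norm_nonneg _) ?_ 2)
      refine (norm_add_le _ _).trans ?_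
      have e1 := (symBdd_diagOp hDXb (hDYb.mono hP'.mx_le le_rfl)).norm_le hlo0.le hhi0 (z₀ - zs)
      have e2 := norm_skewOp_le hxy.le hQ.B (z₀ - zs)
      have e3 := mul_le_mul_of_nonneg_right hLx' (norm_nonneg (z₀ - zs))
      have e4 := mul_le_mul_of_nonneg_right hP.Lxy_le (norm_nonneg (z₀ - zs))
      linarith
    set N₀ := ‖Q.op z₀ - Q.rhs‖
    set ν₀ := ‖D (N₁ (z₀ - zs) + S (z₀ - zs))‖
    set ν := ‖D (N₁ (z - zs) + S (z - zs))‖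
    have h5 : ‖z₀ - zs‖ ≤ N₀ / P.mx := by rwa [le_div_iff₀ hmx, mul_comm]
    have h6 : ν₀ ^ 2 ≤ (3 * P.L * (N₀ / P.mx)) ^ 2 / (P.mx / ρ) := by
      rw [← hmx', le_div_iff₀ hlo0, mul_comm]
      refine h2.trans (pow_le_pow_left₀ (by positivity) ?_ 2)
      gcongr
    have hpw : 0 ≤ (1 - ρ / 3) ^ (T + 1) := pow_nonneg (by linarith) _
    have hpw1 : (1 - ρ / 3) ^ (T + 1) ≤ 1 := pow_le_one₀ (by linarith) (by linarith)
    -- Squaring would double the exponent; one copy of the decay factor is enough.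
    have h7 : ν ^ 2 ≤ (1 - ρ / 3) ^ (T + 1) * ν₀ ^ 2 := by
      refine (pow_le_pow_left₀ (norm_nonneg _) hz 2).trans ?_
      rw [mul_pow]
      refine mul_le_mul_of_nonneg_right ?_ (sq_nonneg _)
      exact pow_le_of_le_one hpw hpw1 two_ne_zero
    have h8 : 1 / ρ + 1 ≤ 2 * (P.L / P.my) := by
      have e0 : P.my / P.L ≤ ρ :=
        le_trans (div_le_div_of_nonneg_left hmy.le hP.Lxy_pos hP.Lxy_le) hρ2
      have e1 : 1 / ρ ≤ P.L / P.my := by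
        rw [div_le_div_iff₀ hρ hmy]
        rw [div_le_iff₀ hL] at e0
        linarith
      have e2 : 1 ≤ P.L / P.my := by rw [le_div_iff₀ hmy, one_mul]; exact hP.my_le
      linarith
    refine le_of_sq_le_sq ?_ (by positivity)
    refine h1.trans ?_
    rw [mul_pow]
    have hpp : 0 ≤ (1 - ρ / 3) ^ (T + 1) * ((3 * P.L * (N₀ / P.mx)) ^ 2 / (P.mx / ρ)) := by
      positivity
    calc hi * ((1 / ρ + 1) ^ 2 * ν ^ 2)
        ≤ (2 * P.L) * ((2 * (P.L / P.my)) ^ 2 * ((1 - ρ / 3) ^ (T + 1)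
          * ((3 * P.L * (N₀ / P.mx)) ^ 2 / (P.mx / ρ)))) := by
          gcongr
          exact h7.trans (mul_le_mul_of_nonneg_left h6 hpw)
      _ = ρ * ((X * (1 - ρ / 3) ^ (T + 1)) * (epsTilde P ε * N₀) ^ 2) := by
          rw [hXdef]; field_simp; ring
      _ ≤ 1 * (1 * (epsTilde P ε * N₀) ^ 2) := by
          gcongr
      _ = _ := by ring
  · rintro ⟨z, R⟩ ⟨h1, t, h2, -⟩
    simp only at h1 h2 ⊢
    rwa [h2, hR₀] at h1
  · have e : max 0 (Real.log X) / (ρ / 3) = max 0 (Real.log X) * (3 / ρ) := by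
      field_simp
    rw [e] at hT2
    have h0 : 0 ≤ cg + N + 10 := by linarith
    gcongr

/-! ### Counting products -/

/-- All problem-dependent logarithms are of quantities polynomial in `L / m_x`, hence `O(Λ)`. The
crude `log c ≤ c` is affordable because only absolute constants are claimed; it is the reason for
the large numerals below. -/
theorem log_le_of_le_pow {X c R Λ : ℝ} {p : ℕ} (hX : 0 < X) (hc : 0 < c) (hR : 1 ≤ R)
    (h : X ≤ c * R ^ p) (hΛ : 1 ≤ Λ) (hRΛ : Real.log R ≤ Λ) :
    max 0 (Real.log X) ≤ (c + p) * Λ := by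
  have hR0 : 0 < R := by linarith
  refine max_le (by positivity) ?_
  calc Real.log X ≤ Real.log (c * R ^ p) := Real.log_le_log hX h
    _ = Real.log c + p * Real.log R := by
        rw [Real.log_mul hc.ne' (by positivity), Real.log_pow]
    _ ≤ c + p * Λ := by
        have := Real.log_le_self hc.le
        gcongr
    _ ≤ (c + p) * Λ := by nlinarith

namespace Params.Ok

variable {P : Params}

theorem one_le_ratio (hP : P.Ok) : 1 ≤ P.L / P.mx := by
  rw [le_div_iff₀ hP.mx_pos, one_mul]; exact hP.mx_le.trans hP.my_le

theorem inv_my_le (hP : P.Ok) : P.L / P.my ≤ P.L / P.mx :=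
  div_le_div_of_nonneg_left hP.L_pos.le hP.mx_pos hP.mx_le

theorem inv_Lxy_le (hP : P.Ok) : P.L / P.Lxy ≤ P.L / P.mx :=
  div_le_div_of_nonneg_left hP.L_pos.le hP.mx_pos (hP.mx_le.trans hP.my_le_Lxy)

end Params.Ok

section

variable {P : Params} {Λ : ℝ}

theorem agdSteps_le (hP : P.Ok) (hΛ : 1 ≤ Λ) (hΛR : Real.log (P.L / P.mx) ≤ Λ) :
    (agdSteps (3 * P.L / (2 * P.Lxy)) : ℝ) ≤ 200 * Λ * √(P.L / P.Lxy) := by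
  have hL := hP.L_pos
  have hxy := hP.Lxy_pos
  have hs : 1 ≤ √(P.L / P.Lxy) := by
    rw [Real.one_le_sqrt, le_div_iff₀ hxy, one_mul]; exact hP.Lxy_le
  have h1 : √(3 * P.L / (2 * P.Lxy)) ≤ 2 * √(P.L / P.Lxy) := by
    rw [show (2 : ℝ) = √4 by rw [show (4 : ℝ) = 2 ^ 2 by norm_num]; simp, ← Real.sqrt_mul (by norm_num)]
    refine Real.sqrt_le_sqrt ?_
    rw [show √4 = (2 : ℝ) by rw [show (4 : ℝ) = 2 ^ 2 by norm_num]; simp,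
      show 3 * P.L / (2 * P.Lxy) = 3 / 2 * (P.L / P.Lxy) by field_simp]
    have : 0 ≤ P.L / P.Lxy := by positivity
    linarith
  have h2 : Real.log (24 * (3 * P.L / (2 * P.Lxy))) ≤ 37 * Λ := by
    refine (le_max_right 0 _).trans ?_
    refine (log_le_of_le_pow (c := 36) (p := 1) (by positivity) (by norm_num) hP.one_le_ratio ?_
      hΛ hΛR).trans (by norm_num)
    rw [show 24 * (3 * P.L / (2 * P.Lxy)) = 36 * (P.L / P.Lxy) by field_simp; norm_num, pow_one]
    linarith [hP.inv_Lxy_le]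
  have h3 : 2 * √(3 * P.L / (2 * P.Lxy)) * Real.log (24 * (3 * P.L / (2 * P.Lxy)))
      ≤ 2 * (2 * √(P.L / P.Lxy)) * (37 * Λ) := by
    refine (mul_le_mul_of_nonneg_left h2 (by positivity)).trans ?_
    gcongr
  have h4 : (1 : ℝ) ≤ Λ * √(P.L / P.Lxy) := one_le_mul_of_one_le_of_one_le hΛ hs
  unfold agdSteps
  have h5 : (⌈2 * √(3 * P.L / (2 * P.Lxy)) * Real.log (24 * (3 * P.L / (2 * P.Lxy)))⌉₊ : ℝ)
      ≤ 2 * (2 * √(P.L / P.Lxy)) * (37 * Λ) + 1 := by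
    refine (Nat.cast_le.2 (Nat.ceil_mono h3)).trans ?_
    exact (Nat.ceil_lt_add_one (by positivity)).le
  linarith

theorem abrCost_le (hP : P.Ok) (hΛ : 1 ≤ Λ) (hΛR : Real.log (P.L / P.mx) ≤ Λ) :
    abrCost P ≤ 2000000 * Λ ^ 2 * √(P.L / P.Lxy) := by
  have hL := hP.L_pos
  have hxy := hP.Lxy_pos
  have hmx := hP.mx_pos
  have hmy := hP.my_pos
  have h1 := agdSteps_le hP hΛ hΛR
  set s := √(P.L / P.Lxy) with hs
  set R := P.L / P.mx with hR
  have hR1 : 1 ≤ R := hP.one_le_ratio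
  set Y := 4 * √(3 * P.L / (2 * P.Lxy) + 3 * P.L / (2 * P.Lxy))
      / (1 / (96 * P.L ^ (5 / 2 : ℝ) / (P.mx * P.my ^ (3 / 2 : ℝ)))) with hY
  have hY0 : 0 < Y := by rw [hY]; positivity
  have h2 : Y ≤ 1152 * R ^ 4 := by
    have e1 : √(3 * P.L / (2 * P.Lxy) + 3 * P.L / (2 * P.Lxy)) ≤ 3 * R := by
      have e0 : 3 * P.L / (2 * P.Lxy) + 3 * P.L / (2 * P.Lxy) = 3 * (P.L / P.Lxy) := by
        field_simp; ring
      have e2 : 3 * (P.L / P.Lxy) ≤ 3 * R := by linarith [hP.inv_Lxy_le]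
      rw [e0]
      refine (Real.sqrt_le_sqrt e2).trans ?_
      rw [Real.sqrt_le_left (by positivity)]
      nlinarith
    have e3 : P.L ^ (5 / 2 : ℝ) / (P.mx * P.my ^ (3 / 2 : ℝ)) ≤ R ^ 3 := by
      have f1 : P.L ^ (5 / 2 : ℝ) = P.L * P.L ^ (3 / 2 : ℝ) := by
        nth_rewrite 2 [← Real.rpow_one P.L]
        rw [← Real.rpow_add hL]; norm_num
      have f2 : P.L ^ (5 / 2 : ℝ) / (P.mx * P.my ^ (3 / 2 : ℝ)) = R * (P.L / P.my) ^ (3 / 2 : ℝ) := by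
        rw [f1, Real.div_rpow hL.le hmy.le, hR]; field_simp
      have f3 : (P.L / P.my) ^ (3 / 2 : ℝ) ≤ R ^ (2 : ℝ) := by
        refine (Real.rpow_le_rpow (by positivity) hP.inv_my_le (by norm_num)).trans ?_
        exact Real.rpow_le_rpow_of_exponent_le hR1 (by norm_num)
      rw [f2]
      rw [Real.rpow_two] at f3
      calc R * (P.L / P.my) ^ (3 / 2 : ℝ) ≤ R * R ^ 2 := by gcongr
        _ = R ^ 3 := by ring
    calc Y = 384 * √(3 * P.L / (2 * P.Lxy) + 3 * P.L / (2 * P.Lxy))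
          * (P.L ^ (5 / 2 : ℝ) / (P.mx * P.my ^ (3 / 2 : ℝ))) := by rw [hY]; field_simp; norm_num
      _ ≤ 384 * (3 * R) * R ^ 3 := by gcongr
      _ = 1152 * R ^ 4 := by ring
  have h3 : Real.logb 2 Y ≤ 2312 * Λ := by
    have e1 := (le_max_right 0 _).trans (log_le_of_le_pow hY0 (by norm_num) hR1 h2 hΛ hΛR)
    have e2 : 1 / 2 ≤ Real.log 2 := by linarith [Real.log_two_gt_d9]
    rw [Real.logb, div_le_iff₀ (by linarith)]
    push_cast at e1
    nlinarith
  have h4 : (⌈Real.logb 2 Y⌉₊ : ℝ) + 1 ≤ 2314 * Λ := by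
    have e1 : (⌈Real.logb 2 Y⌉₊ : ℝ) ≤ 2312 * Λ + 1 := by
      refine (Nat.cast_le.2 (Nat.ceil_mono h3)).trans ?_
      exact (Nat.ceil_lt_add_one (by positivity)).le
    linarith
  unfold abrCost
  rw [← hY]
  calc _ ≤ 2314 * Λ * (200 * Λ * s * 2 + 200 * Λ * s * 2) := by gcongr
    _ = 1851200 * Λ ^ 2 * s := by ring
    _ ≤ _ := by
      have : 0 ≤ Λ ^ 2 * s := by positivity
      linarith

theorem innerCost_le (hP : P.Ok) (hΛ : 1 ≤ Λ) (hΛR : Real.log (P.L / P.mx) ≤ Λ) :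
    innerCost P ≤ 10 ^ 17 * Λ ^ 3 * √(P.L / P.Lxy) * √(P.Lxy / P.my) := by
  have hL := hP.L_pos
  have hxy := hP.Lxy_pos
  have hmx := hP.mx_pos
  have hmy := hP.my_pos
  have h1 := abrCost_le hP hΛ hΛR
  have hs : 1 ≤ √(P.L / P.Lxy) := by
    rw [Real.one_le_sqrt, le_div_iff₀ hxy, one_mul]; exact hP.Lxy_le
  have hs2 : 1 ≤ √(P.Lxy / P.my) := by
    rw [Real.one_le_sqrt, le_div_iff₀ hmy, one_mul]; exact hP.my_le_Lxy
  have hR1 := hP.one_le_ratio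
  have h2 : max 0 (Real.log (1320 * 81 * P.L ^ 5 * pbrM P ^ 2 / (P.my * P.mx ^ 4)))
      ≤ 684288011 * Λ := by
    rw [pbrM_sq hP]
    refine (log_le_of_le_pow (c := 684288000) (p := 11) (by positivity) (by norm_num) hR1 ?_
      hΛ hΛR).trans (by push_cast; linarith)
    calc 1320 * 81 * P.L ^ 5 * (6400 * P.L ^ 6 / (P.mx ^ 3 * P.my ^ 3)) / (P.my * P.mx ^ 4)
        = 684288000 * ((P.L / P.mx) ^ 7 * (P.L / P.my) ^ 4) := by field_simp; norm_num
      _ ≤ 684288000 * ((P.L / P.mx) ^ 7 * (P.L / P.mx) ^ 4) := by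
          gcongr; exact hP.mx_le
      _ = 684288000 * (P.L / P.mx) ^ 11 := by ring
  set s := √(P.L / P.Lxy)
  set s2 := √(P.Lxy / P.my)
  have hΛs2 : 1 ≤ Λ * s2 := one_le_mul_of_one_le_of_one_le hΛ hs2
  have hΛ2 : 1 ≤ Λ ^ 2 := one_le_pow₀ hΛ
  have hΛs : 1 ≤ Λ ^ 2 * s := one_le_mul_of_one_le_of_one_le hΛ2 hs
  unfold innerCost
  calc _ ≤ 4 + (684288011 * Λ * (8 * s2) + 2) * (2000000 * Λ ^ 2 * s + 4) := by
        have := abrCost_nonneg P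
        gcongr
    _ ≤ 4 * (Λ * s2) * (Λ ^ 2 * s) + (684288011 * Λ * (8 * s2) + 2 * (Λ * s2))
        * (2000000 * Λ ^ 2 * s + 4 * (Λ ^ 2 * s)) := by
        have : 1 ≤ (Λ * s2) * (Λ ^ 2 * s) := one_le_mul_of_one_le_of_one_le hΛs2 hΛs
        have e : 4 * (Λ * s2) * (Λ ^ 2 * s) = 4 * ((Λ * s2) * (Λ ^ 2 * s)) := by ring
        rw [e]
        gcongr <;> linarith
    _ = (4 + 5474304090 * 2000004) * (Λ ^ 3 * s * s2) := by ring
    _ ≤ 10 ^ 17 * (Λ ^ 3 * s * s2) := by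
        gcongr; norm_num
    _ = _ := by ring

theorem log_div_epsTilde_le (hP : P.Ok) (hΛ : 1 ≤ Λ) (hΛR : Real.log (P.L / P.mx) ≤ Λ)
    {X c ε : ℝ} {p : ℕ} (hX : 0 < X) (hc : 0 < c) (hXR : X ≤ c * (P.L / P.mx) ^ p) (hε : 0 < ε) :
    max 0 (Real.log (X / epsTilde P ε ^ 2))
      ≤ (4 * c + p + 2) * (Λ + max 0 (Real.log (1 / ε))) := by
  have hL := hP.L_pos
  have hxy := hP.Lxy_pos
  have hmx := hP.mx_pos
  have hLx := hP.Lx_pos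
  have hR1 := hP.one_le_ratio
  have e : X / epsTilde P ε ^ 2 = X * ((P.Lxy + P.Lx) / P.mx) ^ 2 * (1 / ε) ^ 2 := by
    unfold epsTilde; field_simp
  have h1 : X * ((P.Lxy + P.Lx) / P.mx) ^ 2 ≤ 4 * c * (P.L / P.mx) ^ (p + 2) := by
    calc X * ((P.Lxy + P.Lx) / P.mx) ^ 2 ≤ c * (P.L / P.mx) ^ p * (2 * P.L / P.mx) ^ 2 := by
          gcongr
          linarith [hP.Lx_le, hP.Lxy_le]
      _ = 4 * c * (P.L / P.mx) ^ (p + 2) := by ring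
  have h2 := (le_max_right 0 _).trans (log_le_of_le_pow (by positivity) (by positivity) hR1 h1 hΛ hΛR)
  have h3 := le_max_right 0 (Real.log (1 / ε))
  have h4 := le_max_left 0 (Real.log (1 / ε))
  refine max_le (by positivity) ?_
  rw [e, Real.log_mul (by positivity) (by positivity), Real.log_pow]
  push_cast at h2 ⊢
  nlinarith [mul_nonneg (show 0 ≤ 4 * c + (p : ℝ) by positivity) h4]

/-! ### The rate and its behaviour under recursion -/

/-- The leading factor of the number of products. -/
noncomputable def rate (k : ℕ) (P : Params) : ℝ :=
  √(P.Lxy ^ 2 / (P.mx * P.my) + (P.Lx / P.mx + P.Lx / P.my) * (1 + 1 / hssRho k P))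

theorem rate_sq (hP : P.Ok) (k : ℕ) : rate k P ^ 2
    = P.Lxy ^ 2 / (P.mx * P.my) + (P.Lx / P.mx + P.Lx / P.my) * (1 + 1 / hssRho k P) := by
  have hmx := hP.mx_pos
  have hmy := hP.my_pos
  have hLx := hP.Lx_pos
  have := hssRho_pos (k := k) hP
  unfold rate
  rw [Real.sq_sqrt (by positivity)]

theorem rate_nonneg (k : ℕ) (P : Params) : 0 ≤ rate k P := Real.sqrt_nonneg _

theorem inv_hssRho_le_rate (hP : P.Ok) {k : ℕ} (hk : k ≠ 0) : 1 / hssRho k P ≤ rate k P := by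
  have hmx := hP.mx_pos
  have hmy := hP.my_pos
  have hLx := hP.Lx_pos
  have hxy := hP.Lxy_pos
  have hρ := hssRho_pos (k := k) hP
  refine le_of_sq_le_sq ?_ (rate_nonneg _ _)
  rw [rate_sq hP]
  have h1 : 1 / hssRho k P ≤ P.Lxy / P.my := by
    have := le_hssRho hP hk
    rw [div_le_div_iff₀ hρ hmy]
    rw [div_le_iff₀ hxy] at this
    linarith
  have h2 : (1 / hssRho k P) ^ 2 ≤ (P.Lxy / P.my) ^ 2 := by gcongr
  have h3 : (P.Lxy / P.my) ^ 2 ≤ P.Lxy ^ 2 / (P.mx * P.my) := by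
    rw [div_pow, sq P.my]
    gcongr
    exact hP.mx_le
  have h4 : 0 ≤ (P.Lx / P.mx + P.Lx / P.my) * (1 + 1 / hssRho k P) := by positivity
  linarith

/-- The three factors are the iteration counts of descent, inner loop and outer loop, up to
logarithms. After multiplying them, `L ≤ L_x + L_xy` splits the result into the coupling term and,
because `1 / ρ = L_xy / m_y` for `k = 1`, the smoothness term. -/
theorem pbr_rate (hP : P.Ok) :
    √(P.L / P.Lxy) * √(P.Lxy / P.my) * √(P.Lxy / P.mx) ≤ rate 1 P := by
  have hL := hP.L_pos
  have hmx := hP.mx_pos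
  have hmy := hP.my_pos
  have hLx := hP.Lx_pos
  have hxy := hP.Lxy_pos
  unfold rate
  rw [← Real.sqrt_mul (by positivity), ← Real.sqrt_mul (by positivity), hssRho_one hP]
  refine Real.sqrt_le_sqrt ?_
  have h1 : P.L ≤ P.Lx + P.Lxy := max_le (by linarith) (by linarith)
  calc P.L / P.Lxy * (P.Lxy / P.my) * (P.Lxy / P.mx) = P.L * P.Lxy / (P.mx * P.my) := by field_simp
    _ ≤ (P.Lx + P.Lxy) * P.Lxy / (P.mx * P.my) := by gcongr
    _ = P.Lxy ^ 2 / (P.mx * P.my) + P.Lx / P.mx * (1 / (P.my / P.Lxy)) := by field_simp; ring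
    _ ≤ _ := by
        gcongr
        · have : 0 ≤ P.Lx / P.my := by positivity
          linarith
        · linarith

/-- Passing to the subproblem divides `m_y / L_xy = ρ ^ (k + 2)` by `ρ`, and the root taken is one
degree lower. -/
theorem hssRho_hssParams (hP : P.Ok) (k : ℕ) :
    hssRho (k + 1) (hssParams (k + 2) P) = hssRho (k + 2) P := by
  have hρ := hssRho_pos (k := k + 2) hP
  have h1 := hssRho_pow (k := k + 2) hP (by omega)
  have h2 : (hssParams (k + 2) P).my / (hssParams (k + 2) P).Lxy = hssRho (k + 2) P ^ (k + 1) := by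
    rw [hssParams_my hP, hssParams_Lxy, div_right_comm, ← h1, pow_succ _ (k + 1)]
    field_simp
  unfold hssRho at h2 ⊢
  rw [h2, one_div ((k + 1 : ℕ) : ℝ), Real.pow_rpow_inv_natCast _ (by omega)]
  exact Real.rpow_nonneg (div_pos hP.my_pos hP.Lxy_pos).le _

/-- Since `ρ ^ (k + 2) = m_y / L_xy`, up to `2 (k + 2)` inverse powers of `ρ` fit into the coupling
term. This absorbs the branch `m_y / ρ` of the new `L_x`; degree at least two leaves room for the
cube needed below. -/
theorem inv_hssRho_pow_le (hP : P.Ok) {k : ℕ} {j : ℕ} (hj : j ≤ 2 * (k + 2)) :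
    P.my / P.mx * (1 / hssRho (k + 2) P) ^ j ≤ P.Lxy ^ 2 / (P.mx * P.my) := by
  have hmx := hP.mx_pos
  have hmy := hP.my_pos
  have hxy := hP.Lxy_pos
  have hρ := hssRho_pos (k := k + 2) hP
  have hρ1 := hssRho_le_one (k := k + 2) hP
  have h1 : (1 / hssRho (k + 2) P) ^ j ≤ (P.Lxy / P.my) ^ 2 := by
    refine (pow_le_pow_right₀ ?_ hj).trans (le_of_eq ?_)
    · rwa [le_div_iff₀ hρ, one_mul]
    · rw [mul_comm 2, pow_mul, div_pow, one_pow, hssRho_pow hP (by omega)]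
      field_simp
  calc P.my / P.mx * (1 / hssRho (k + 2) P) ^ j ≤ P.my / P.mx * (P.Lxy / P.my) ^ 2 := by gcongr
    _ = _ := by field_simp

theorem hssParams_Lx_le_add (hP : P.Ok) (k : ℕ) : (hssParams (k + 2) P).Lx
    ≤ 2 * (P.my / hssRho (k + 2) P) + 2 * (hssRho (k + 2) P * P.Lx) := by
  have hmy := hP.my_pos
  have hLx := hP.Lx_pos
  have hρ := hssRho_pos (k := k + 2) hP
  rw [hssParams_Lx hP (by omega)]
  have : max (P.my / hssRho (k + 2) P) (hssRho (k + 2) P * P.Lx)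
      ≤ P.my / hssRho (k + 2) P + hssRho (k + 2) P * P.Lx :=
    max_le (by have : 0 ≤ hssRho (k + 2) P * P.Lx := by positivity
               linarith)
      (by have : 0 ≤ P.my / hssRho (k + 2) P := by positivity
          linarith)
  linarith

/-- The balance behind the recursion. Dividing both moduli by `ρ` shrinks the coupling term by `ρ²`,
and the new smoothness ratios shrink by `ρ²` apart from the branch `m_y / ρ`. This offsets the
square of the `1 / ρ` passes, and `ρ` itself does not change. -/
theorem rate_hssParams (hP : P.Ok) (k : ℕ) :
    1 / hssRho (k + 2) P * rate (k + 1) (hssParams (k + 2) P) ≤ 3 * rate (k + 2) P := by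
  have hmx := hP.mx_pos
  have hmy := hP.my_pos
  have hLx := hP.Lx_pos
  have hxy := hP.Lxy_pos
  have hk : k + 2 ≠ 0 := by omega
  have hρ := hssRho_pos (k := k + 2) hP
  have hρ1 := hssRho_le_one (k := k + 2) hP
  have hr := rate_nonneg (k + 2) P
  refine le_of_sq_le_sq ?_ (by positivity)
  have h3 := inv_hssRho_pow_le (k := k) (j := 3) hP (by omega)
  have hLx' := hssParams_Lx_le_add hP k
  rw [mul_pow, mul_pow, rate_sq (hssParams_ok hP hk), rate_sq hP, hssRho_hssParams hP k,
    hssParams_mx hP, hssParams_my hP, hssParams_Lxy]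
  set ρ := hssRho (k + 2) P
  set l := (hssParams (k + 2) P).Lx
  have e1 : (1 / ρ) ^ 2 * (P.Lxy ^ 2 / (P.mx / ρ * (P.my / ρ))) = P.Lxy ^ 2 / (P.mx * P.my) := by
    field_simp
  have h4 : l / (P.mx / ρ) + l / (P.my / ρ)
      ≤ 4 * (P.my / P.mx) + 2 * ρ ^ 2 * (P.Lx / P.mx + P.Lx / P.my) := by
    have f1 : l / (P.mx / ρ) ≤ 2 * (P.my / P.mx) + 2 * ρ ^ 2 * (P.Lx / P.mx) := by
      calc l / (P.mx / ρ) ≤ (2 * (P.my / ρ) + 2 * (ρ * P.Lx)) / (P.mx / ρ) := by gcongr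
        _ = _ := by field_simp
    have f2 : l / (P.my / ρ) ≤ 2 * 1 + 2 * ρ ^ 2 * (P.Lx / P.my) := by
      calc l / (P.my / ρ) ≤ (2 * (P.my / ρ) + 2 * (ρ * P.Lx)) / (P.my / ρ) := by gcongr
        _ = _ := by field_simp
    have f3 : 1 ≤ P.my / P.mx := by rw [le_div_iff₀ hmx, one_mul]; exact hP.mx_le
    linarith
  have h5 : 1 + 1 / ρ ≤ 2 * (1 / ρ) := by
    have : 1 ≤ 1 / ρ := by rwa [le_div_iff₀ hρ, one_mul]
    linarith
  have h6 : (1 / ρ) ^ 2 * ((l / (P.mx / ρ) + l / (P.my / ρ)) * (1 + 1 / ρ))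
      ≤ 8 * (P.my / P.mx * (1 / ρ) ^ 3)
        + 2 * ((P.Lx / P.mx + P.Lx / P.my) * (1 + 1 / ρ)) := by
    calc _ ≤ (1 / ρ) ^ 2 * ((4 * (P.my / P.mx) + 2 * ρ ^ 2 * (P.Lx / P.mx + P.Lx / P.my))
          * (1 + 1 / ρ)) := by gcongr
      _ = (1 / ρ) ^ 2 * (4 * (P.my / P.mx)) * (1 + 1 / ρ)
          + 2 * ((P.Lx / P.mx + P.Lx / P.my) * (1 + 1 / ρ)) := by field_simp
      _ ≤ (1 / ρ) ^ 2 * (4 * (P.my / P.mx)) * (2 * (1 / ρ))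
          + 2 * ((P.Lx / P.mx + P.Lx / P.my) * (1 + 1 / ρ)) := by gcongr
      _ = _ := by ring
  have h7 : 0 ≤ (P.Lx / P.mx + P.Lx / P.my) * (1 + 1 / ρ) := by positivity
  rw [mul_add, e1]
  linarith

/-- The shift `m_x / ρ` improves the conditioning by one factor `ρ`, against two lost to the passes.
This leaves `(L_x / m_x) / ρ`, which is the origin of the power `1 / k` in the theorem. -/
theorem cg_rate (hP : P.Ok) (k : ℕ) : 1 / hssRho (k + 2) P
    * √(((hssParams (k + 2) P).Lx + P.Lx) / (hssParams (k + 2) P).mx) ≤ 3 * rate (k + 2) P := by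
  have hmx := hP.mx_pos
  have hmy := hP.my_pos
  have hLx := hP.Lx_pos
  have hk : k + 2 ≠ 0 := by omega
  have hρ := hssRho_pos (k := k + 2) hP
  have hρ1 := hssRho_le_one (k := k + 2) hP
  have hr := rate_nonneg (k + 2) P
  have hl := (hssParams_ok hP hk).Lx_pos
  have hm := (hssParams_ok hP hk).mx_pos
  refine le_of_sq_le_sq ?_ (by positivity)
  have h3 := inv_hssRho_pow_le (k := k) (j := 2) hP (by omega)
  have hLx' := hssParams_Lx_le_add hP k
  rw [mul_pow, mul_pow, Real.sq_sqrt (by positivity), rate_sq hP, hssParams_mx hP]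
  set ρ := hssRho (k + 2) P
  set l := (hssParams (k + 2) P).Lx
  have h4 : (1 / ρ) ^ 2 * ((l + P.Lx) / (P.mx / ρ))
      ≤ 2 * (P.my / P.mx * (1 / ρ) ^ 2) + 3 * (P.Lx / P.mx * (1 / ρ)) := by
    calc (1 / ρ) ^ 2 * ((l + P.Lx) / (P.mx / ρ))
        ≤ (1 / ρ) ^ 2 * ((2 * (P.my / ρ) + 2 * (1 * P.Lx) + P.Lx) / (P.mx / ρ)) := by
          gcongr
          refine hLx'.trans ?_
          gcongr
      _ = _ := by field_simp; ring
  have h5 : P.Lx / P.mx * (1 / ρ) ≤ (P.Lx / P.mx + P.Lx / P.my) * (1 + 1 / ρ) := by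
    gcongr
    · have : 0 ≤ P.Lx / P.my := by positivity
      linarith
    · linarith
  have h6 : 0 ≤ P.Lx / P.mx * (1 / ρ) := by positivity
  have h7 : 0 ≤ P.Lxy ^ 2 / (P.mx * P.my) := by positivity
  linarith

theorem cgCost_le (hP : P.Ok) (hΛ : 1 ≤ Λ) (hΛR : Real.log (P.L / P.mx) ≤ Λ) (k : ℕ) :
    cgCost (k + 2) P
      ≤ 500000 * Λ * √(((hssParams (k + 2) P).Lx + P.Lx) / (hssParams (k + 2) P).mx) := by
  have hL := hP.L_pos
  have hmx := hP.mx_pos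
  have hmy := hP.my_pos
  have hLx := hP.Lx_pos
  have hk : k + 2 ≠ 0 := by omega
  have hρ := hssRho_pos (k := k + 2) hP
  have hρ1 := hssRho_le_one (k := k + 2) hP
  have hP' := hssParams_ok hP hk
  have hl := hP'.Lx_pos
  have hm := hP'.mx_pos
  have hLx' := hssParams_Lx_le hP hk
  have h1 : ((hssParams (k + 2) P).Lx + P.Lx) / (hssParams (k + 2) P).mx ≤ 3 * (P.L / P.mx) := by
    rw [hssParams_mx hP]
    calc _ ≤ (3 * P.L) / (P.mx / 1) := by
          gcongr
          linarith [hP.Lx_le]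
      _ = _ := by rw [div_one]; ring
  have h2 : 1 ≤ √(((hssParams (k + 2) P).Lx + P.Lx) / (hssParams (k + 2) P).mx) := by
    rw [Real.one_le_sqrt, le_div_iff₀ hm, one_mul]
    linarith [hP'.mx_le.trans hP'.my_le_Lx]
  unfold cgCost
  have hκ0 : 0 < ((hssParams (k + 2) P).Lx + P.Lx) / (hssParams (k + 2) P).mx := by positivity
  set κ := ((hssParams (k + 2) P).Lx + P.Lx) / (hssParams (k + 2) P).mx
  have h3 : max 0 (Real.log (2 * κ / (1 / (192 * P.L ^ 5 / (P.mx ^ 2 * P.my ^ 3))) ^ 2))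
      ≤ 221195 * Λ := by
    refine (log_le_of_le_pow (c := 221184) (p := 11) (by positivity) (by norm_num)
      hP.one_le_ratio ?_ hΛ hΛR).trans (by push_cast; linarith)
    calc 2 * κ / (1 / (192 * P.L ^ 5 / (P.mx ^ 2 * P.my ^ 3))) ^ 2
        = 73728 * κ * ((P.L / P.mx) ^ 4 * (P.L / P.my) ^ 6) := by field_simp; norm_num
      _ ≤ 73728 * (3 * (P.L / P.mx)) * ((P.L / P.mx) ^ 4 * (P.L / P.mx) ^ 6) := by
          gcongr; exact hP.mx_le
      _ = _ := by ring
  have h4 : 1 ≤ Λ * √κ := one_le_mul_of_one_le_of_one_le hΛ h2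
  have h5 := mul_le_mul_of_nonneg_right h3 (Real.sqrt_nonneg κ)
  linarith

end

/-! ### Cost of the base case and of one recursive level -/

section

variable {P : Params} {Λ : ℝ}

theorem pbr_cost_le (hP : P.Ok) (hΛ : 1 ≤ Λ) (hΛR : Real.log (P.L / P.mx) ≤ Λ) {ε : ℝ}
    (hε : 0 < ε) :
    4 + (max 0 (Real.log (576 * P.L ^ 6 / (P.mx ^ 3 * P.my ^ 3) / epsTilde P ε ^ 2))
        * (8 * √(P.Lxy / P.mx)) + 2) * (innerCost P + 4)
      ≤ rate 1 P * 10 ^ 22 * Λ ^ 3 * (Λ + max 0 (Real.log (1 / ε))) := by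
  have hL := hP.L_pos
  have hmx := hP.mx_pos
  have hmy := hP.my_pos
  have hxy := hP.Lxy_pos
  have hi := innerCost_le hP hΛ hΛR
  have hi0 := innerCost_nonneg P
  have hr := pbr_rate hP
  have hX : 576 * P.L ^ 6 / (P.mx ^ 3 * P.my ^ 3) ≤ 576 * (P.L / P.mx) ^ 6 := by
    calc 576 * P.L ^ 6 / (P.mx ^ 3 * P.my ^ 3)
        = 576 * ((P.L / P.mx) ^ 3 * (P.L / P.my) ^ 3) := by field_simp
      _ ≤ 576 * ((P.L / P.mx) ^ 3 * (P.L / P.mx) ^ 3) := by gcongr; exact hP.mx_le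
      _ = _ := by ring
  have hl := log_div_epsTilde_le hP hΛ hΛR (by positivity) (by norm_num) hX hε
  have hs1 : 1 ≤ √(P.L / P.Lxy) := by
    rw [Real.one_le_sqrt, le_div_iff₀ hxy, one_mul]; exact hP.Lxy_le
  have hs2 : 1 ≤ √(P.Lxy / P.my) := by
    rw [Real.one_le_sqrt, le_div_iff₀ hmy, one_mul]; exact hP.my_le_Lxy
  have hs3 : 1 ≤ √(P.Lxy / P.mx) := by
    rw [Real.one_le_sqrt, le_div_iff₀ hmx, one_mul]; exact hP.mx_le.trans hP.my_le_Lxy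
  set W := Λ + max 0 (Real.log (1 / ε)) with hW
  have hW1 : 1 ≤ W := by have := le_max_left 0 (Real.log (1 / ε)); linarith
  set s := √(P.Lxy / P.mx)
  set a := √(P.L / P.Lxy) * √(P.Lxy / P.my)
  set lg := max 0 (Real.log (576 * P.L ^ 6 / (P.mx ^ 3 * P.my ^ 3) / epsTilde P ε ^ 2))
  have ha : 1 ≤ a := one_le_mul_of_one_le_of_one_le hs1 hs2
  have hΛ3 : 1 ≤ Λ ^ 3 := one_le_pow₀ hΛ
  have hΛa : 1 ≤ Λ ^ 3 * a := one_le_mul_of_one_le_of_one_le hΛ3 ha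
  have hWs : 1 ≤ W * s := one_le_mul_of_one_le_of_one_le hW1 hs3
  have h1 : innerCost P + 4 ≤ 2 * 10 ^ 17 * (Λ ^ 3 * a) := by
    have : innerCost P ≤ 10 ^ 17 * (Λ ^ 3 * a) := hi.trans (le_of_eq (by ring))
    linarith
  have h2 : lg * (8 * s) + 2 ≤ 20000 * (W * s) := by
    have : lg * (8 * s) ≤ (4 * 576 + (6 : ℕ) + 2) * W * (8 * s) := by gcongr
    push_cast at this
    linarith
  have h3 : 1 ≤ (W * s) * (Λ ^ 3 * a) := one_le_mul_of_one_le_of_one_le hWs hΛa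
  calc 4 + (lg * (8 * s) + 2) * (innerCost P + 4)
      ≤ 4 + 20000 * (W * s) * (2 * 10 ^ 17 * (Λ ^ 3 * a)) := by gcongr
    _ ≤ 10 ^ 22 * ((W * s) * (Λ ^ 3 * a)) := by linarith
    _ = (a * s) * 10 ^ 22 * Λ ^ 3 * W := by ring
    _ ≤ _ := by gcongr

/-- The recursive calls run at the fixed precision `16 L_xy / m_y`, whose logarithm is `O(Λ)`. A
level thus multiplies the cost by `O(Λ)`, and `ln (1 / ε)` enters only once, through the outermost
loop. -/
theorem rhss_cost_le (hP : P.Ok) (hΛ : 1 ≤ Λ) (hΛR : Real.log (P.L / P.mx) ≤ Λ) (k : ℕ) {ε : ℝ}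
    (hε : 0 < ε) :
    4 + (max 0 (Real.log (72 * P.L ^ 5 / (P.mx ^ 3 * P.my ^ 2) / epsTilde P ε ^ 2))
        * (3 / hssRho (k + 2) P) + 2) * (cgCost (k + 2) P
          + rate (k + 1) (hssParams (k + 2) P) * (10 ^ 22) ^ (k + 1) * Λ ^ (k + 3)
            * (Λ + max 0 (Real.log (1 / (1 / (16 * P.Lxy / P.my))))) + 10)
      ≤ rate (k + 2) P * (10 ^ 22) ^ (k + 2) * Λ ^ (k + 4) * (Λ + max 0 (Real.log (1 / ε))) := by
  have hL := hP.L_pos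
  have hmx := hP.mx_pos
  have hmy := hP.my_pos
  have hxy := hP.Lxy_pos
  have hk : k + 2 ≠ 0 := by omega
  have hρ := hssRho_pos (k := k + 2) hP
  have hρ1 := hssRho_le_one (k := k + 2) hP
  have hrr := rate_hssParams hP k
  have hcr := cg_rate hP k
  have hcc := cgCost_le hP hΛ hΛR k
  have hcc0 := cgCost_nonneg (k + 2) P
  have hir := inv_hssRho_le_rate hP hk
  have hr0 := rate_nonneg (k + 1) (hssParams (k + 2) P)
  have hX : 72 * P.L ^ 5 / (P.mx ^ 3 * P.my ^ 2) ≤ 72 * (P.L / P.mx) ^ 5 := by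
    calc 72 * P.L ^ 5 / (P.mx ^ 3 * P.my ^ 2)
        = 72 * ((P.L / P.mx) ^ 3 * (P.L / P.my) ^ 2) := by field_simp
      _ ≤ 72 * ((P.L / P.mx) ^ 3 * (P.L / P.mx) ^ 2) := by gcongr; exact hP.mx_le
      _ = _ := by ring
  have hl := log_div_epsTilde_le hP hΛ hΛR (by positivity) (by norm_num) hX hε
  have hM : Λ + max 0 (Real.log (1 / (1 / (16 * P.Lxy / P.my)))) ≤ 18 * Λ := by
    have h := log_le_of_le_pow (X := 1 / (1 / (16 * P.Lxy / P.my))) (c := 16) (p := 1)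
      (by positivity) (by norm_num) hP.one_le_ratio ?_ hΛ hΛR
    · push_cast at h; linarith
    · rw [one_div_one_div, pow_one]
      calc 16 * P.Lxy / P.my = 16 * (P.Lxy / P.my) := by ring
        _ ≤ 16 * (P.L / P.mx) := by gcongr; exacts [hP.Lxy_le, hP.mx_le]
  set W := Λ + max 0 (Real.log (1 / ε)) with hW
  have hW1 : 1 ≤ W := by have := le_max_left 0 (Real.log (1 / ε)); linarith
  set V := Λ + max 0 (Real.log (1 / (1 / (16 * P.Lxy / P.my))))
  have hV0 : 0 ≤ V := by positivity
  set lg := max 0 (Real.log (72 * P.L ^ 5 / (P.mx ^ 3 * P.my ^ 2) / epsTilde P ε ^ 2))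
  set ρ := hssRho (k + 2) P
  set r := rate (k + 2) P
  set r' := rate (k + 1) (hssParams (k + 2) P)
  set cg := cgCost (k + 2) P
  set σ := √(((hssParams (k + 2) P).Lx + P.Lx) / (hssParams (k + 2) P).mx)
  set c : ℝ := (10 ^ 22) ^ (k + 1) with hc
  have hc1 : 1 ≤ c := one_le_pow₀ (by norm_num)
  have hΛk : 1 ≤ Λ ^ (k + 3) := one_le_pow₀ hΛ
  have hi1 : 1 ≤ 1 / ρ := by rwa [le_div_iff₀ hρ, one_mul]
  have hr1 : 1 ≤ r := hi1.trans hir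
  have hN0 : 0 ≤ r' * c * Λ ^ (k + 3) * V := by positivity
  set K := cg + r' * c * Λ ^ (k + 3) * V + 10 with hK
  have hWρ : 1 ≤ W * (1 / ρ) := one_le_mul_of_one_le_of_one_le hW1 hi1
  have h2 : lg * (3 / ρ) + 2 ≤ 887 * (W * (1 / ρ)) := by
    have : lg * (3 / ρ) ≤ (4 * 72 + (5 : ℕ) + 2) * W * (3 / ρ) := by gcongr
    have e : (4 * 72 + ((5 : ℕ) : ℝ) + 2) * W * (3 / ρ) = 885 * (W * (1 / ρ)) := by
      push_cast; ring
    linarith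
  have hcΛ : 1 ≤ c * Λ ^ (k + 3) := one_le_mul_of_one_le_of_one_le hc1 hΛk
  have h3 : 1 / ρ * K ≤ 2000000 * (r * c * Λ ^ (k + 4)) := by
    have e1 : 1 / ρ * cg ≤ 1500000 * (r * Λ * 1) := by
      calc 1 / ρ * cg ≤ 1 / ρ * (500000 * Λ * σ) := by gcongr
        _ = 500000 * Λ * (1 / ρ * σ) := by ring
        _ ≤ 500000 * Λ * (3 * r) := by gcongr
        _ = _ := by ring
    have e2 : 1 / ρ * (r' * c * Λ ^ (k + 3) * V) ≤ 54 * (r * c * Λ ^ (k + 4)) := by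
      calc 1 / ρ * (r' * c * Λ ^ (k + 3) * V) = (1 / ρ * r') * (c * Λ ^ (k + 3)) * V := by ring
        _ ≤ (3 * r) * (c * Λ ^ (k + 3)) * (18 * Λ) := by gcongr
        _ = _ := by ring
    have e3 : 1 / ρ * 10 ≤ 10 * (r * Λ * 1) := by
      have : r ≤ r * Λ := le_mul_of_one_le_right (by linarith) hΛ
      linarith
    have e4 : r * Λ * 1 ≤ r * Λ * (c * Λ ^ (k + 3)) := by gcongr
    have e5 : r * Λ * (c * Λ ^ (k + 3)) = r * c * Λ ^ (k + 4) := by ring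
    have e6 : 0 ≤ r * c * Λ ^ (k + 4) := by positivity
    rw [hK, mul_add, mul_add]
    linarith
  have hK1 : 1 ≤ K := by linarith
  have h4 : 1 ≤ W * (1 / ρ) * K := one_le_mul_of_one_le_of_one_le hWρ hK1
  have h5 : 0 ≤ W * (r * c * Λ ^ (k + 4)) := by positivity
  calc 4 + (lg * (3 / ρ) + 2) * K ≤ 4 + 887 * (W * (1 / ρ)) * K := by gcongr
    _ ≤ 891 * (W * (1 / ρ * K)) := by linarith
    _ ≤ 891 * (W * (2000000 * (r * c * Λ ^ (k + 4)))) := by gcongr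
    _ ≤ 10 ^ 22 * (W * (r * c * Λ ^ (k + 4))) := by linarith
    _ = r * (10 ^ 22) ^ (k + 2) * Λ ^ (k + 4) * W := by rw [hc]; ring

end

/-! ### Induction on the depth of the recursion -/

/-- `L` at most doubles and `m_x` does not decrease, so each level spends at most `log 2` of the
logarithmic budget. -/
theorem log_hssParams_ratio_le {P : Params} (hP : P.Ok) {k : ℕ} (hk : k ≠ 0) :
    Real.log ((hssParams k P).L / (hssParams k P).mx) ≤ Real.log 2 + Real.log (P.L / P.mx) := by
  have hL := hP.L_pos
  have hmx := hP.mx_pos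
  have hρ := hssRho_pos (k := k) hP
  have hρ1 := hssRho_le_one (k := k) hP
  have hP' := hssParams_ok hP hk
  have hL' := hP'.L_pos
  have hm' := hP'.mx_pos
  rw [← Real.log_mul two_ne_zero (by positivity)]
  refine Real.log_le_log (by positivity) ?_
  have h1 : (hssParams k P).L ≤ 2 * P.L := by
    refine max_le (hssParams_Lx_le hP hk) ?_
    rw [hssParams_Lxy]; linarith [hP.Lxy_le]
  have h2 : P.mx ≤ (hssParams k P).mx := by
    rw [hssParams_mx hP, le_div_iff₀ hρ]
    exact mul_le_of_le_one_right hmx.le hρ1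
  rw [← mul_div_assoc]
  gcongr

/-- One `Λ` is used at all levels: the hypothesis reserves `log 2` for every remaining level.
Problem, parameters, start and precision vary with the level and are therefore quantified inside the
induction. -/
theorem meets_rhss (k : ℕ) : ∀ {P : Params} {Λ : ℝ}, P.Ok → 1 ≤ Λ →
    (k : ℝ) * Real.log 2 + Real.log (P.L / P.mx) ≤ Λ → ∀ {Q : QuadSaddle n m},
    Q.Bounded P.mx P.my P.Lx P.Lx P.Lxy → ∀ (z₀ : PVec n m) {ε : ℝ}, 0 < ε →
    (rhss (k + 1) P Q z₀ ε).Meets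
      (rate (k + 1) P * (10 ^ 22) ^ (k + 1) * Λ ^ (k + 3) * (Λ + max 0 (Real.log (1 / ε))))
      (fun z => ‖Q.op z - Q.rhs‖ ≤ epsTilde P ε * ‖Q.op z₀ - Q.rhs‖) := by
  induction k with
  | zero =>
    intro P Λ hP hΛ hΛR Q hQ z₀ ε hε
    have h := meets_pbr hP hQ z₀ hε
    refine h.mono ((pbr_cost_le hP hΛ (by simpa using hΛR) hε).trans (le_of_eq ?_))
      (fun _ h => h)
    ring
  | succ k ih =>
    intro P Λ hP hΛ hΛR Q hQ z₀ ε hε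
    have hk : k + 2 ≠ 0 := by omega
    have hP' := hssParams_ok hP hk
    have hlog := log_hssParams_ratio_le hP hk
    have hr0 := rate_nonneg (k + 1) (hssParams (k + 2) P)
    have hl2 : 0 ≤ Real.log 2 := Real.log_nonneg (by norm_num)
    push_cast at hΛR
    have hΛR' : Real.log (P.L / P.mx) ≤ Λ := by
      have : 0 ≤ ((k : ℝ) + 1) * Real.log 2 := by positivity
      linarith
    have hδ : 0 < 1 / (16 * P.Lxy / P.my) := by
      have := hP.Lxy_pos
      have := hP.my_pos
      positivity
    exact (meets_rhss_succ hP hQ (fun R z hR => ih hP' hΛ (by linarith) hR z hδ)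
      (by positivity) z₀ hε).mono (rhss_cost_le hP hΛ hΛR' k hε) (fun _ h => h)

/-! ### From the function class and the saddle point to operators -/

theorem symBdd_of_posSemidef {d : ℕ} {M : Matrix (Fin d) (Fin d) ℝ} {l u : ℝ}
    (hl : (M - l • (1 : Matrix (Fin d) (Fin d) ℝ)).PosSemidef)
    (hu : (u • (1 : Matrix (Fin d) (Fin d) ℝ) - M).PosSemidef) :
    SymBdd (Matrix.toEuclideanLin M) l u := by
  have key : ∀ {N : Matrix (Fin d) (Fin d) ℝ}, N.PosSemidef → ∀ x : Vec d,
      0 ≤ ⟪x, Matrix.toEuclideanLin N x⟫_ℝ := fun {N} hN x => by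
    have := (Matrix.isPositive_toEuclideanLin_iff.2 hN).inner_nonneg_right x
    simpa using this
  have hM : M.IsHermitian := by
    have h := hl.isHermitian.add (Matrix.isHermitian_one.smul (k := l) (.all l))
    simpa using h
  refine ⟨fun x y => ?_, fun x => ?_, fun x => ?_⟩
  · exact (Matrix.isSymmetric_toEuclideanLin_iff.2 hM) x y
  · have h := key hl x
    rw [map_sub, map_smul, LinearMap.sub_apply, LinearMap.smul_apply, toEuclideanLin_one,
      inner_sub_right, inner_smul_right, real_inner_self_eq_norm_sq] at h
    linarith
  · have h := key hu x
    rw [map_sub, map_smul, LinearMap.sub_apply, LinearMap.smul_apply, toEuclideanLin_one,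
      inner_sub_right, inner_smul_right, real_inner_self_eq_norm_sq] at h
    linarith

theorem QuadSaddle.InClass.bounded {Q : QuadSaddle n m} {mx my Lx Lxy Ly : ℝ}
    (h : Q.InClass mx my Lx Lxy Ly) : Q.Bounded mx my Lx Ly Lxy :=
  ⟨symBdd_of_posSemidef h.A_lower h.A_upper, symBdd_of_posSemidef h.C_lower h.C_upper, h.B_norm⟩

/-- First-order optimality for a quadratic function. -/
theorem SymBdd.stationary {E : Type*} [NormedAddCommGroup E] [InnerProductSpace ℝ E]
    {M : E →ₗ[ℝ] E} {l u : ℝ} (h : SymBdd M l u) (hu : 0 < u) {g x₀ : E}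
    (hmin : ∀ x, 1 / 2 * ⟪x₀, M x₀⟫_ℝ + ⟪g, x₀⟫_ℝ ≤ 1 / 2 * ⟪x, M x⟫_ℝ + ⟪g, x⟫_ℝ) :
    M x₀ + g = 0 := by
  set G := M x₀ + g with hG
  have h1 := hmin (x₀ - (1 / u) • G)
  have h2 := h.upper G
  have h3 : ⟪G, G⟫_ℝ = ⟪M x₀, G⟫_ℝ + ⟪g, G⟫_ℝ := by
    conv_lhs => rw [hG]
    rw [← hG, inner_add_left]
  have h4 : ⟪x₀, M G⟫_ℝ = ⟪M x₀, G⟫_ℝ := (h.symm _ _).symm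
  rw [map_sub, map_smul, inner_sub_left, inner_sub_right, inner_sub_right, inner_sub_right,
    inner_smul_left, inner_smul_left, inner_smul_right, inner_smul_right, inner_smul_right, h4,
    real_inner_comm (M x₀) G] at h1
  rw [real_inner_self_eq_norm_sq] at h3
  simp only [conj_trivial] at h1
  have h5 : (1 / u) * ((1 / u) * ⟪G, M G⟫_ℝ) ≤ (1 / u) * ‖G‖ ^ 2 := by
    have : (1 / u) * ⟪G, M G⟫_ℝ ≤ ‖G‖ ^ 2 := by
      rw [one_div, inv_mul_le_iff₀ hu]; exact h2
    gcongr
  have h6 : (1 / u) * ‖G‖ ^ 2 = (1 / u) * ⟪M x₀, G⟫_ℝ + (1 / u) * ⟪g, G⟫_ℝ := by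
    rw [h3, mul_add]
  have h7 : (1 / u) * ‖G‖ ^ 2 ≤ 0 := by linarith
  have h8 : ‖G‖ ^ 2 ≤ 0 := by
    by_contra hc
    have : 0 < (1 / u) * ‖G‖ ^ 2 := mul_pos (by positivity) (not_le.1 hc)
    linarith
  have h9 : ‖G‖ = 0 := by
    have := sq_nonneg ‖G‖
    exact pow_eq_zero_iff two_ne_zero |>.1 (le_antisymm h8 this)
  exact norm_eq_zero.1 h9

theorem QuadSaddle.IsSaddle.op_eq {Q : QuadSaddle n m} {mx my lx ly q : ℝ} {z : PVec n m}
    (hz : Q.IsSaddle z) (h : Q.Bounded mx my lx ly q) (hx : 0 < lx) (hy : 0 < ly) :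
    Q.op z = Q.rhs := by
  have h1 : matVec Q.A z.fst + (matVec Q.B z.snd + Q.u) = 0 := by
    refine h.A.stationary hx fun x => ?_
    have := (hz x z.snd).1
    unfold value at this
    rw [inner_add_left, inner_add_left, real_inner_comm z.fst, real_inner_comm x]
    unfold matVec at *
    linarith
  have hB : ∀ y, ⟪matVec Q.B.transpose z.fst, y⟫_ℝ = ⟪z.fst, matVec Q.B y⟫_ℝ :=
    inner_matVec_transpose Q.B z.fst
  have h2 : matVec Q.C z.snd + -(matVec Q.B.transpose z.fst + Q.v) = 0 := by
    refine h.C.stationary hy fun y => ?_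
    have := (hz z.fst y).2
    unfold value at this
    rw [inner_neg_left, inner_neg_left, inner_add_left, inner_add_left, hB, hB]
    unfold matVec at *
    linarith
  refine pvec_ext ?_ ?_
  · rw [op_fst, rhs_fst, eq_neg_iff_add_eq_zero, add_assoc]; exact h1
  · rw [op_snd, rhs_snd, ← sub_eq_zero, ← h2]; abel

/-- A point with relative residual `epsTilde P (ε / ‖z₀ - z*‖)` is `ε`-close to the solution. -/
theorem norm_sub_le_of_residual_le {P : Params} (hP : P.Ok) {Q : QuadSaddle n m}
    (hQ : Q.Bounded P.mx P.my P.Lx P.Lx P.Lxy) {zs z₀ z : PVec n m} (hs : Q.op zs = Q.rhs)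
    (hne : z₀ ≠ zs) {ε : ℝ} (hε : 0 < ε)
    (hz : ‖Q.op z - Q.rhs‖ ≤ epsTilde P (ε / ‖z₀ - zs‖) * ‖Q.op z₀ - Q.rhs‖) :
    ‖z - zs‖ ≤ ε := by
  have hmx := hP.mx_pos
  have hxy := hP.Lxy_pos
  have hLx := hP.Lx_pos
  have hd : 0 < ‖z₀ - zs‖ := norm_pos_iff.2 (sub_ne_zero.2 hne)
  have h1 := mul_norm_le_of_monotone (hQ.monotone le_rfl hP.mx_le) (z - zs)
  have h2 := hQ.norm_op_le hmx.le hP.my_pos.le hxy.le hLx le_rfl le_rfl (z₀ - zs)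
  rw [map_sub, hs] at h1 h2
  have h3 : 0 ≤ epsTilde P (ε / ‖z₀ - zs‖) := by unfold epsTilde; positivity
  refine le_of_mul_le_mul_left (h1.trans (hz.trans ?_)) hmx
  calc _ ≤ epsTilde P (ε / ‖z₀ - zs‖) * ((P.Lx + P.Lxy) * ‖z₀ - zs‖) := by gcongr
    _ = P.mx * ε := by unfold epsTilde; field_simp; ring

end SaddleQuad

/-! ### The complexity bound -/

theorem theorem4 :
    ∃ C₁ C₂ : ℝ, 0 < C₁ ∧ 0 < C₂ ∧
      ∀ (k : ℕ), 1 ≤ k →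
      ∀ (n m : ℕ) (Q : SaddleQuad.QuadSaddle n m) (mx my Lx Lxy Ly L : ℝ),
        0 < mx → mx ≤ my → my ≤ Lxy → my ≤ Lx → Lx = Ly → L = max Lx (max Lxy Ly) →
        Q.InClass mx my Lx Lxy Ly →
      ∀ (zstar z₀ : SaddleQuad.PVec n m), Q.IsSaddle zstar → z₀ ≠ zstar →
      ∀ (ε : ℝ), 0 < ε →
        ∃ (zT : SaddleQuad.PVec n m) (N : ℕ),
          (SaddleQuad.rhss k { mx := mx, my := my, Lxy := Lxy, Lx := Lx } Q z₀
            (ε / ‖z₀ - zstar‖)).run = some (zT, N) ∧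
          ‖zT - zstar‖ ≤ ε ∧
          (N : ℝ) ≤
            √(Lxy ^ 2 / (mx * my)
                + (Lx / mx + Ly / my) * (1 + (Lxy / max mx my) ^ (1 / (k : ℝ))))
              * (C₁ * max (k : ℝ) (Real.log (C₂ * L ^ 2 / (mx * my)))) ^ (k + 3)
              * max 1 (Real.log (‖z₀ - zstar‖ / ε)) := by
  -- In `4 · 10 ^ 22` the `10 ^ 22` is the loss per level, one factor `2` comes from `Λ = 2 M`, and
  -- the other from `hmax`, absorbed into the power by `hc`. Of the second constant only that it is
  -- at least `1` is used.
  refine ⟨4 * 10 ^ 22, Real.exp 1, by norm_num, Real.exp_pos 1, ?_⟩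
  intro k hk n m Q mx my Lx Lxy Ly L hmx hmxy hmyxy hmyx hLL hL hQ zs z₀ hzs hne ε hε
  obtain ⟨j, rfl⟩ : ∃ j, k = j + 1 := ⟨k - 1, by omega⟩
  subst hLL
  set P : SaddleQuad.Params := { mx := mx, my := my, Lxy := Lxy, Lx := Lx } with hPd
  have hP : P.Ok := ⟨hmx, hmxy, hmyxy, hmyx⟩
  have hPL : P.L = L := by
    rw [hL, max_comm Lxy, ← max_assoc, max_self]; rfl
  have hL0 : 0 < L := hPL ▸ hP.L_pos
  have hmy : 0 < my := hP.my_pos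
  have hmyL : my ≤ L := hPL ▸ hP.my_le
  have hxy : 0 < Lxy := hP.Lxy_pos
  have hB : Q.Bounded P.mx P.my P.Lx P.Lx P.Lxy := hQ.bounded
  have hs : Q.op zs = Q.rhs := hzs.op_eq hB hP.Lx_pos hP.Lx_pos
  have hd : 0 < ‖z₀ - zs‖ := norm_pos_iff.2 (sub_ne_zero.2 hne)
  set M := max (((j + 1 : ℕ) : ℝ)) (Real.log (Real.exp 1 * L ^ 2 / (mx * my))) with hM
  have hMk : ((j + 1 : ℕ) : ℝ) ≤ M := le_max_left _ _
  have hMl : Real.log (L / mx) ≤ M := by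
    refine le_trans (Real.log_le_log (by positivity) ?_) (le_max_right _ _)
    have h1 : 1 ≤ L / my := by rwa [le_div_iff₀ hmy, one_mul]
    have h2 : 1 ≤ Real.exp 1 := Real.one_le_exp zero_le_one
    calc L / mx ≤ L / mx * (Real.exp 1 * (L / my)) :=
          le_mul_of_one_le_right (by positivity) (one_le_mul_of_one_le_of_one_le h2 h1)
      _ = _ := by field_simp
  push_cast at hMk
  have hj : (0 : ℝ) ≤ j := Nat.cast_nonneg j
  have hlog2 : (j : ℝ) * Real.log 2 ≤ j := by
    refine mul_le_of_le_one_right hj ?_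
    linarith [Real.log_le_sub_one_of_pos (show (0 : ℝ) < 2 by norm_num)]
  -- One copy of `M` covers `j log 2` because `M ≥ k`, the other covers `log (L / m_x)`.
  obtain ⟨zT, N, hrun, hN, hpost⟩ := SaddleQuad.meets_rhss j (Λ := 2 * M) hP (by linarith)
    (by rw [hPL]; change _ + Real.log (L / mx) ≤ _; linarith) hB z₀ (div_pos hε hd)
  refine ⟨zT, N, hrun, SaddleQuad.norm_sub_le_of_residual_le hP hB hs hne hε hpost, hN.trans ?_⟩
  have hrate : SaddleQuad.rate (j + 1) P = √(Lxy ^ 2 / (mx * my)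
      + (Lx / mx + Lx / my) * (1 + (Lxy / max mx my) ^ (1 / ((j + 1 : ℕ) : ℝ)))) := by
    unfold SaddleQuad.rate SaddleQuad.hssRho
    rw [max_eq_right hmxy, one_div ((P.my / P.Lxy) ^ _),
      ← Real.inv_rpow (div_pos hmy hxy).le, inv_div]
  rw [← hrate, one_div_div]
  have hr := SaddleQuad.rate_nonneg (j + 1) P
  set x := Real.log (‖z₀ - zs‖ / ε)
  set r := SaddleQuad.rate (j + 1) P
  have hM1 : 1 ≤ M := by linarith
  -- Bounding the sum by a product turns the additive `Λ` into one more power, which raises the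
  -- exponent from `j + 3` to `k + 3`.
  have hmax : 2 * M + max 0 x ≤ 2 * (2 * M) * max 1 x := by
    have h1 : 1 ≤ max 1 x := le_max_left _ _
    have h2 : max 0 x ≤ max 1 x := max_le_max_right x zero_le_one
    nlinarith
  have hc : 2 * ((10 : ℝ) ^ 22) ^ (j + 1) ≤ (2 * 10 ^ 22) ^ (j + 1 + 3) := by
    calc 2 * ((10 : ℝ) ^ 22) ^ (j + 1) ≤ (2 * 10 ^ 22) ^ 3 * (2 * 10 ^ 22) ^ (j + 1) := by
          gcongr <;> norm_num
      _ = _ := by ring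
  calc r * (10 ^ 22) ^ (j + 1) * (2 * M) ^ (j + 3) * (2 * M + max 0 x)
      ≤ r * (10 ^ 22) ^ (j + 1) * (2 * M) ^ (j + 3) * (2 * (2 * M) * max 1 x) := by gcongr
    _ = r * ((2 * (10 ^ 22) ^ (j + 1)) * (2 * M) ^ (j + 1 + 3)) * max 1 x := by ring
    _ ≤ r * ((2 * 10 ^ 22) ^ (j + 1 + 3) * (2 * M) ^ (j + 1 + 3)) * max 1 x := by gcongr
    _ = r * (4 * 10 ^ 22 * M) ^ (j + 1 + 3) * max 1 x := by
        rw [← mul_pow]; congr 3; ring
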